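/- Let $M(c)=(M^{2n+1},\phi,\xi,\eta,g)$ be a Sasakian space form, that is, a contact metric manifold ($\phi^2=-\mathrm{id}+\eta\otimes\xi$, $\eta(\xi)=1$, $g(\phi X,\phi Y)=g(X,Y)-\eta(X)\eta(Y)$, $d\eta(X,Y)=g(X,\phi Y)$, where $2\,d\eta(X,Y)=X\eta(Y)-Y\eta(X)-\eta([X,Y])$) which is normal ($N_\phi=-2\,d\eta\otimes\xi$) and all of whose $\phi$-sections (the planes spanned by $v$ and $\phi v$ with $v\neq 0$, $\eta(v)=0$) have the same constant sectional curvature $c$. Let $\nabla$ be the Levi-Civita connection of $g$, and suppose $c\neq 1$. Let $J\subset\mathbb{R}$ be an open interval and let $\gamma:J\to M(c)$ be a smooth curve parametrized by arc length, with $T=\gamma'$, which is a Legendre curve ($\eta(T)=0$) and a Frenet curve of osculating order $r$: there are smooth orthonormal vector fields $E_1=T,E_2,\dots,E_r$ along $\gamma$ and functions $k_1\ge 0,k_2,\dots,k_{r-1}$ on $J$ with $$\nabla_T E_1=k_1E_2,\qquad \nabla_TE_i=-k_{i-1}E_{i-1}+k_iE_{i+1}\ (2\le i\le r-1),\qquad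 \nabla_TE_r=-k_{r-1}E_{r-1},$$ and put $k_i=0$ for $i\ge r$ (for $r=1$ the equations reduce to $\nabla_TE_1=0$). Suppose that $\gamma$ is not a geodesic ($k_1$ does not vanish identically) and that $\phi T\parallel E_2$ along $\gamma$. Let $\delta_1,\delta_2$ be real constants with $\delta_2\neq0$ and $\delta_1/\delta_2\neq 0$. Call $\gamma$ interpolating sesqui-harmonic if for every compact interval $[a,b]\subset J$ it is a critical point, with respect to all smooth variations of $\gamma$ supported in $[a,b]$, of $$E_{\delta_1,\delta_2}(\gamma)=\delta_1\int_a^b\|\gamma'\|^2\,dt+\delta_2\int_a^b\|\nabla_{\gamma'}\gamma'\|^2\,dt .$$ Then $\gamma$ is interpolating sesqui-harmonic if and only if, on $J$, $$k_1=\text{constant}>0,\qquad k_2=\text{constant},\qquad k_1^2+k_2^2=c-\frac{\delta_1}{\delta_2},\qquad k_2k_3=0 .$$ -/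

import Mathlib

open Set
open scoped Manifold ContDiff Topology Bundle

noncomputable section

namespace SesquiHarmonic

section Definitions

variable {E : Type*} [NormedAddCommGroup E] [NormedSpace ℝ E] [FiniteDimensional ℝ E]
  {H : Type*} [TopologicalSpace H] {I : ModelWithCorners ℝ E H}
  {M : Type*} [TopologicalSpace M] [ChartedSpace H M]

/-! ### Vector fields and connections -/

/-- `X` is a smooth vector field on `M`. -/
def IsSmoothField [IsManifold I ∞ M] (X : ∀ x : M, TangentSpace I x) : Prop :=
  ContMDiff I I.tangent ∞ (fun x : M => (⟨x, X x⟩ : TangentBundle I M))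

/-- `cov` is the Levi-Civita connection of the Riemannian metric of `M`: the smooth connection on
the tangent bundle that is torsion free, `∇_X Y - ∇_Y X = [X, Y]`, and compatible with the metric,
`X g(Y, Z) = g(∇_X Y, Z) + g(Y, ∇_X Z)`. (In Mathlib's convention
`cov Y x (X x)` is `(∇_X Y)(x)`.) -/
structure IsLeviCivita [IsManifold I ∞ M]
    [Bundle.RiemannianBundle (fun x : M => TangentSpace I x)]
    [IsContMDiffRiemannianBundle I ∞ E (fun x : M => TangentSpace I x)]
    (cov : CovariantDerivative I E (fun x : M => TangentSpace I x)) : Prop where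
  smooth : cov.ContMDiffCovariantDerivative ∞
  torsion_free : cov.torsion = 0
  metric : ∀ (x : M) (X Y Z : ∀ x : M, TangentSpace I x),
    MDifferentiableAt I I.tangent (fun y : M => (⟨y, Y y⟩ : TangentBundle I M)) x →
    MDifferentiableAt I I.tangent (fun y : M => (⟨y, Z y⟩ : TangentBundle I M)) x →
    mvfderiv I (fun y : M => (inner ℝ (Y y) (Z y) : ℝ)) x (X x) =
      inner ℝ (cov Y x (X x)) (Z x) + inner ℝ (Y x) (cov Z x (X x))

/-- The curvature `R(X, Y)Z = ∇_X ∇_Y Z - ∇_Y ∇_X Z - ∇_{[X, Y]} Z` of a connection. -/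
def curvature [IsManifold I ∞ M] (cov : CovariantDerivative I E (fun x : M => TangentSpace I x))
    (X Y Z : ∀ x : M, TangentSpace I x) (x : M) : TangentSpace I x :=
  cov (fun y => cov Z y (Y y)) x (X x) - cov (fun y => cov Z y (X y)) x (Y x)
    - cov Z x (VectorField.mlieBracket I X Y x)

/-! ### Sasakian space forms -/

/-- Exterior derivative of a one-form, in the normalization
`2 dη(X, Y) = X(η(Y)) - Y(η(X)) - η([X, Y])` that is usual in contact geometry. -/
def extDeriv (η : ∀ x : M, TangentSpace I x →L[ℝ] ℝ)
    (X Y : ∀ x : M, TangentSpace I x) (x : M) : ℝ :=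
  (1 / 2) * (mvfderiv I (fun y => η y (Y y)) x (X x) - mvfderiv I (fun y => η y (X y)) x (Y x)
    - η x (VectorField.mlieBracket I X Y x))

/-- The Nijenhuis tensor
`N_φ(X, Y) = φ²[X, Y] + [φX, φY] - φ[φX, Y] - φ[X, φY]` of a `(1,1)`-tensor field. -/
def nijenhuis (φ : ∀ x : M, TangentSpace I x →L[ℝ] TangentSpace I x)
    (X Y : ∀ x : M, TangentSpace I x) (x : M) : TangentSpace I x :=
  φ x (φ x (VectorField.mlieBracket I X Y x))
    + VectorField.mlieBracket I (fun y => φ y (X y)) (fun y => φ y (Y y)) x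
    - φ x (VectorField.mlieBracket I (fun y => φ y (X y)) Y x)
    - φ x (VectorField.mlieBracket I X (fun y => φ y (Y y)) x)

/-- `(φ, ξ, η)` together with the Riemannian metric of `M` is an almost contact metric structure. -/
structure IsAlmostContactMetric [IsManifold I ∞ M]
    [Bundle.RiemannianBundle (fun x : M => TangentSpace I x)]
    (φ : ∀ x : M, TangentSpace I x →L[ℝ] TangentSpace I x)
    (ξ : ∀ x : M, TangentSpace I x) (η : ∀ x : M, TangentSpace I x →L[ℝ] ℝ) : Prop where
  smooth_phi : ContMDiff I (I.prod 𝓘(ℝ, E →L[ℝ] E)) ∞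
    (fun x : M => Bundle.TotalSpace.mk' (E →L[ℝ] E)
      (E := fun x : M => TangentSpace I x →L[ℝ] TangentSpace I x) x (φ x))
  smooth_xi : IsSmoothField ξ
  smooth_eta : ContMDiff I (I.prod 𝓘(ℝ, E →L[ℝ] ℝ)) ∞
    (fun x : M => Bundle.TotalSpace.mk' (E →L[ℝ] ℝ)
      (E := fun x : M => TangentSpace I x →L[ℝ] ℝ) x (η x))
  phi_phi : ∀ (x : M) (v : TangentSpace I x), φ x (φ x v) = -v + η x v • ξ x
  eta_xi : ∀ x : M, η x (ξ x) = 1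
  inner_phi_phi : ∀ (x : M) (v w : TangentSpace I x),
    inner ℝ (φ x v) (φ x w) = inner ℝ v w - η x v * η x w

/-- `(φ, ξ, η, g)` is a Sasakian structure: a contact metric structure (an almost contact metric
structure with `dη(X, Y) = g(X, φY)`) that is normal, i.e. `N_φ = -2 dη ⊗ ξ`. -/
structure IsSasakian [IsManifold I ∞ M]
    [Bundle.RiemannianBundle (fun x : M => TangentSpace I x)]
    (φ : ∀ x : M, TangentSpace I x →L[ℝ] TangentSpace I x)
    (ξ : ∀ x : M, TangentSpace I x) (η : ∀ x : M, TangentSpace I x →L[ℝ] ℝ) : Prop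
    extends IsAlmostContactMetric φ ξ η where
  contact : ∀ X Y : ∀ x : M, TangentSpace I x, IsSmoothField X → IsSmoothField Y →
    ∀ x : M, extDeriv η X Y x = inner ℝ (X x) (φ x (Y x))
  normal : ∀ X Y : ∀ x : M, TangentSpace I x, IsSmoothField X → IsSmoothField Y →
    ∀ x : M, nijenhuis φ X Y x = -((2 * extDeriv η X Y x) • ξ x)

/-- Every `φ`-section, i.e. every plane spanned by `v` and `φ v` with `v` a unit tangent vector
with `η(v) = 0`, has sectional curvature `g(R(v, φv)φv, v) = c`. Tangent vectors are the values
of smooth vector fields. -/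
def HasConstantPhiSectionalCurvature [IsManifold I ∞ M]
    [Bundle.RiemannianBundle (fun x : M => TangentSpace I x)]
    (cov : CovariantDerivative I E (fun x : M => TangentSpace I x))
    (φ : ∀ x : M, TangentSpace I x →L[ℝ] TangentSpace I x)
    (η : ∀ x : M, TangentSpace I x →L[ℝ] ℝ) (c : ℝ) : Prop :=
  ∀ X : ∀ x : M, TangentSpace I x, IsSmoothField X → ∀ x : M, η x (X x) = 0 → ‖X x‖ = 1 →
    inner ℝ (curvature cov X (fun y => φ y (X y)) (fun y => φ y (X y)) x) (X x) = c

/-! ### Curves -/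

/-- The velocity vector `γ'(t)`. -/
def velocity (γ : ℝ → M) (t : ℝ) : TangentSpace I (γ t) :=
  mfderiv 𝓘(ℝ, ℝ) I γ t (1 : ℝ)

/-- The covariant derivative `∇_T V` of a vector field `V` along the curve `γ`. In the chart around
`γ t`, write `V = ∑ vⁱ ∂ᵢ`; then `∇_T V = ∑ (vⁱ)' ∂ᵢ + ∑ vⁱ ∇_{γ'} ∂ᵢ` at `t`. Here
`FiberBundle.extend E (V t)` is the vector field `∑ vⁱ(t) ∂ᵢ`, with constant coefficients in that
chart. -/
def covDerivAlong [IsManifold I ∞ M]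
    (cov : CovariantDerivative I E (fun x : M => TangentSpace I x))
    (γ : ℝ → M) (V : ∀ t : ℝ, TangentSpace I (γ t)) (t : ℝ) : TangentSpace I (γ t) :=
  (trivializationAt E (fun x : M => TangentSpace I x) (γ t)).symm (γ t)
      (deriv (fun s : ℝ =>
        ((trivializationAt E (fun x : M => TangentSpace I x) (γ t)) ⟨γ s, V s⟩).2) t)
    + cov (FiberBundle.extend E (V t)) (γ t) (velocity (I := I) γ t)

/-- The tension field `τ(γ) = tr(∇dγ) = ∇_T T` of a curve. -/
def tension [IsManifold I ∞ M]
    (cov : CovariantDerivative I E (fun x : M => TangentSpace I x))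
    (γ : ℝ → M) (t : ℝ) : TangentSpace I (γ t) :=
  covDerivAlong cov γ (velocity (I := I) γ) t

/-- The functional `E_{δ₁,δ₂}(γ) = δ₁ ∫ ‖dγ‖² + δ₂ ∫ ‖τ(γ)‖²` over `[a, b]`. -/
def sesquiEnergy [IsManifold I ∞ M]
    [Bundle.RiemannianBundle (fun x : M => TangentSpace I x)]
    (cov : CovariantDerivative I E (fun x : M => TangentSpace I x))
    (δ₁ δ₂ : ℝ) (a b : ℝ) (γ : ℝ → M) : ℝ :=
  δ₁ * (∫ t in a..b, ‖velocity (I := I) γ t‖ ^ 2) + δ₂ * (∫ t in a..b, ‖tension cov γ t‖ ^ 2)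

/-- `γ : J → M` (`J` an open interval) is interpolating sesqui-harmonic: it is a critical point of
`E_{δ₁,δ₂}` on every compact interval `[a, b] ⊆ J`, for all smooth variations `Γ` of `γ` supported
in `[a, b]`. -/
def IsInterpolatingSesquiHarmonic [IsManifold I ∞ M]
    [Bundle.RiemannianBundle (fun x : M => TangentSpace I x)]
    (cov : CovariantDerivative I E (fun x : M => TangentSpace I x))
    (δ₁ δ₂ : ℝ) (J : Set ℝ) (γ : ℝ → M) : Prop :=
  ∀ a b : ℝ, a < b → Icc a b ⊆ J → ∀ ε : ℝ, 0 < ε → ∀ Γ : ℝ → ℝ → M,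
    ContMDiffOn 𝓘(ℝ, ℝ × ℝ) I ∞ (fun p : ℝ × ℝ => Γ p.1 p.2) (Ioo (-ε) ε ×ˢ J) →
    (∀ t ∈ J, Γ 0 t = γ t) →
    (∀ s ∈ Ioo (-ε) ε, ∀ t ∈ J \ Ioo a b, Γ s t = γ t) →
    HasDerivAt (fun s : ℝ => sesquiEnergy cov δ₁ δ₂ a b (Γ s)) 0 0

/-- The curve `γ : J → M`, parametrized by arc length, is a Frenet curve of osculating order `r`
with Frenet frame `F 1 = T, …, F r` and curvatures `k 1, …, k (r - 1)`. The conventions `k 0 = 0`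
and `k i = 0` for `i ≥ r` give all Frenet equations the same form; `F 0` and `F (r + 1)` only occur
with coefficient `0`. The first curvature is nonnegative; no sign is required of the others. -/
structure IsFrenetCurve [IsManifold I ∞ M]
    [Bundle.RiemannianBundle (fun x : M => TangentSpace I x)]
    (cov : CovariantDerivative I E (fun x : M => TangentSpace I x))
    (J : Set ℝ) (γ : ℝ → M) (r : ℕ)
    (F : ℕ → ∀ t : ℝ, TangentSpace I (γ t)) (k : ℕ → ℝ → ℝ) : Prop where
  smooth : ContMDiffOn 𝓘(ℝ, ℝ) I ∞ γ J
  one_le_order : 1 ≤ r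
  smooth_frame : ∀ i ∈ Finset.Icc 1 r,
    ContMDiffOn 𝓘(ℝ, ℝ) I.tangent ∞ (fun t : ℝ => (⟨γ t, F i t⟩ : TangentBundle I M)) J
  orthonormal : ∀ t ∈ J, ∀ i ∈ Finset.Icc 1 r, ∀ j ∈ Finset.Icc 1 r,
    inner ℝ (F i t) (F j t) = if i = j then (1 : ℝ) else 0
  frame_one : ∀ t ∈ J, F 1 t = velocity (I := I) γ t
  curvature_zero : ∀ t ∈ J, k 0 t = 0
  curvature_of_ge : ∀ i, r ≤ i → ∀ t ∈ J, k i t = 0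
  curvature_one_nonneg : ∀ t ∈ J, 0 ≤ k 1 t
  frenet : ∀ i ∈ Finset.Icc 1 r, ∀ t ∈ J,
    covDerivAlong cov γ (F i) t = -(k (i - 1) t • F (i - 1) t) + k i t • F (i + 1) t

/-- `γ : J → M` is a Legendre curve: an integral curve of the contact distribution `η = 0`. -/
def IsLegendre (η : ∀ x : M, TangentSpace I x →L[ℝ] ℝ) (J : Set ℝ) (γ : ℝ → M) : Prop :=
  ∀ t ∈ J, η (γ t) (velocity (I := I) γ t) = 0

end Definitions

end SesquiHarmonic

end

/-! The hypothesis `φT ∥ E₂` is very rigid. Write `φT = aE₂`, so that `a² = 1`. Computing `∇_T(φT)`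
on the one hand by the Frenet equations, on the other by `(∇_Xφ)Y = g(X,Y)ξ - η(Y)X`, gives `ξ = a
k₂ E₃`. Hence `r ≥ 3` and `k₂² = 1`, and differentiating `E₃ = ±ξ` with `∇_Tξ = -φT ∥ E₂` gives `k₃
= 0`. This is `IsFrenetCurve.phi_parallel`. The conditions on `k₂` alone and on `k₂k₃` are therefore
automatic, and only `k₁` is left to determine.

For such a curve `τ = ∇_T T = k₁E₂` is a multiple of `φT`, so the only curvature entering the first
variation is `R(φT,T)T = cφT`. This follows from constancy of the `φ`-sectional curvature by
polarization (`curvature_phi_section`), without the full curvature tensor. Differentiating under the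
integral and integrating by parts (`hasDerivAt_sesquiEnergy`) yields the Euler-Lagrange equation
`δ₂(∇_T²τ + cτ) - δ₁τ = 0`; compactly supported variations with field `χ · W`, `W` the left side,
show that it is also necessary.

In the frame `T, E₂, ξ`, whose covariant derivatives close up, the `ξ`-component of `W` is `2δ₂ a
k₁'` and the `E₂`-component is `δ₂(k₁'' - k₁³ - k₁ + ck₁) - δ₁k₁` (`eulerLagrange_frame`). Vanishing
of the former makes `k₁` constant; it is positive because the curve is not a geodesic, and then the
latter says `k₁² + 1 = c - δ₁/δ₂`. Conversely these relations annihilate all components.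

All tensor identities are proved in a chart, where metric, connection, `φ`, `ξ`, `η` become maps on
an open subset of `E`. The formulas for `∇ξ` and `∇φ` are derived from the contact and normality
conditions by the pointwise algebra of `sasaki_aux`. -/

namespace SesquiHarmonic

/-! ### Linear algebra of almost contact metric structures -/

section LinearAlgebra

variable {E : Type*} [NormedAddCommGroup E] [NormedSpace ℝ E]

/-- An almost contact metric structure on a vector space with scalar product `G`. -/
structure IsContactVectorSpace (G : E →L[ℝ] E →L[ℝ] ℝ) (P : E →L[ℝ] E) (ξ : E) (η : E →L[ℝ] ℝ) :
    Prop where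
  symm : ∀ v w, G v w = G w v
  pos : ∀ v, v ≠ 0 → 0 < G v v
  phi_phi : ∀ v, P (P v) = -v + η v • ξ
  eta_xi : η ξ = 1
  inner_phi_phi : ∀ v w, G (P v) (P w) = G v w - η v * η w

namespace IsContactVectorSpace

variable {G : E →L[ℝ] E →L[ℝ] ℝ} {P : E →L[ℝ] E} {ξ : E} {η : E →L[ℝ] ℝ}

lemma eq_of_inner (h : IsContactVectorSpace G P ξ η) {v w : E} (H : ∀ z, G v z = G w z) :
    v = w := by
  by_contra hne
  have h1 := h.pos (v - w) (sub_ne_zero.mpr hne)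
  have h2 : G (v - w) (v - w) = 0 := by
    rw [ContinuousLinearMap.map_sub₂, H, sub_self]
  exact h1.ne' h2

/-- Since `φ²ξ = 0`, evaluating `φ²` on `φξ` gives `φξ = η(φξ)ξ`; a second application of `φ`,
followed by `η`, gives `η(φξ)² = 0`. -/
lemma phi_xi (h : IsContactVectorSpace G P ξ η) : P ξ = 0 := by
  have h1 : P (P ξ) = 0 := by rw [h.phi_phi, h.eta_xi, one_smul, neg_add_cancel]
  have h2 : P ξ = η (P ξ) • ξ := by
    have h3 := h.phi_phi (P ξ)
    rw [h1, map_zero] at h3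
    rw [eq_comm, neg_add_eq_zero] at h3
    exact h3
  have h4 : η (P ξ) * η (P ξ) = 0 := by
    have h5 : P (P ξ) = η (P ξ) • P ξ := by
      conv_lhs => rw [h2, map_smul]
    have h6 := congrArg η h5
    rw [h1, map_zero, map_smul, smul_eq_mul] at h6
    exact h6.symm
  rw [h2, mul_self_eq_zero.mp h4, zero_smul]

lemma eta_phi (h : IsContactVectorSpace G P ξ η) (v : E) : η (P v) = 0 := by
  have h1 := h.phi_phi (P v)
  rw [h.phi_phi v, map_add, map_neg, map_smul, h.phi_xi, smul_zero, add_zero] at h1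
  have h2 : η (P v) • ξ = 0 := by simpa using h1.symm
  have h3 := congrArg η h2
  rwa [map_smul, h.eta_xi, smul_eq_mul, mul_one, map_zero] at h3

lemma inner_xi (h : IsContactVectorSpace G P ξ η) (v : E) : G v ξ = η v := by
  have h1 := h.inner_phi_phi v ξ
  rw [h.phi_xi, map_zero, h.eta_xi] at h1
  linarith

lemma xi_inner (h : IsContactVectorSpace G P ξ η) (v : E) : G ξ v = η v := by
  rw [h.symm, h.inner_xi]

lemma phi_inner (h : IsContactVectorSpace G P ξ η) (v w : E) : G (P v) w = -G v (P w) := by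
  have h1 := h.inner_phi_phi v (P w)
  rw [h.phi_phi, h.eta_phi, map_add, map_neg, map_smul, h.inner_xi, h.eta_phi] at h1
  simp only [smul_eq_mul, mul_zero, add_zero, sub_zero] at h1
  linarith

lemma inner_self_phi (h : IsContactVectorSpace G P ξ η) (v : E) : G v (P v) = 0 := by
  have h1 := h.phi_inner v v
  rw [h.symm] at h1
  linarith

/-- The covariant derivatives `A = ∇φ`, `B = ∇ξ` and `h = ∇η` of the structure tensors of a
Sasakian manifold are determined by the first order identities that they satisfy. -/
lemma sasaki_aux (hs : IsContactVectorSpace G P ξ η)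
    {A : E → E → E} {B : E → E} {h : E → E → ℝ}
    (h1 : ∀ X Y, A X (P Y) + P (A X Y) = h X Y • ξ + η Y • B X)
    (h2 : ∀ X Y Z, G (A X Y) Z = -G Y (A X Z))
    (h3 : ∀ X Y, h X Y = G (B X) Y)
    (h4 : ∀ X, G (B X) ξ = 0)
    (h5 : ∀ X, A X ξ = -P (B X))
    (h6 : ∀ X Y Z, G Y (A X Z) + G Z (A Y X) + G X (A Z Y) = 0)
    (h7 : ∀ X Y, A (P X) Y - A (P Y) X + P (A Y X) - P (A X Y) = -((2 * G X (P Y)) • ξ))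
    (h8 : ∀ X Y, h X Y - h Y X = 2 * G X (P Y))
    (Badd : ∀ X Y, B (X + Y) = B X + B Y) (Bsmul : ∀ (a : ℝ) X, B (a • X) = a • B X) :
    (∀ X, B X = -P X) ∧ ∀ X Y, A X Y = G X Y • ξ - η Y • X := by
  -- Origin of the hypotheses: `h1` differentiates `φ² = -id + η ⊗ ξ`, `h2` the skewness of `φ`,
  -- `h3` the identity `η = g(ξ,·)`, `h4` `g(ξ,ξ) = 1`, `h5` `φξ = 0`; `h6` is `d(dη) = 0`, `h7`
  -- normality, `h8` the contact condition.
  set a : E → E → E → ℝ := fun X Y Z => G (A X Y) Z with ha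
  have askew : ∀ X Y Z, a X Y Z = -a X Z Y := fun X Y Z => by
    simp only [ha]; rw [h2, hs.symm]
  have acyc : ∀ X Y Z, a X Y Z + a Y Z X + a Z X Y = 0 := fun X Y Z => by
    have := h6 X Z Y
    rw [hs.symm Z, hs.symm Y, hs.symm X] at this
    have e1 := askew Y Z X
    have e2 := askew Z X Y
    have e3 := askew X Y Z
    simp only [ha] at *
    linarith
  have hhxi : ∀ X, h X ξ = 0 := fun X => by rw [h3, h4]
  have hxih : ∀ X, h ξ X = 0 := fun X => by
    have := h8 ξ X
    rw [hhxi, hs.xi_inner, hs.eta_phi] at this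
    linarith
  -- `a ξ` in two ways
  have e1 : ∀ X Y, a ξ X Y = h X (P Y) - h Y (P X) := fun X Y => by
    have c := acyc ξ X Y
    have d1 : a Y ξ X = h Y (P X) := by
      simp only [ha]
      rw [h5, ContinuousLinearMap.map_neg₂, hs.phi_inner, neg_neg, h3]
    have d2 : a X ξ Y = h X (P Y) := by
      simp only [ha]
      rw [h5, ContinuousLinearMap.map_neg₂, hs.phi_inner, neg_neg, h3]
    have d3 := askew X Y ξ
    linarith
  have aξξ : ∀ X, a ξ X ξ = 0 := fun X => by
    rw [e1, hs.phi_xi, hxih, h3, map_zero, sub_zero]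
  have hB0 : ∀ X, η (B X) = 0 := fun X => by rw [← hs.inner_xi, h4]
  -- The second expression is normality with `ξ` in the second slot, paired with `φY`.
  have e2 : ∀ X Y, a ξ X Y = h X (P Y) + h (P X) Y := fun X Y => by
    have c := h7 X ξ
    rw [hs.phi_xi, map_zero, mul_zero, zero_smul, neg_zero, h5, h5] at c
    -- No linearity of `A` in its first slot is available; the cyclic identity supplies the value at
    -- `0`.
    have A0 : A 0 X = 0 := by
      apply hs.eq_of_inner
      intro z
      have c1 := acyc 0 X z
      have c2 := h7 z ξ
      rw [hs.phi_xi] at c2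
      have c3 := h7 ξ ξ
      have c4 := h1 0 X
      have b0 : B 0 = 0 := by simpa using Bsmul 0 0
      have az : a z X 0 = 0 := by simp [ha]
      have az' : a X z 0 = 0 := by simp [ha]
      have s1 := askew z 0 X
      simp only [ha, map_zero, zero_apply] at *
      linarith
    rw [A0, sub_zero] at c
    have c' := congrArg (fun v => G v (P Y)) c
    simp only [map_add, map_sub, map_neg, map_zero, add_apply,
      sub_apply, neg_apply,
      zero_apply, hs.inner_phi_phi, hs.phi_phi (B X), hB0] at c'
    have hA : η (A ξ X) = 0 := by rw [← hs.inner_xi]; exact aξξ X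
    simp only [hA, zero_smul, zero_mul, sub_zero, map_zero, zero_apply,
      add_zero] at c'
    rw [h3, h3]
    simp only [ha]
    linarith
  -- Comparing `e1` and `e2` shows that `h(φX,Y) = -h(Y,φX)`, so `∇η` is skew there and equals half
  -- of its antisymmetrization, known from `h8`.
  have hphi : ∀ X Y, h (P X) Y = G (P X) (P Y) := fun X Y => by
    have d1 := e1 X Y
    have d2 := e2 X Y
    have d3 := h8 (P X) Y
    linarith
  have hX : ∀ X Y, h X Y = G X (P Y) := fun X Y => by
    have d := hphi (P X) Y
    rw [hs.phi_phi, h3, Badd, Bsmul] at d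
    have b1 : B (-X) = -B X := by simpa using Bsmul (-1) X
    have b2 : ∀ Z, G (B ξ) Z = 0 := fun Z => by rw [← h3, hxih]
    rw [b1] at d
    simp only [map_add, map_neg, map_smul, add_apply,
      neg_apply, smul_apply, b2, smul_zero, add_zero,
      hs.xi_inner, hs.eta_phi] at d
    rw [h3]
    linarith
  have hB : ∀ X, B X = -P X := fun X => by
    apply hs.eq_of_inner
    intro Z
    rw [← h3, hX, ContinuousLinearMap.map_neg₂, hs.phi_inner, neg_neg]
  refine ⟨hB, ?_⟩
  -- the difference of `a` and its expected value
  set d : E → E → E → ℝ := fun X Y Z => a X Y Z - (G X Y * η Z - η Y * G X Z) with hd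
  have dskew : ∀ X Y Z, d X Y Z = -d X Z Y := fun X Y Z => by
    simp only [hd]; rw [askew]; ring
  have dcyc : ∀ X Y Z, d X Y Z + d Y Z X + d Z X Y = 0 := fun X Y Z => by
    have := acyc X Y Z
    simp only [hd]
    rw [hs.symm Y X, hs.symm Z X, hs.symm Z Y]
    linarith
  have dphi : ∀ X Y Z, d X (P Y) Z = d X Y (P Z) := fun X Y Z => by
    have c := congrArg (fun v => G v Z) (h1 X Y)
    simp only [map_add, map_smul, add_apply, smul_apply,
      hs.phi_inner, hs.xi_inner, hX, hB, map_neg, neg_apply,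
      smul_eq_mul] at c
    simp only [hd, ha, hs.eta_phi]
    linarith
  have dN : ∀ X Y Z, d (P X) Y Z - d (P Y) X Z - d Y X (P Z) + d X Y (P Z) = 0 := fun X Y Z => by
    have c := congrArg (fun v => G v Z) (h7 X Y)
    simp only [map_add, map_sub, map_neg, map_smul, add_apply,
      sub_apply, neg_apply,
      smul_apply, hs.phi_inner, hs.xi_inner, smul_eq_mul] at c
    have s1 := hs.phi_inner X Y
    have s2 := hs.phi_inner Y X
    rw [hs.symm] at s2
    simp only [hd, ha, hs.eta_phi, hs.phi_inner, mul_zero]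
    rw [hs.symm Y (P X), hs.phi_inner]
    linarith
  -- `d` satisfies the homogeneous versions of all identities. As on a Kähler manifold, closedness
  -- of the fundamental form together with integrability forces it to vanish on the image of `φ`.
  have d0 : ∀ X Y Z, d Z X (P Y) = 0 := fun X Y Z => by
    have n := dN X Y Z
    have c1 := dcyc (P X) Y Z
    have c2 := dcyc (P Y) X Z
    have p1 := dphi Y Z X
    have p2 := dphi Z X Y
    have p3 := dphi X Z Y
    have p4 := dphi Z Y X
    have p5 := dphi Z X Y
    have s1 := dskew Y (P Z) X
    have s2 := dskew X (P Z) Y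
    have s3 := dskew Z (P X) Y
    have s4 := dskew Z (P Y) X
    linarith
  have dxi : ∀ X Z, d X ξ Z = 0 := fun X Z => by
    have := h5 X
    simp only [hd, ha]
    rw [this, hB, map_neg P, neg_neg, hs.phi_phi]
    simp only [map_add, map_neg, map_smul, add_apply,
      neg_apply, smul_apply, hs.xi_inner, hs.inner_xi,
      hs.eta_xi, smul_eq_mul]
    ring
  intro X Y
  apply hs.eq_of_inner
  intro Z
  -- `Z = -φ(φZ) + η(Z)ξ`, so only the value on `ξ` remains, which is `dxi`.
  have f := d0 Y (P Z) X
  rw [hs.phi_phi] at f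
  have fx := dxi X Y
  rw [dskew] at fx
  simp only [hd, ha, map_add, map_neg, map_smul, map_sub,
    sub_apply, smul_apply, hs.xi_inner, smul_eq_mul,
    hs.eta_xi, hs.inner_xi] at f fx ⊢
  have fx' : η (A X Y) = G X Y * 1 - η Y * η X := by linarith
  rw [fx'] at f
  linarith

end IsContactVectorSpace

end LinearAlgebra

end SesquiHarmonic

namespace SesquiHarmonic

/-! ### Levi-Civita connections and Sasakian structures in coordinates -/

section Local

set_option synthInstance.maxHeartbeats 400000
set_option maxHeartbeats 2000000

variable {E : Type*} [NormedAddCommGroup E] [NormedSpace ℝ E]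
  {F : Type*} [NormedAddCommGroup F] [NormedSpace ℝ F]

lemma hasDerivAt_line {f : E → F} {y : E} (h : DifferentiableAt ℝ f y) (X : E) :
    HasDerivAt (fun t : ℝ => f (y + t • X)) (fderiv ℝ f y X) 0 := by
  have h1 : HasDerivAt (fun t : ℝ => y + t • X) X 0 := by
    simpa using ((hasDerivAt_id (0 : ℝ)).smul_const X).const_add y
  have h2 : HasFDerivAt f (fderiv ℝ f y) (y + (0 : ℝ) • X) := by simpa using h.hasFDerivAt
  exact h2.comp_hasDerivAt 0 h1

/-- Two functions that agree near `y` have the same derivative along a line through `y`. -/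
lemma line_deriv_unique {f g : E → F} {U : Set E} (hU : IsOpen U) {y : E} (hy : y ∈ U)
    (hfg : ∀ z ∈ U, f z = g z) {X : E} {a b : F}
    (ha : HasDerivAt (fun t : ℝ => f (y + t • X)) a 0)
    (hb : HasDerivAt (fun t : ℝ => g (y + t • X)) b 0) : a = b := by
  refine ha.unique (hb.congr_of_eventuallyEq ?_)
  have hc : ContinuousAt (fun t : ℝ => y + t • X) 0 := by fun_prop
  have : ∀ᶠ t : ℝ in 𝓝 0, y + t • X ∈ U := hc.preimage_mem_nhds (by simpa using hU.mem_nhds hy)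
  filter_upwards [this] with t ht using hfg _ ht

/-- Curvature of the connection with Christoffel map `C`, in coordinates. -/
noncomputable def localCurvature (C : E → E →L[ℝ] E →L[ℝ] E) (y X Y Z : E) : E :=
  fderiv ℝ C y X Y Z - fderiv ℝ C y Y X Z + C y X (C y Y Z) - C y Y (C y X Z)

/-- `C` is the Christoffel map of the Levi-Civita connection of the metric `G` on the open set `U`
of `E`. -/
structure IsLocalLeviCivita (U : Set E) (G : E → E →L[ℝ] E →L[ℝ] ℝ)
    (C : E → E →L[ℝ] E →L[ℝ] E) : Prop where
  isOpen : IsOpen U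
  smooth_metric : ContDiffOn ℝ ∞ G U
  smooth_conn : ContDiffOn ℝ ∞ C U
  inner_symm : ∀ y ∈ U, ∀ v w, G y v w = G y w v
  inner_pos : ∀ y ∈ U, ∀ v, v ≠ 0 → 0 < G y v v
  conn_symm : ∀ y ∈ U, ∀ v w, C y v w = C y w v
  metric : ∀ y ∈ U, ∀ X v w, fderiv ℝ G y X v w = G y (C y X v) w + G y v (C y X w)

lemma ContDiffOn.differentiableAt_of_isOpen {f : E → F} {U : Set E} (h : ContDiffOn ℝ ∞ f U)
    (hU : IsOpen U) {y : E} (hy : y ∈ U) : DifferentiableAt ℝ f y :=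
  (h.contDiffAt (hU.mem_nhds hy)).differentiableAt (by simp)

lemma ContDiffOn.fderiv_of_isOpen_infty {f : E → F} {U : Set E} (h : ContDiffOn ℝ ∞ f U)
    (hU : IsOpen U) : ContDiffOn ℝ ∞ (fderiv ℝ f) U :=
  h.fderiv_of_isOpen hU (by simp)

lemma fderiv_fderiv_symm {f : E → F} {U : Set E} (h : ContDiffOn ℝ ∞ f U)
    (hU : IsOpen U) {y : E} (hy : y ∈ U) (X Y : E) :
    fderiv ℝ (fderiv ℝ f) y X Y = fderiv ℝ (fderiv ℝ f) y Y X :=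
  ((h.contDiffAt (hU.mem_nhds hy)).isSymmSndFDerivAt
    (by simp; exact ENat.LEInfty.out)) X Y

lemma hasDerivAt_line_of_contDiffOn {f : E → F} {U : Set E} (h : ContDiffOn ℝ ∞ f U)
    (hU : IsOpen U) {y : E} (hy : y ∈ U) (X : E) :
    HasDerivAt (fun t : ℝ => f (y + t • X)) (fderiv ℝ f y X) 0 :=
  hasDerivAt_line (ContDiffOn.differentiableAt_of_isOpen h hU hy) X

lemma hasDerivAt_line_fderiv {f : E → F} {U : Set E} (h : ContDiffOn ℝ ∞ f U)
    (hU : IsOpen U) {y : E} (hy : y ∈ U) (X : E) :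
    HasDerivAt (fun t : ℝ => fderiv ℝ f (y + t • X)) (fderiv ℝ (fderiv ℝ f) y X) 0 :=
  hasDerivAt_line_of_contDiffOn (ContDiffOn.fderiv_of_isOpen_infty h hU) hU hy X

namespace IsLocalLeviCivita

variable {U : Set E} {G : E → E →L[ℝ] E →L[ℝ] ℝ} {C : E → E →L[ℝ] E →L[ℝ] E} {y : E}

lemma curvature_antisymm (C : E → E →L[ℝ] E →L[ℝ] E) (y X Y Z : E) :
    localCurvature C y X Y Z = -localCurvature C y Y X Z := by
  simp only [localCurvature]; abel

lemma fderiv_conn_symm (h : IsLocalLeviCivita U G C) (hy : y ∈ U) (X v w : E) :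
    fderiv ℝ C y X v w = fderiv ℝ C y X w v := by
  have hC := hasDerivAt_line_of_contDiffOn h.smooth_conn h.isOpen hy X
  refine line_deriv_unique (f := fun z => C z v w) (g := fun z => C z w v) h.isOpen hy
    (fun z hz => h.conn_symm z hz v w) (X := X) ?_ ?_
  · simpa using (hC.clm_apply (hasDerivAt_const 0 v)).clm_apply (hasDerivAt_const 0 w)
  · simpa using (hC.clm_apply (hasDerivAt_const 0 w)).clm_apply (hasDerivAt_const 0 v)

lemma bianchi (h : IsLocalLeviCivita U G C) (hy : y ∈ U) (X Y Z : E) :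
    localCurvature C y X Y Z + localCurvature C y Y Z X + localCurvature C y Z X Y = 0 := by
  simp only [localCurvature]
  rw [h.fderiv_conn_symm hy X Z Y, h.fderiv_conn_symm hy Y X Z, h.fderiv_conn_symm hy Z Y X,
    h.conn_symm y hy Z Y, h.conn_symm y hy X Z, h.conn_symm y hy Y X]
  abel

set_option synthInstance.maxSize 1000 in
set_option maxSynthPendingDepth 8 in
-- Differentiate metric compatibility once more: the second derivative of `G` is symmetric in `X,
-- Y`, and antisymmetrizing leaves exactly the two curvature terms.
lemma curvature_skew (h : IsLocalLeviCivita U G C) (hy : y ∈ U) (X Y Z W : E) :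
    G y (localCurvature C y X Y Z) W = -G y Z (localCurvature C y X Y W) := by
  have key : ∀ X Y : E, fderiv ℝ (fderiv ℝ G) y X Y Z W =
      (G y (C y X (C y Y Z)) W + G y (C y Y Z) (C y X W)) + G y (fderiv ℝ C y X Y Z) W
      + ((G y (C y X Z) (C y Y W) + G y Z (C y X (C y Y W))) + G y Z (fderiv ℝ C y X Y W)) := by
    intro X Y
    have hCX := hasDerivAt_line_of_contDiffOn h.smooth_conn h.isOpen hy X
    have hGX := hasDerivAt_line_of_contDiffOn h.smooth_metric h.isOpen hy X
    have hGX' := hasDerivAt_line_fderiv h.smooth_metric h.isOpen hy X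
    rw [← h.metric y hy, ← h.metric y hy]
    refine line_deriv_unique (f := fun z => fderiv ℝ G z Y Z W)
      (g := fun z => G z (C z Y Z) W + G z Z (C z Y W)) h.isOpen hy
      (fun z hz => h.metric z hz Y Z W) (X := X) ?_ ?_
    · simpa using ((hGX'.clm_apply (hasDerivAt_const 0 Y)).clm_apply
        (hasDerivAt_const 0 Z)).clm_apply (hasDerivAt_const 0 W)
    · have c1 := ((hCX.clm_apply (hasDerivAt_const 0 Y)).clm_apply (hasDerivAt_const 0 Z))
      have c2 := ((hCX.clm_apply (hasDerivAt_const 0 Y)).clm_apply (hasDerivAt_const 0 W))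
      have c3 := ((hGX.clm_apply c1).clm_apply (hasDerivAt_const 0 W)).fun_add
        ((hGX.clm_apply (hasDerivAt_const 0 Z)).clm_apply c2)
      simpa using c3
  have k1 := key X Y
  have k2 := key Y X
  rw [fderiv_fderiv_symm h.smooth_metric h.isOpen hy Y X] at k2
  simp only [localCurvature, map_add, map_sub, add_apply, sub_apply]
  linarith

/-- The octahedron argument: four Bianchi identities, one for each choice of last entry, combined
with the skewness in each pair. -/
lemma curvature_pair_symm (h : IsLocalLeviCivita U G C) (hy : y ∈ U) (X Y Z W : E) :
    G y (localCurvature C y X Y Z) W = G y (localCurvature C y Z W X) Y := by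
  have B : ∀ X Y Z W, G y (localCurvature C y X Y Z) W + G y (localCurvature C y Y Z X) W
      + G y (localCurvature C y Z X Y) W = 0 := fun X Y Z W => by
    rw [← ContinuousLinearMap.map_add₂, ← ContinuousLinearMap.map_add₂, h.bianchi hy,
      ContinuousLinearMap.map_zero₂]
  have S : ∀ X Y Z W, G y (localCurvature C y X Y Z) W = -G y (localCurvature C y X Y W) Z :=
    fun X Y Z W => by rw [h.curvature_skew hy, h.inner_symm y hy]
  have T : ∀ X Y Z W, G y (localCurvature C y X Y Z) W = -G y (localCurvature C y Y X Z) W :=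
    fun X Y Z W => by rw [curvature_antisymm, ContinuousLinearMap.map_neg₂]
  have b1 := B X Y Z W
  have b2 := B Y Z W X
  have b3 := B Z W X Y
  have b4 := B W X Y Z
  linarith [S X Y Z W, S Y Z X W, S Z X Y W, S Y Z W X, S Z W Y X, S W Y Z X, S Z W X Y, S W X Z Y,
    S X Z W Y, S W X Y Z, S X Y W Z, S Y W X Z, T Z X Y W, T X Z W Y, T W Y Z X, T Y W X Z]

end IsLocalLeviCivita

/-- A Sasakian structure of constant `φ`-sectional curvature `c` on the open set `U` of `E`. -/
structure IsLocalSasakiSpaceForm (U : Set E) (G : E → E →L[ℝ] E →L[ℝ] ℝ)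
    (C : E → E →L[ℝ] E →L[ℝ] E) (P : E → E →L[ℝ] E) (ξ : E → E) (η : E → E →L[ℝ] ℝ) (c : ℝ) :
    Prop extends IsLocalLeviCivita U G C where
  smooth_phi : ContDiffOn ℝ ∞ P U
  smooth_xi : ContDiffOn ℝ ∞ ξ U
  smooth_eta : ContDiffOn ℝ ∞ η U
  contactSpace : ∀ y ∈ U, IsContactVectorSpace (G y) (P y) (ξ y) (η y)
  contact : ∀ y ∈ U, ∀ X Y,
    fderiv ℝ η y X Y - fderiv ℝ η y Y X = 2 * G y X (P y Y)
  normal : ∀ y ∈ U, ∀ X Y, fderiv ℝ P y (P y X) Y - fderiv ℝ P y (P y Y) X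
    + P y (fderiv ℝ P y Y X) - P y (fderiv ℝ P y X Y) = -((2 * G y X (P y Y)) • ξ y)
  phi_sectional : ∀ y ∈ U, ∀ v, η y v = 0 → G y v v = 1 →
    G y (localCurvature C y v (P y v) (P y v)) v = c

namespace IsLocalSasakiSpaceForm

variable {U : Set E} {G : E → E →L[ℝ] E →L[ℝ] ℝ} {C : E → E →L[ℝ] E →L[ℝ] E}
  {P : E → E →L[ℝ] E} {ξ : E → E} {η : E → E →L[ℝ] ℝ} {c : ℝ} {y : E}

/-- Reduction to `sasaki_aux`. Each of the differential hypotheses there comes from an identity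
valid on all of `U`, compared along a line through `y` by `line_deriv_unique` or already recorded in
the structure; metric compatibility and symmetry of `C` turn ordinary derivatives into covariant
ones. -/
lemma nabla_aux (h : IsLocalSasakiSpaceForm U G C P ξ η c) (hy : y ∈ U) :
    (∀ X, fderiv ℝ ξ y X + C y X (ξ y) = -P y X) ∧
    ∀ X Y, fderiv ℝ P y X Y + C y X (P y Y) - P y (C y X Y) = G y X Y • ξ y - η y Y • X := by
  have hs := h.contactSpace y hy
  have lG := fun X => hasDerivAt_line_of_contDiffOn h.smooth_metric h.isOpen hy X
  have lP := fun X => hasDerivAt_line_of_contDiffOn h.smooth_phi h.isOpen hy X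
  have lx := fun X => hasDerivAt_line_of_contDiffOn h.smooth_xi h.isOpen hy X
  have le := fun X => hasDerivAt_line_of_contDiffOn h.smooth_eta h.isOpen hy X
  have le' := fun X => hasDerivAt_line_fderiv h.smooth_eta h.isOpen hy X
  have k := fun (X : E) => hasDerivAt_const (0 : ℝ) X
  refine hs.sasaki_aux (B := fun X => fderiv ℝ ξ y X + C y X (ξ y))
    (A := fun X Y => fderiv ℝ P y X Y + C y X (P y Y) - P y (C y X Y))
    (h := fun X Y => fderiv ℝ η y X Y - η y (C y X Y)) ?_ ?_ ?_ ?_ ?_ ?_ ?_ ?_ ?_ ?_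
  · intro X Y
    have e : fderiv ℝ P y X (P y Y) + P y (fderiv ℝ P y X Y) =
        fderiv ℝ η y X Y • ξ y + η y Y • fderiv ℝ ξ y X := by
      refine line_deriv_unique (f := fun z => P z (P z Y)) (g := fun z => -Y + η z Y • ξ z)
        h.isOpen hy (fun z hz => (h.contactSpace z hz).phi_phi Y) (X := X) ?_ ?_
      · simpa using (lP X).clm_apply ((lP X).clm_apply (k Y))
      · have := (((le X).clm_apply (k Y)).smul (lx X)).const_add (-Y)
        simpa [add_comm] using this
    have e1 : fderiv ℝ P y X (P y Y) = fderiv ℝ η y X Y • ξ y + η y Y • fderiv ℝ ξ y X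
        - P y (fderiv ℝ P y X Y) := by rw [← e]; abel
    simp only [e1, map_add, map_sub, hs.phi_phi, map_neg, map_smul]
    module
  · intro X Y Z
    have e : fderiv ℝ G y X (P y Y) Z + G y (fderiv ℝ P y X Y) Z =
        -(fderiv ℝ G y X Y (P y Z) + G y Y (fderiv ℝ P y X Z)) := by
      refine line_deriv_unique (f := fun z => G z (P z Y) Z) (g := fun z => -G z Y (P z Z))
        h.isOpen hy (fun z hz => (h.contactSpace z hz).phi_inner Y Z) (X := X) ?_ ?_
      · simpa using ((lG X).clm_apply ((lP X).clm_apply (k Y))).clm_apply (k Z)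
      · simpa using (((lG X).clm_apply (k Y)).clm_apply ((lP X).clm_apply (k Z))).fun_neg
    rw [h.metric y hy, h.metric y hy] at e
    simp only [map_add, map_sub, add_apply, sub_apply, hs.phi_inner] at e ⊢
    have := hs.phi_inner Y (C y X Z)
    linarith
  · intro X Y
    have e : fderiv ℝ η y X Y = fderiv ℝ G y X (ξ y) Y + G y (fderiv ℝ ξ y X) Y := by
      refine line_deriv_unique (f := fun z => η z Y) (g := fun z => G z (ξ z) Y)
        h.isOpen hy (fun z hz => ((h.contactSpace z hz).xi_inner Y).symm) (X := X) ?_ ?_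
      · simpa using (le X).clm_apply (k Y)
      · simpa using ((lG X).clm_apply (lx X)).clm_apply (k Y)
    rw [h.metric y hy] at e
    simp only [map_add, add_apply, e, hs.xi_inner]
    ring
  · intro X
    have e : (fderiv ℝ G y X (ξ y) + G y (fderiv ℝ ξ y X)) (ξ y) + G y (ξ y) (fderiv ℝ ξ y X)
        = 0 := by
      refine line_deriv_unique (f := fun z => G z (ξ z) (ξ z)) (g := fun z => (1 : ℝ))
        h.isOpen hy (fun z hz => ?_) (X := X) ?_ (hasDerivAt_const _ _)
      · rw [(h.contactSpace z hz).xi_inner, (h.contactSpace z hz).eta_xi]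
      · simpa using ((lG X).clm_apply (lx X)).clm_apply (lx X)
    rw [add_apply, h.metric y hy] at e
    simp only [map_add, add_apply]
    rw [hs.symm (ξ y) (fderiv ℝ ξ y X), hs.symm (ξ y)] at e
    linarith
  · intro X
    have e : fderiv ℝ P y X (ξ y) + P y (fderiv ℝ ξ y X) = 0 := by
      refine line_deriv_unique (f := fun z => P z (ξ z)) (g := fun z => (0 : E))
        h.isOpen hy (fun z hz => (h.contactSpace z hz).phi_xi) (X := X) ?_ (k _)
      simpa using (lP X).clm_apply (lx X)
    rw [add_eq_zero_iff_eq_neg] at e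
    simp only [map_add, hs.phi_xi, map_zero, e]
    abel
  · intro X Y Z
    -- Derivative of the contact condition. In the cyclic sum the second derivatives of `η` cancel,
    -- which is `d(dη) = 0`.
    have e : ∀ X Y Z, fderiv ℝ (fderiv ℝ η) y X Y Z - fderiv ℝ (fderiv ℝ η) y X Z Y =
        2 * (fderiv ℝ G y X Y (P y Z) + G y Y (fderiv ℝ P y X Z)) := fun X Y Z => by
      refine line_deriv_unique (f := fun z => fderiv ℝ η z Y Z - fderiv ℝ η z Z Y)
        (g := fun z => 2 * G z Y (P z Z)) h.isOpen hy (fun z hz => h.contact z hz Y Z) (X := X) ?_ ?_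
      · simpa using (((le' X).clm_apply (k Y)).clm_apply (k Z)).fun_sub
          (((le' X).clm_apply (k Z)).clm_apply (k Y))
      · simpa using (((lG X).clm_apply (k Y)).clm_apply ((lP X).clm_apply (k Z))).const_mul 2
    have e1 := e X Y Z
    have e2 := e Y Z X
    have e3 := e Z X Y
    rw [h.metric y hy] at e1 e2 e3
    rw [fderiv_fderiv_symm h.smooth_eta h.isOpen hy X Z] at e1
    rw [fderiv_fderiv_symm h.smooth_eta h.isOpen hy Y X] at e2
    rw [fderiv_fderiv_symm h.smooth_eta h.isOpen hy Z Y] at e3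
    simp only [map_add, map_sub]
    rw [h.conn_symm y hy Y X] at *
    rw [h.conn_symm y hy Z X] at *
    rw [h.conn_symm y hy Z Y] at *
    have p1 := hs.phi_inner Y (C y X Z)
    have p2 := hs.phi_inner Z (C y X Y)
    have p3 := hs.phi_inner X (C y Y Z)
    have q1 := hs.symm (P y Y) (C y X Z)
    have q2 := hs.symm (P y Z) (C y X Y)
    have q3 := hs.symm (P y X) (C y Y Z)
    linarith
  · intro X Y
    rw [← h.normal y hy]
    simp only [map_add, map_sub]
    rw [h.conn_symm y hy (P y X) (P y Y), h.conn_symm y hy (P y X) Y, h.conn_symm y hy (P y Y) X,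
      h.conn_symm y hy Y X]
    abel
  · intro X Y
    rw [← h.contact y hy, h.conn_symm y hy Y X]
    ring
  · intro X Y
    simp only [map_add, add_apply]
    abel
  · intro a X
    simp only [map_smul, smul_apply, smul_add]

/-- `∇_X ξ = -φX` -/
lemma nabla_xi (h : IsLocalSasakiSpaceForm U G C P ξ η c) (hy : y ∈ U) (X : E) :
    fderiv ℝ ξ y X = -P y X - C y X (ξ y) := by
  rw [← (h.nabla_aux hy).1 X]; abel

/-- `(∇_X φ) Y = g(X, Y) ξ - η(Y) X` -/
lemma nabla_phi (h : IsLocalSasakiSpaceForm U G C P ξ η c) (hy : y ∈ U) (X Y : E) :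
    fderiv ℝ P y X Y = -C y X (P y Y) + P y (C y X Y) + (G y X Y • ξ y - η y Y • X) := by
  rw [← (h.nabla_aux hy).2 X]; abel

/-- `(∇_X η) Y = g(X, φY)` -/
lemma nabla_eta (h : IsLocalSasakiSpaceForm U G C P ξ η c) (hy : y ∈ U) (X Y : E) :
    fderiv ℝ η y X Y = η y (C y X Y) + G y X (P y Y) := by
  have hs := h.contactSpace y hy
  have e : fderiv ℝ η y X Y = fderiv ℝ G y X (ξ y) Y + G y (fderiv ℝ ξ y X) Y := by
    refine line_deriv_unique (f := fun z => η z Y) (g := fun z => G z (ξ z) Y)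
      h.isOpen hy (fun z hz => ((h.contactSpace z hz).xi_inner Y).symm) (X := X) ?_ ?_
    · simpa using (hasDerivAt_line_of_contDiffOn h.smooth_eta h.isOpen hy X).clm_apply (hasDerivAt_const 0 Y)
    · simpa using ((hasDerivAt_line_of_contDiffOn h.smooth_metric h.isOpen hy X).clm_apply (hasDerivAt_line_of_contDiffOn h.smooth_xi h.isOpen hy X)).clm_apply
        (hasDerivAt_const 0 Y)
  rw [h.metric y hy, h.nabla_xi hy, ContinuousLinearMap.map_sub₂, ContinuousLinearMap.map_neg₂,
    hs.phi_inner, hs.xi_inner] at e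
  rw [e]; ring

/-- The commutator of `φ` with the curvature of a Sasakian manifold. -/
lemma curvature_phi (h : IsLocalSasakiSpaceForm U G C P ξ η c) (hy : y ∈ U) (W X Y : E) :
    localCurvature C y W X (P y Y) = P y (localCurvature C y W X Y)
      - G y X Y • P y W + G y W Y • P y X - G y W (P y Y) • X + G y X (P y Y) • W := by
  have lG := fun X => hasDerivAt_line_of_contDiffOn h.smooth_metric h.isOpen hy X
  have lP := fun X => hasDerivAt_line_of_contDiffOn h.smooth_phi h.isOpen hy X
  have lC := fun X => hasDerivAt_line_of_contDiffOn h.smooth_conn h.isOpen hy X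
  have lP' := fun X => hasDerivAt_line_fderiv h.smooth_phi h.isOpen hy X
  have lx := fun X => hasDerivAt_line_of_contDiffOn h.smooth_xi h.isOpen hy X
  have le := fun X => hasDerivAt_line_of_contDiffOn h.smooth_eta h.isOpen hy X
  have k := fun (X : E) => hasDerivAt_const (0 : ℝ) X
  -- The formula for `∇φ` is differentiated again; symmetry of the second derivative of `φ` in `W,
  -- X` is then the Ricci identity `[R(W,X), φ] = ...`.
  have key : ∀ W X, fderiv ℝ (fderiv ℝ P) y W X Y =
      -(fderiv ℝ C y W X (P y Y) + C y X (fderiv ℝ P y W Y))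
      + (fderiv ℝ P y W (C y X Y) + P y (fderiv ℝ C y W X Y))
      + ((G y X Y • fderiv ℝ ξ y W + fderiv ℝ G y W X Y • ξ y) - fderiv ℝ η y W Y • X) := by
    intro W X
    refine line_deriv_unique (f := fun z => fderiv ℝ P z X Y)
      (g := fun z => -C z X (P z Y) + P z (C z X Y) + (G z X Y • ξ z - η z Y • X))
      h.isOpen hy (fun z hz => h.nabla_phi hz X Y) (X := W) ?_ ?_
    · simpa using ((lP' W).clm_apply (k X)).clm_apply (k Y)
    · have c1 := (((lC W).clm_apply (k X)).clm_apply ((lP W).clm_apply (k Y))).fun_neg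
      have c2 := (lP W).clm_apply (((lC W).clm_apply (k X)).clm_apply (k Y))
      have c3 := (((lG W).clm_apply (k X)).clm_apply (k Y)).fun_smul (lx W)
      have c4 := ((le W).clm_apply (k Y)).smul_const X
      simpa using (c1.fun_add c2).fun_add (c3.fun_sub c4)
  have k1 := key W X
  have k2 := key X W
  rw [fderiv_fderiv_symm h.smooth_phi h.isOpen hy X W, k1] at k2
  simp only [h.nabla_phi hy, h.nabla_xi hy, h.nabla_eta hy, h.metric y hy, map_add, map_sub,
    map_neg, map_smul] at k2
  rw [h.conn_symm y hy X W] at k2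
  simp only [localCurvature, map_add, map_sub]
  have e : ∀ a b c d : E, c = d → a - c = b - d → a = b := fun a b c d h1 h2 => by
    rw [h1] at h2; simpa using h2
  refine e _ _ _ _ k2.symm ?_
  module

end IsLocalSasakiSpaceForm

end Local

end SesquiHarmonic

namespace SesquiHarmonic

/-! ### Polarization of the `φ`-sectional curvature -/

section Polarization

set_option synthInstance.maxHeartbeats 400000
set_option maxHeartbeats 2000000

variable {E : Type*} [NormedAddCommGroup E] [NormedSpace ℝ E]

section Trilinear

variable (C : E → E →L[ℝ] E →L[ℝ] E) (y X X' Y Z : E) (a : ℝ)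

lemma localCurvature_add_left :
    localCurvature C y (X + X') Y Z = localCurvature C y X Y Z + localCurvature C y X' Y Z := by
  simp only [localCurvature, map_add, add_apply]; abel

lemma localCurvature_smul_left :
    localCurvature C y (a • X) Y Z = a • localCurvature C y X Y Z := by
  simp only [localCurvature, map_smul, smul_apply]; module

lemma localCurvature_add_mid :
    localCurvature C y Y (X + X') Z = localCurvature C y Y X Z + localCurvature C y Y X' Z := by
  simp only [localCurvature, map_add, add_apply]; abel

lemma localCurvature_smul_mid :
    localCurvature C y X (a • Y) Z = a • localCurvature C y X Y Z := by
  simp only [localCurvature, map_smul, smul_apply]; module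

lemma localCurvature_add_right :
    localCurvature C y Y Z (X + X') = localCurvature C y Y Z X + localCurvature C y Y Z X' := by
  simp only [localCurvature, map_add]; abel

lemma localCurvature_smul_right :
    localCurvature C y X Y (a • Z) = a • localCurvature C y X Y Z := by
  simp only [localCurvature, map_smul]; module

end Trilinear

namespace IsLocalSasakiSpaceForm

variable {U : Set E} {G : E → E →L[ℝ] E →L[ℝ] ℝ} {C : E → E →L[ℝ] E →L[ℝ] E}
  {P : E → E →L[ℝ] E} {ξ : E → E} {η : E → E →L[ℝ] ℝ} {c : ℝ} {y : E}

/-- Both sides are homogeneous of degree four, so the normalization to unit length can be dropped.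
-/
lemma phi_sectional_quartic (h : IsLocalSasakiSpaceForm U G C P ξ η c) (hy : y ∈ U) {u : E}
    (hu : η y u = 0) :
    G y (localCurvature C y u (P y u) (P y u)) u = c * G y u u ^ 2 := by
  rcases eq_or_ne u 0 with rfl | hne
  · simp
  have hpos := h.inner_pos y hy u hne
  set s := Real.sqrt (G y u u) with hs
  have hs0 : 0 < s := Real.sqrt_pos.mpr hpos
  have hs2 : s * s = G y u u := Real.mul_self_sqrt hpos.le
  have hu' : u = s • (s⁻¹ • u) := by rw [smul_smul, mul_inv_cancel₀ hs0.ne', one_smul]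
  have e := h.phi_sectional y hy (s⁻¹ • u) (by rw [map_smul, hu, smul_zero]) (by
    simp only [map_smul, smul_apply, smul_eq_mul, ← hs2]
    field_simp)
  simp only [map_smul, smul_apply, smul_eq_mul, localCurvature_smul_left,
    localCurvature_smul_mid, localCurvature_smul_right] at e
  rw [← hs2, ← e]
  field_simp

/-- In `curvature_phi` with `W = φv` and `X = Y = v`, the corrections `-g(v,v)φ²v` and `-g(φv,φv)v`
cancel and the other two contain `g(v,φv) = 0`. -/
lemma curvature_phi_self (h : IsLocalSasakiSpaceForm U G C P ξ η c) (hy : y ∈ U) {v : E}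
    (hv : η y v = 0) :
    P y (localCurvature C y (P y v) v v) = -localCurvature C y v (P y v) (P y v) := by
  have hs := h.contactSpace y hy
  have e := h.curvature_phi hy (P y v) v v
  rw [hs.phi_phi, hs.inner_phi_phi, hs.phi_inner, hs.inner_self_phi, hv] at e
  rw [IsLocalLeviCivita.curvature_antisymm C y v (P y v), neg_neg, e]
  module

/-- The coefficient of `t` in the quartic identity for `v + tw`: it consists of four curvature
terms, all equal by the symmetries of `R` and its commutation with `φ`, against `4c g(v,v)g(v,w)`.
-/
lemma polarized (h : IsLocalSasakiSpaceForm U G C P ξ η c) (hy : y ∈ U) {v w : E}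
    (hv : η y v = 0) (hw : η y w = 0) :
    G y (localCurvature C y v (P y v) (P y v)) w = c * G y v v * G y v w := by
  have hs := h.contactSpace y hy
  have poly : ∀ t : ℝ, G y (localCurvature C y (v + t • w) (P y (v + t • w)) (P y (v + t • w)))
      (v + t • w) = c * G y (v + t • w) (v + t • w) ^ 2 := fun t =>
    h.phi_sectional_quartic hy (by rw [map_add, map_smul, hv, hw, smul_zero, add_zero])
  -- The odd part of a quartic in `t` has only the coefficients of `t` and `t³`, so the values at
  -- `±1` and `±2` isolate the linear one.
  have a1 := poly 1
  have a2 := poly (-1)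
  have a3 := poly 2
  have a4 := poly (-2)
  simp only [map_add, map_smul, add_apply, smul_apply, smul_eq_mul, localCurvature_smul_left,
    localCurvature_smul_mid, localCurvature_smul_right, localCurvature_add_left,
    localCurvature_add_mid, localCurvature_add_right] at a1 a2 a3 a4
  rw [hs.symm w v] at a1 a2 a3 a4
  have q : G y (localCurvature C y w (P y v) (P y v)) v
      + G y (localCurvature C y v (P y w) (P y v)) v
      + G y (localCurvature C y v (P y v) (P y w)) v
      + G y (localCurvature C y v (P y v) (P y v)) w = 4 * (c * G y v v * G y v w) := by
    linarith
  have k := h.curvature_phi_self hy hv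
  have s1 : G y (localCurvature C y (P y v) v v) (P y w) =
      G y (localCurvature C y v (P y v) (P y v)) w := by
    have := hs.phi_inner (localCurvature C y (P y v) v v) w
    rw [k, ContinuousLinearMap.map_neg₂] at this
    linarith
  have s2 : G y (localCurvature C y w (P y v) (P y v)) v =
      G y (localCurvature C y v (P y v) (P y v)) w := by
    rw [h.curvature_pair_symm hy, h.curvature_skew hy, IsLocalLeviCivita.curvature_antisymm C y (P y v) v,
      map_neg, neg_neg, hs.symm]
  have s3 : G y (localCurvature C y v (P y w) (P y v)) v =
      G y (localCurvature C y (P y v) v v) (P y w) := by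
    rw [h.curvature_pair_symm hy]
  have s4 : G y (localCurvature C y v (P y v) (P y w)) v =
      G y (localCurvature C y (P y v) v v) (P y w) := by
    rw [h.curvature_skew hy, IsLocalLeviCivita.curvature_antisymm, map_neg, neg_neg, hs.symm]
  linarith

/-- In a Sasakian space form, `R(φv, v)v = c φv` for unit vectors `v` orthogonal to `ξ`. -/
lemma curvature_phi_section (h : IsLocalSasakiSpaceForm U G C P ξ η c) (hy : y ∈ U) {v : E}
    (hv : η y v = 0) (hv1 : G y v v = 1) :
    localCurvature C y (P y v) v v = c • P y v := by
  have hs := h.contactSpace y hy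
  apply hs.eq_of_inner
  intro z
  -- `curvature_phi` applied to `ξ` shows `φ(R(φv,v)ξ) = 0`; hence `R(φv,v)ξ` is a multiple of `ξ`
  -- and so orthogonal to `v`.
  have hxi : G y (localCurvature C y (P y v) v v) (ξ y) = 0 := by
    have e := h.curvature_phi hy (P y v) v (ξ y)
    rw [hs.phi_xi, hs.inner_xi, hs.inner_xi, hv, hs.eta_phi, map_zero, map_zero] at e
    simp only [zero_smul, sub_zero, add_zero] at e
    have e0 : localCurvature C y (P y v) v 0 = 0 := by simp [localCurvature]
    rw [e0] at e
    have e1 := hs.phi_phi (localCurvature C y (P y v) v (ξ y))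
    rw [← e, map_zero, eq_comm, neg_add_eq_zero] at e1
    rw [h.curvature_skew hy, e1, map_smul, hs.inner_xi, hv, smul_zero, neg_zero]
  -- Testing against `ξ` is done, so `z` may be taken of the form `φw` with `η(w) = 0`, where
  -- `polarized` applies.
  have hz : z = P y (-P y z) + η y z • ξ y := by
    rw [map_neg, hs.phi_phi]; abel
  have hz' : η y (-P y z) = 0 := by rw [map_neg, hs.eta_phi, neg_zero]
  have e := h.polarized hy hv hz'
  have e2 := hs.phi_inner (localCurvature C y (P y v) v v) (-P y z)
  rw [h.curvature_phi_self hy hv, ContinuousLinearMap.map_neg₂, e, hv1] at e2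
  conv_lhs => rw [hz]
  rw [map_add, map_smul, hxi, smul_zero, add_zero, ContinuousLinearMap.map_smul₂, hs.phi_inner]
  simp only [map_neg, smul_eq_mul] at e2 ⊢
  linarith

end IsLocalSasakiSpaceForm

end Polarization

end SesquiHarmonic

namespace SesquiHarmonic

/-! ### Tangent vectors and vector fields in a chart -/

section Chart

variable {E : Type*} [NormedAddCommGroup E] [NormedSpace ℝ E]
  {M : Type*} [TopologicalSpace M] [ChartedSpace E M] [IsManifold 𝓘(ℝ, E) ∞ M]
  {F : Type*} [NormedAddCommGroup F] [NormedSpace ℝ F]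

/-- The components of a tangent vector at `x` in the chart around `x₀`. -/
noncomputable def toChart (x₀ x : M) : TangentSpace 𝓘(ℝ, E) x →L[ℝ] E :=
  (trivializationAt E (fun x : M => TangentSpace 𝓘(ℝ, E) x) x₀).continuousLinearMapAt ℝ x

/-- The tangent vector at `x` with given components in the chart around `x₀`. -/
noncomputable def ofChart (x₀ x : M) : E →L[ℝ] TangentSpace 𝓘(ℝ, E) x :=
  (trivializationAt E (fun x : M => TangentSpace 𝓘(ℝ, E) x) x₀).symmL ℝ x

variable {x₀ x : M}

lemma mem_baseSet_iff :
    x ∈ (trivializationAt E (fun x : M => TangentSpace 𝓘(ℝ, E) x) x₀).baseSet ↔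
      x ∈ (chartAt E x₀).source := Iff.rfl

lemma toChart_apply (hx : x ∈ (chartAt E x₀).source) (v : TangentSpace 𝓘(ℝ, E) x) :
    toChart x₀ x v = ((trivializationAt E (fun x : M => TangentSpace 𝓘(ℝ, E) x) x₀) ⟨x, v⟩).2 := by
  rw [toChart, Bundle.Trivialization.continuousLinearMapAt_apply,
    Bundle.Trivialization.coe_linearMapAt_of_mem _ (mem_baseSet_iff.mpr hx)]

lemma ofChart_apply (hx : x ∈ (chartAt E x₀).source) (w : E) :
    ofChart x₀ x w = (trivializationAt E (fun x : M => TangentSpace 𝓘(ℝ, E) x) x₀).symm x w := by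
  rw [ofChart, Bundle.Trivialization.symmL_apply _ (mem_baseSet_iff.mpr hx)]

lemma toChart_ofChart (hx : x ∈ (chartAt E x₀).source) (w : E) :
    toChart x₀ x (ofChart x₀ x w) = w :=
  Bundle.Trivialization.continuousLinearMapAt_symmL _ (mem_baseSet_iff.mpr hx) w

lemma ofChart_toChart (hx : x ∈ (chartAt E x₀).source) (v : TangentSpace 𝓘(ℝ, E) x) :
    ofChart x₀ x (toChart x₀ x v) = v :=
  Bundle.Trivialization.symmL_continuousLinearMapAt _ (mem_baseSet_iff.mpr hx) v

lemma toChart_injective (hx : x ∈ (chartAt E x₀).source) :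
    Function.Injective (toChart (E := E) x₀ x) :=
  Function.LeftInverse.injective (ofChart_toChart hx)

lemma toChart_eq_mfderiv (hx : x ∈ (chartAt E x₀).source) (v : TangentSpace 𝓘(ℝ, E) x) :
    toChart x₀ x v = mfderiv 𝓘(ℝ, E) 𝓘(ℝ, E) (chartAt E x₀) x v := by
  have := TangentBundle.continuousLinearMapAt_trivializationAt (I := 𝓘(ℝ, E)) hx
  have h2 := congrArg (fun L => L v) this
  simpa using! h2

/-- The components of a vector field in the chart around `x₀`. -/
noncomputable def coordField (x₀ : M) (σ : ∀ x : M, TangentSpace 𝓘(ℝ, E) x) (y : E) : E :=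
  toChart x₀ ((chartAt E x₀).symm y) (σ ((chartAt E x₀).symm y))

lemma coordField_chartAt (hx : x ∈ (chartAt E x₀).source)
    (σ : ∀ x : M, TangentSpace 𝓘(ℝ, E) x) :
    coordField x₀ σ (chartAt E x₀ x) = toChart x₀ x (σ x) := by
  rw [coordField, (chartAt E x₀).left_inv hx]

lemma contMDiffAt_chart (hx : x ∈ (chartAt E x₀).source) :
    ContMDiffAt 𝓘(ℝ, E) 𝓘(ℝ, E) ∞ (chartAt E x₀) x :=
  contMDiffAt_of_mem_maximalAtlas (IsManifold.chart_mem_maximalAtlas x₀) hx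

lemma contMDiffAt_chart_symm {y : E} (hy : y ∈ (chartAt E x₀).target) :
    ContMDiffAt 𝓘(ℝ, E) 𝓘(ℝ, E) ∞ (chartAt E x₀).symm y :=
  contMDiffAt_symm_of_mem_maximalAtlas (IsManifold.chart_mem_maximalAtlas x₀) hy

lemma contDiffAt_comp_chart_symm {y : E} (hy : y ∈ (chartAt E x₀).target) {f : M → F}
    (hf : ContMDiffAt 𝓘(ℝ, E) 𝓘(ℝ, F) ∞ f ((chartAt E x₀).symm y)) :
    ContDiffAt ℝ ∞ (f ∘ (chartAt E x₀).symm) y :=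
  (hf.comp y (contMDiffAt_chart_symm hy)).contDiffAt

lemma hasFDerivAt_comp_chart_symm (hx : x ∈ (chartAt E x₀).source) {f : M → F}
    (hf : MDifferentiableAt 𝓘(ℝ, E) 𝓘(ℝ, F) f x) :
    DifferentiableAt ℝ (f ∘ (chartAt E x₀).symm) (chartAt E x₀ x) ∧
    ∀ v : TangentSpace 𝓘(ℝ, E) x, mvfderiv 𝓘(ℝ, E) f x v =
      fderiv ℝ (f ∘ (chartAt E x₀).symm) (chartAt E x₀ x) (toChart x₀ x v) := by
  have hy := (chartAt E x₀).map_source hx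
  have hs := (contMDiffAt_chart_symm (x₀ := x₀) hy).mdifferentiableAt (by simp)
  have hd : DifferentiableAt ℝ (f ∘ (chartAt E x₀).symm) (chartAt E x₀ x) := by
    rw [← mdifferentiableAt_iff_differentiableAt]
    refine MDifferentiableAt.comp _ ?_ hs
    rwa [(chartAt E x₀).left_inv hx]
  refine ⟨hd, fun v => ?_⟩
  have hc := (contMDiffAt_chart hx).mdifferentiableAt (by simp : (∞ : ℕ∞ω) ≠ 0)
  have e : f =ᶠ[𝓝 x] (f ∘ (chartAt E x₀).symm) ∘ chartAt E x₀ := by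
    filter_upwards [(chartAt E x₀).open_source.mem_nhds hx] with z hz
    simp [(chartAt E x₀).left_inv hz]
  have h3 : mfderiv 𝓘(ℝ, E) 𝓘(ℝ, F) f x =
      (mfderiv 𝓘(ℝ, E) 𝓘(ℝ, F) (f ∘ (chartAt E x₀).symm) (chartAt E x₀ x)).comp
      (mfderiv 𝓘(ℝ, E) 𝓘(ℝ, E) (chartAt E x₀) x) := by
    rw [e.mfderiv_eq, mfderiv_comp x hd.mdifferentiableAt hc]
  rw [toChart_eq_mfderiv hx, mvfderiv, h3, mfderiv_eq_fderiv]
  rfl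

lemma mdifferentiableAt_section_iff_coord (hx : x ∈ (chartAt E x₀).source)
    {σ : ∀ x : M, TangentSpace 𝓘(ℝ, E) x} :
    MDifferentiableAt 𝓘(ℝ, E) (𝓘(ℝ, E)).tangent
      (fun x : M => (⟨x, σ x⟩ : TangentBundle 𝓘(ℝ, E) M)) x ↔
    MDifferentiableAt 𝓘(ℝ, E) 𝓘(ℝ, E) (fun z => toChart x₀ z (σ z)) x := by
  have h1 := Bundle.Trivialization.mdifferentiableAt_section_iff 𝓘(ℝ, E)
    (trivializationAt E (fun x : M => TangentSpace 𝓘(ℝ, E) x) x₀) σ (mem_baseSet_iff.mpr hx)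
  refine h1.trans (Filter.EventuallyEq.mdifferentiableAt_iff ?_)
  filter_upwards [(chartAt E x₀).open_source.mem_nhds hx] with z hz
  rw [toChart_apply hz]

lemma contMDiffAt_section_iff_coord (hx : x ∈ (chartAt E x₀).source)
    {σ : ∀ x : M, TangentSpace 𝓘(ℝ, E) x} :
    ContMDiffAt 𝓘(ℝ, E) (𝓘(ℝ, E)).tangent ∞
      (fun x : M => (⟨x, σ x⟩ : TangentBundle 𝓘(ℝ, E) M)) x ↔
    ContMDiffAt 𝓘(ℝ, E) 𝓘(ℝ, E) ∞ (fun z => toChart x₀ z (σ z)) x := by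
  have h1 := Bundle.Trivialization.contMDiffAt_section_iff (IB := 𝓘(ℝ, E)) (n := ∞) (s := σ)
    (trivializationAt E (fun x : M => TangentSpace 𝓘(ℝ, E) x) x₀) (mem_baseSet_iff.mpr hx)
  refine h1.trans (Filter.EventuallyEq.contMDiffAt_iff ?_)
  filter_upwards [(chartAt E x₀).open_source.mem_nhds hx] with z hz
  rw [toChart_apply hz]

/-- A vector field is smooth along a map iff its components are. -/
lemma contMDiffWithinAt_field_iff_coord {E' : Type*} [NormedAddCommGroup E'] [NormedSpace ℝ E']
    {γ : E' → M} {V : ∀ t, TangentSpace 𝓘(ℝ, E) (γ t)} {s : Set E'} {t : E'}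
    (hx : γ t ∈ (chartAt E x₀).source) :
    ContMDiffWithinAt 𝓘(ℝ, E') (𝓘(ℝ, E)).tangent ∞
      (fun t => (⟨γ t, V t⟩ : TangentBundle 𝓘(ℝ, E) M)) s t ↔
    ContMDiffWithinAt 𝓘(ℝ, E') 𝓘(ℝ, E) ∞ γ s t ∧
    ContMDiffWithinAt 𝓘(ℝ, E') 𝓘(ℝ, E) ∞ (fun t => toChart x₀ (γ t) (V t)) s t := by
  have h1 := Bundle.Trivialization.contMDiffWithinAt_iff (IB := 𝓘(ℝ, E)) (IM := 𝓘(ℝ, E'))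
    (n := ∞) (f := fun t => (⟨γ t, V t⟩ : TangentBundle 𝓘(ℝ, E) M)) (s := s) (x₀ := t)
    (e := trivializationAt E (fun x : M => TangentSpace 𝓘(ℝ, E) x) x₀)
    ((Bundle.Trivialization.mem_source _).mpr (mem_baseSet_iff.mpr hx))
  refine h1.trans (and_congr_right fun hγ => ?_)
  refine Filter.EventuallyEq.contMDiffWithinAt_iff ?_ ?_
  · filter_upwards [hγ.continuousWithinAt.preimage_mem_nhdsWithin
      ((chartAt E x₀).open_source.mem_nhds hx)] with z hz
    rw [toChart_apply hz]
  · rw [toChart_apply hx]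

/-- The directional derivative of the components of vector fields is a connection. -/
lemma isCovariantDerivativeOn_flat (x₀ : M) :
    IsCovariantDerivativeOn (I := 𝓘(ℝ, E)) E (V := fun x : M => TangentSpace 𝓘(ℝ, E) x)
      (fun σ x => (ofChart x₀ x).comp
        ((mvfderiv 𝓘(ℝ, E) (fun z => toChart x₀ z (σ z)) x : TangentSpace 𝓘(ℝ, E) x →L[ℝ] E)))
      (chartAt E x₀).source where
  add {σ σ' x} hσ hσ' hx := by
    have e : (fun z => toChart x₀ z ((σ + σ') z)) =
        (fun z => toChart x₀ z (σ z)) + fun z => toChart x₀ z (σ' z) := by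
      ext z; simp
    rw [e, mvfderiv_add ((mdifferentiableAt_section_iff_coord hx).mp hσ)
      ((mdifferentiableAt_section_iff_coord hx).mp hσ'), ContinuousLinearMap.comp_add]
  leibniz {σ g x} hσ hg hx := by
    have e : (fun z => toChart x₀ z ((g • σ) z)) = g • (fun z => toChart x₀ z (σ z)) := by
      ext z; simp
    rw [e, mvfderiv_smul hg ((mdifferentiableAt_section_iff_coord hx).mp hσ)]
    ext v
    simp [ofChart_toChart hx]

/-- Components of a covariant derivative, in terms of its value on a field with the same value. -/
lemma toChart_cov [FiniteDimensional ℝ E]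
    (cov : CovariantDerivative 𝓘(ℝ, E) E (fun x : M => TangentSpace 𝓘(ℝ, E) x))
    (hx : x ∈ (chartAt E x₀).source) {σ τ : ∀ x : M, TangentSpace 𝓘(ℝ, E) x}
    (hσ : MDifferentiableAt 𝓘(ℝ, E) (𝓘(ℝ, E)).tangent
      (fun x : M => (⟨x, σ x⟩ : TangentBundle 𝓘(ℝ, E) M)) x)
    (hτ : MDifferentiableAt 𝓘(ℝ, E) (𝓘(ℝ, E)).tangent
      (fun x : M => (⟨x, τ x⟩ : TangentBundle 𝓘(ℝ, E) M)) x) (hστ : σ x = τ x)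
    (hτ' : ∀ᶠ z in 𝓝 x, toChart x₀ z (τ z) = toChart x₀ x (τ x)) (v : TangentSpace 𝓘(ℝ, E) x) :
    toChart x₀ x (cov σ x v) =
      fderiv ℝ (coordField x₀ σ) (chartAt E x₀ x) (toChart x₀ x v) + toChart x₀ x (cov τ x v) := by
  -- The difference of two connections is tensorial: its value on `σ` at `x` is its value on `τ`,
  -- and the flat derivative of `τ` vanishes there.
  have d1 := IsCovariantDerivativeOn.difference_apply
    (cov.isCovariantDerivativeOn (s := (chartAt E x₀).source)) (isCovariantDerivativeOn_flat x₀)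
    hx hσ
  have d2 := IsCovariantDerivativeOn.difference_apply
    (cov.isCovariantDerivativeOn (s := (chartAt E x₀).source)) (isCovariantDerivativeOn_flat x₀)
    hx hτ
  rw [hστ, d2] at d1
  have z : mvfderiv 𝓘(ℝ, E) (fun z => toChart x₀ z (τ z)) x = 0 := by
    have e : (fun z => toChart x₀ z (τ z)) =ᶠ[𝓝 x] fun _ => toChart x₀ x (τ x) := hτ'
    rw [mvfderiv, e.mfderiv_eq, mfderiv_const, ContinuousLinearMap.comp_zero]
  rw [z, ContinuousLinearMap.comp_zero, sub_zero] at d1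
  have d3 : cov σ x v = cov τ x v + ofChart x₀ x
      (mvfderiv 𝓘(ℝ, E) (fun z => toChart x₀ z (σ z)) x v) := by
    rw [d1]; simp
  rw [d3, map_add, toChart_ofChart hx, add_comm,
    (hasFDerivAt_comp_chart_symm hx ((mdifferentiableAt_section_iff_coord hx).mp hσ)).2 v]
  rfl

end Chart

end SesquiHarmonic

namespace SesquiHarmonic

/-! ### The structure tensors in a chart -/

section LocalStructure

set_option linter.unusedSectionVars false

variable {E : Type*} [NormedAddCommGroup E] [NormedSpace ℝ E] [FiniteDimensional ℝ E]
  {M : Type*} [TopologicalSpace M] [T2Space M] [ChartedSpace E M] [IsManifold 𝓘(ℝ, E) ∞ M]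

/-- A smooth bump function around `x₀`. -/
noncomputable def bumpAt (x₀ : M) : SmoothBumpFunction 𝓘(ℝ, E) x₀ := Classical.arbitrary _

/-- The vector field with constant components `w` in the chart around `x₀`, cut off outside of a
neighbourhood of `x₀`. -/
noncomputable def frame (x₀ : M) (w : E) (x : M) : TangentSpace 𝓘(ℝ, E) x :=
  bumpAt (E := E) x₀ x • ofChart x₀ x w

/-- A neighbourhood of `x₀` on which `frame x₀ w` has constant components. -/
def frameNhd (E : Type*) [NormedAddCommGroup E] [NormedSpace ℝ E] [FiniteDimensional ℝ E]
    {M : Type*} [TopologicalSpace M] [ChartedSpace E M] (x₀ : M) : Set M :=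
  (chartAt E x₀).source ∩ interior {x | (Classical.arbitrary (SmoothBumpFunction 𝓘(ℝ, E) x₀)) x = 1}

/-- The image of `frameNhd E x₀` in the chart around `x₀`. -/
def chartNhd (E : Type*) [NormedAddCommGroup E] [NormedSpace ℝ E] [FiniteDimensional ℝ E]
    {M : Type*} [TopologicalSpace M] [ChartedSpace E M] (x₀ : M) : Set E :=
  (chartAt E x₀).target ∩ (chartAt E x₀).symm ⁻¹' frameNhd E x₀

variable {x₀ x : M} {y : E}

lemma isOpen_frameNhd : IsOpen (frameNhd E x₀) := (chartAt E x₀).open_source.inter isOpen_interior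

lemma mem_frameNhd_self : x₀ ∈ frameNhd E x₀ :=
  ⟨mem_chart_source E x₀, mem_interior_iff_mem_nhds.mpr
    (Classical.arbitrary (SmoothBumpFunction 𝓘(ℝ, E) x₀)).eventuallyEq_one⟩

lemma isOpen_chartNhd : IsOpen (chartNhd E x₀) :=
  (chartAt E x₀).isOpen_inter_preimage_symm isOpen_frameNhd

lemma chartAt_mem_chartNhd (hx : x ∈ frameNhd E x₀) : chartAt E x₀ x ∈ chartNhd E x₀ :=
  ⟨(chartAt E x₀).map_source hx.1, by rwa [mem_preimage, (chartAt E x₀).left_inv hx.1]⟩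

lemma frame_apply (hx : x ∈ frameNhd E x₀) (w : E) : frame x₀ w x = ofChart x₀ x w := by
  have h1 : x ∈ {x | bumpAt (E := E) x₀ x = 1} := interior_subset hx.2
  rw [frame, h1, one_smul]

lemma toChart_frame (hx : x ∈ frameNhd E x₀) (w : E) : toChart x₀ x (frame x₀ w x) = w := by
  rw [frame_apply hx, toChart_ofChart hx.1]

lemma frame_toChart (hx : x ∈ frameNhd E x₀) (v : TangentSpace 𝓘(ℝ, E) x) :
    frame x₀ (toChart x₀ x v) x = v := by
  rw [frame_apply hx, ofChart_toChart hx.1]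

lemma isSmoothField_frame (x₀ : M) (w : E) : IsSmoothField (I := 𝓘(ℝ, E)) (frame x₀ w) := by
  intro x
  by_cases hx : x ∈ (chartAt E x₀).source
  · rw [contMDiffAt_section_iff_coord hx]
    have h1 : ContMDiffAt 𝓘(ℝ, E) 𝓘(ℝ, E) ∞ (fun z => bumpAt (E := E) x₀ z • w) x :=
      (bumpAt x₀).contMDiffAt.smul contMDiffAt_const
    refine h1.congr_of_eventuallyEq ?_
    filter_upwards [(chartAt E x₀).open_source.mem_nhds hx] with z hz
    rw [frame, map_smul, toChart_ofChart hz]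
  · have h0 : x ∉ tsupport (bumpAt (E := E) x₀) := fun h =>
      hx ((bumpAt x₀).tsupport_subset_chartAt_source h)
    have h1 : ContMDiffAt 𝓘(ℝ, E) (𝓘(ℝ, E)).tangent ∞
        (fun x : M => (⟨x, 0⟩ : TangentBundle 𝓘(ℝ, E) M)) x :=
      (Bundle.contMDiff_zeroSection ℝ (fun x : M => TangentSpace 𝓘(ℝ, E) x)) x
    refine h1.congr_of_eventuallyEq ?_
    filter_upwards [(isClosed_tsupport _).isOpen_compl.mem_nhds h0] with z hz
    rw [frame, image_eq_zero_of_notMem_tsupport hz, zero_smul]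

lemma frame_add (v w : E) : frame x₀ (v + w) x = frame x₀ v x + frame x₀ w x := by
  simp [frame]

lemma frame_smul (a : ℝ) (w : E) : frame x₀ (a • w) x = a • frame x₀ w x := by
  simp [frame, smul_comm a]

lemma IsSmoothField.mdifferentiableAt {σ : ∀ x : M, TangentSpace 𝓘(ℝ, E) x}
    (h : IsSmoothField (I := 𝓘(ℝ, E)) σ) (x : M) :
    MDifferentiableAt 𝓘(ℝ, E) (𝓘(ℝ, E)).tangent
      (fun x : M => (⟨x, σ x⟩ : TangentBundle 𝓘(ℝ, E) M)) x :=
  (h x).mdifferentiableAt (by simp)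

lemma IsSmoothField.contDiffOn_coordField {σ : ∀ x : M, TangentSpace 𝓘(ℝ, E) x}
    (h : IsSmoothField (I := 𝓘(ℝ, E)) σ) (x₀ : M) :
    ContDiffOn ℝ ∞ (coordField x₀ σ) (chartAt E x₀).target := by
  intro y hy
  have h1 := (contMDiffAt_section_iff_coord ((chartAt E x₀).map_target hy)).mp
    (h ((chartAt E x₀).symm y))
  exact (contDiffAt_comp_chart_symm hy h1).contDiffWithinAt

lemma coordField_frame (hy : y ∈ chartNhd E x₀) (w : E) : coordField x₀ (frame x₀ w) y = w :=
  toChart_frame hy.2 w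

/-! #### The metric -/

section Metric

variable [Bundle.RiemannianBundle (fun x : M => TangentSpace 𝓘(ℝ, E) x)]

/-- The Riemannian metric in the chart around `x₀`. -/
noncomputable def localMetric (x₀ : M) (y : E) : E →L[ℝ] E →L[ℝ] ℝ :=
  (LinearMap.mk₂ ℝ (fun v w => (inner ℝ (frame x₀ v ((chartAt E x₀).symm y))
      (frame x₀ w ((chartAt E x₀).symm y)) : ℝ))
    (fun _ _ _ => by rw [frame_add, inner_add_left])
    (fun _ _ _ => by rw [frame_smul, real_inner_smul_left]; rfl)
    (fun _ _ _ => by rw [frame_add, inner_add_right])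
    (fun _ _ _ => by rw [frame_smul, real_inner_smul_right]; rfl)).toContinuousBilinearMap

lemma localMetric_apply (v w : E) : localMetric x₀ y v w =
    inner ℝ (frame x₀ v ((chartAt E x₀).symm y)) (frame x₀ w ((chartAt E x₀).symm y)) := rfl

lemma inner_eq_localMetric (hx : x ∈ frameNhd E x₀) (v w : TangentSpace 𝓘(ℝ, E) x) :
    inner ℝ v w = localMetric x₀ (chartAt E x₀ x) (toChart x₀ x v) (toChart x₀ x w) := by
  rw [localMetric_apply, (chartAt E x₀).left_inv hx.1, frame_toChart hx, frame_toChart hx]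

lemma contDiffOn_localMetric
    [IsContMDiffRiemannianBundle 𝓘(ℝ, E) ∞ E (fun x : M => TangentSpace 𝓘(ℝ, E) x)] (x₀ : M) :
    ContDiffOn ℝ ∞ (localMetric (E := E) x₀) (chartNhd E x₀) := by
  rw [contDiffOn_clm_apply]
  intro v
  rw [contDiffOn_clm_apply]
  intro w y hy
  have h1 : ContMDiffAt 𝓘(ℝ, E) 𝓘(ℝ, ℝ) ∞
      (fun x : M => (inner ℝ (frame x₀ v x) (frame x₀ w x) : ℝ)) ((chartAt E x₀).symm y) :=
    ContMDiffAt.inner_bundle (isSmoothField_frame x₀ v _) (isSmoothField_frame x₀ w _)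
  exact (contDiffAt_comp_chart_symm hy.1 h1).contDiffWithinAt

end Metric

/-! #### The connection -/

section Connection

variable (cov : CovariantDerivative 𝓘(ℝ, E) E (fun x : M => TangentSpace 𝓘(ℝ, E) x))

/-- The Christoffel map of a connection in the chart around `x₀`. -/
noncomputable def localConn (x₀ : M) (y : E) : E →L[ℝ] E →L[ℝ] E :=
  (LinearMap.mk₂ ℝ (fun v w => toChart x₀ ((chartAt E x₀).symm y)
      (cov (frame x₀ w) ((chartAt E x₀).symm y) (frame x₀ v ((chartAt E x₀).symm y))))
    (fun _ _ _ => by rw [frame_add, map_add, map_add])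
    (fun _ _ _ => by rw [frame_smul, map_smul, map_smul])
    (fun v w w' => by
      have e : frame x₀ (w + w') = frame x₀ w + frame x₀ w' := funext fun z => frame_add w w'
      rw [e, cov.isCovariantDerivativeOnUniv.add
        ((isSmoothField_frame x₀ w).mdifferentiableAt _)
        ((isSmoothField_frame x₀ w').mdifferentiableAt _), add_apply, map_add])
    (fun a v w => by
      have e : frame x₀ (a • w) = a • frame x₀ w := funext fun z => frame_smul a w
      rw [e, cov.isCovariantDerivativeOnUniv.smul_const a
        ((isSmoothField_frame x₀ w).mdifferentiableAt _), smul_apply, map_smul]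
      )).toContinuousBilinearMap

lemma localConn_apply (v w : E) : localConn cov x₀ y v w =
    toChart x₀ ((chartAt E x₀).symm y)
      (cov (frame x₀ w) ((chartAt E x₀).symm y) (frame x₀ v ((chartAt E x₀).symm y))) := rfl

/-- The covariant derivative in components. -/
lemma toChart_cov_eq (hx : x ∈ frameNhd E x₀) {σ : ∀ x : M, TangentSpace 𝓘(ℝ, E) x}
    (hσ : MDifferentiableAt 𝓘(ℝ, E) (𝓘(ℝ, E)).tangent
      (fun x : M => (⟨x, σ x⟩ : TangentBundle 𝓘(ℝ, E) M)) x) (v : TangentSpace 𝓘(ℝ, E) x) :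
    toChart x₀ x (cov σ x v) = fderiv ℝ (coordField x₀ σ) (chartAt E x₀ x) (toChart x₀ x v) +
      localConn cov x₀ (chartAt E x₀ x) (toChart x₀ x v) (toChart x₀ x (σ x)) := by
  rw [localConn_apply, (chartAt E x₀).left_inv hx.1, frame_toChart hx]
  refine toChart_cov cov hx.1 hσ ((isSmoothField_frame x₀ _).mdifferentiableAt _)
    (frame_toChart hx _).symm ?_ v
  filter_upwards [isOpen_frameNhd.mem_nhds hx] with z hz
  rw [toChart_frame hz, toChart_frame hx]

variable {cov}

lemma IsSmoothField.covDeriv (hcov : cov.ContMDiffCovariantDerivative ∞)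
    {X Y : ∀ x : M, TangentSpace 𝓘(ℝ, E) x} (hX : IsSmoothField (I := 𝓘(ℝ, E)) X)
    (hY : IsSmoothField (I := 𝓘(ℝ, E)) Y) :
    IsSmoothField (I := 𝓘(ℝ, E)) (fun x => cov Y x (X x)) := by
  have h1 := hcov.contMDiff.contMDiff (σ := Y) (by simpa using hY.contMDiffOn)
  rw [contMDiffOn_univ] at h1
  exact ContMDiff.clm_bundle_apply h1 hX

lemma contDiffOn_localConn (hcov : cov.ContMDiffCovariantDerivative ∞) (x₀ : M) :
    ContDiffOn ℝ ∞ (localConn cov x₀) (chartNhd E x₀) := by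
  rw [contDiffOn_clm_apply]
  intro v
  rw [contDiffOn_clm_apply]
  intro w
  exact ((IsSmoothField.covDeriv hcov (isSmoothField_frame x₀ v)
    (isSmoothField_frame x₀ w)).contDiffOn_coordField x₀).mono inter_subset_left

/-- The vector field on `E` with constant value `w`. -/
def constField (w : E) (y : E) : TangentSpace 𝓘(ℝ, E) y := w

/-- Near `x` the two fields are pullbacks of constant fields under the chart, and pullback commutes
with the Lie bracket. -/
lemma mlieBracket_frame (hx : x ∈ frameNhd E x₀) (v w : E) :
    VectorField.mlieBracket 𝓘(ℝ, E) (frame x₀ v) (frame x₀ w) x = 0 := by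
  have hinv : ∀ (w : E) (z : M), z ∈ frameNhd E x₀ → frame x₀ w z =
      VectorField.mpullback 𝓘(ℝ, E) 𝓘(ℝ, E) (chartAt E x₀) (constField w) z := by
    intro w z hz
    rw [VectorField.mpullback_apply, frame_apply hz]
    have e : (mfderiv 𝓘(ℝ, E) 𝓘(ℝ, E) (chartAt E x₀) z).inverse = ofChart (E := E) x₀ z := by
      refine ContinuousLinearMap.inverse_eq ?_ ?_
      · refine ContinuousLinearMap.ext fun u : E => ?_
        have h1 : toChart x₀ z (ofChart x₀ z u) = u := toChart_ofChart hz.1 u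
        rw [toChart_eq_mfderiv hz.1] at h1
        exact h1
      · ext u
        have := ofChart_toChart hz.1 u
        rw [toChart_eq_mfderiv hz.1] at this
        exact this
    rw [e]
    rfl
  have ev : ∀ w : E, frame x₀ w =ᶠ[𝓝 x]
      VectorField.mpullback 𝓘(ℝ, E) 𝓘(ℝ, E) (chartAt E x₀) (constField w) := fun w => by
    filter_upwards [isOpen_frameNhd.mem_nhds hx] with z hz using hinv w z hz
  rw [(ev v).mlieBracket_vectorField_eq (ev w)]
  have hc : ∀ w : E, MDifferentiableAt 𝓘(ℝ, E) (𝓘(ℝ, E)).tangent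
      (fun z : E => (⟨z, constField w z⟩ : TangentBundle 𝓘(ℝ, E) E)) (chartAt E x₀ x) := fun w =>
    ((contMDiffAt_vectorSpace_iff_contDiffAt (n := ∞) (V := constField w)).mpr
      contDiffAt_const).mdifferentiableAt (by simp)
  have : IsManifold 𝓘(ℝ, E) (minSmoothness ℝ 2) M :=
    IsManifold.of_le (n := ∞) (by simp; exact ENat.LEInfty.out)
  rw [← VectorField.mpullback_mlieBracket (n := ∞) (hc v) (hc w) (contMDiffAt_chart hx.1)
    (by simp; exact ENat.LEInfty.out)]
  rw [VectorField.mpullback_apply]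
  have z : VectorField.mlieBracket 𝓘(ℝ, E) (constField v) (constField w)
      (chartAt E x₀ x) = 0 := by
    rw [← VectorField.mlieBracketWithin_univ,
      VectorField.mlieBracketWithin_eq_lieBracketWithin]
    change fderivWithin ℝ (fun _ : E => w) univ (chartAt E x₀ x) v -
      fderivWithin ℝ (fun _ : E => v) univ (chartAt E x₀ x) w = (0 : E)
    simp
  rw [z, map_zero]

end Connection

end LocalStructure

end SesquiHarmonic

namespace SesquiHarmonic

/-! ### Curvature and Sasakian space forms in a chart -/

section LocalSasaki

set_option linter.unusedSectionVars false

variable {E : Type*} [NormedAddCommGroup E] [NormedSpace ℝ E] [FiniteDimensional ℝ E]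
  {M : Type*} [TopologicalSpace M] [T2Space M] [ChartedSpace E M] [IsManifold 𝓘(ℝ, E) ∞ M]
  [Bundle.RiemannianBundle (fun x : M => TangentSpace 𝓘(ℝ, E) x)]
  [IsContMDiffRiemannianBundle 𝓘(ℝ, E) ∞ E (fun x : M => TangentSpace 𝓘(ℝ, E) x)]
  {cov : CovariantDerivative 𝓘(ℝ, E) E (fun x : M => TangentSpace 𝓘(ℝ, E) x)}
  {x₀ x : M} {y : E}

lemma fderiv_clm_const_apply {F F' : Type*} [NormedAddCommGroup F] [NormedSpace ℝ F]
    [NormedAddCommGroup F'] [NormedSpace ℝ F'] {A : E → F →L[ℝ] F'} (h : DifferentiableAt ℝ A y)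
    (v : F) (X : E) : fderiv ℝ (fun z => A z v) y X = fderiv ℝ A y X v := by
  have h1 := h.hasFDerivAt.clm_apply (hasFDerivAt_const v y)
  rw [h1.fderiv]
  simp

lemma chartAt_symm_chart (hy : y ∈ chartNhd E x₀) :
    chartAt E x₀ ((chartAt E x₀).symm y) = y := (chartAt E x₀).right_inv hy.1

lemma IsSmoothField.differentiableAt_coordField {σ : ∀ x : M, TangentSpace 𝓘(ℝ, E) x}
    (h : IsSmoothField (I := 𝓘(ℝ, E)) σ) (hy : y ∈ chartNhd E x₀) :
    DifferentiableAt ℝ (coordField x₀ σ) y :=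
  ContDiffOn.differentiableAt_of_isOpen (h.contDiffOn_coordField x₀) (chartAt E x₀).open_target hy.1

/-- `toChart_cov_eq` at the point with coordinates `y`. -/
lemma coordField_cov {σ τ : ∀ x : M, TangentSpace 𝓘(ℝ, E) x}
    (hσ : IsSmoothField (I := 𝓘(ℝ, E)) σ) (hy : y ∈ chartNhd E x₀) :
    coordField x₀ (fun x => cov σ x (τ x)) y =
      fderiv ℝ (coordField x₀ σ) y (coordField x₀ τ y) +
      localConn cov x₀ y (coordField x₀ τ y) (coordField x₀ σ y) := by
  have h := toChart_cov_eq cov (x₀ := x₀) hy.2 (hσ.mdifferentiableAt _) (τ _)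
  rw [chartAt_symm_chart hy] at h
  exact h

lemma IsLeviCivita.mlieBracket_eq (hcov : IsLeviCivita cov) {σ τ : ∀ x : M, TangentSpace 𝓘(ℝ, E) x}
    (hσ : IsSmoothField (I := 𝓘(ℝ, E)) σ) (hτ : IsSmoothField (I := 𝓘(ℝ, E)) τ) (x : M) :
    VectorField.mlieBracket 𝓘(ℝ, E) σ τ x = cov τ x (σ x) - cov σ x (τ x) :=
  (cov.torsion_eq_zero_iff.mp hcov.torsion_free (hσ.mdifferentiableAt x)
    (hτ.mdifferentiableAt x)).symm

/-- The Levi-Civita connection in a chart. -/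
lemma IsLeviCivita.isLocalLeviCivita (hcov : IsLeviCivita cov) (x₀ : M) :
    IsLocalLeviCivita (chartNhd E x₀) (localMetric x₀) (localConn cov x₀) where
  isOpen := isOpen_chartNhd
  smooth_metric := contDiffOn_localMetric x₀
  smooth_conn := contDiffOn_localConn hcov.smooth x₀
  inner_symm y _ v w := by rw [localMetric_apply, localMetric_apply, real_inner_comm]
  inner_pos y hy v hv := by
    rw [localMetric_apply]
    refine real_inner_self_pos.mpr fun h0 => hv ?_
    rw [← toChart_frame hy.2 v, h0, map_zero]
  conn_symm y hy v w := by
    -- Coordinate fields commute, so vanishing torsion amounts to symmetry of the Christoffel map.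
    have h := hcov.mlieBracket_eq (isSmoothField_frame x₀ v) (isSmoothField_frame x₀ w)
      ((chartAt E x₀).symm y)
    rw [mlieBracket_frame hy.2, eq_comm, sub_eq_zero] at h
    rw [localConn_apply, localConn_apply, h]
  metric y hy X v w := by
    have h := hcov.metric ((chartAt E x₀).symm y) (frame x₀ X) (frame x₀ v) (frame x₀ w)
      ((isSmoothField_frame x₀ v).mdifferentiableAt _)
      ((isSmoothField_frame x₀ w).mdifferentiableAt _)
    have h1 : ContMDiffAt 𝓘(ℝ, E) 𝓘(ℝ, ℝ) ∞
        (fun x : M => (inner ℝ (frame x₀ v x) (frame x₀ w x) : ℝ)) ((chartAt E x₀).symm y) :=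
      ContMDiffAt.inner_bundle (isSmoothField_frame x₀ v _) (isSmoothField_frame x₀ w _)
    rw [(hasFDerivAt_comp_chart_symm hy.2.1 (h1.mdifferentiableAt (by simp))).2, toChart_frame hy.2, chartAt_symm_chart hy,
      inner_eq_localMetric hy.2, inner_eq_localMetric hy.2, toChart_frame hy.2,
      toChart_frame hy.2, chartAt_symm_chart hy] at h
    have hG := ContDiffOn.differentiableAt_of_isOpen (contDiffOn_localMetric (E := E) x₀)
      isOpen_chartNhd hy
    have e : fderiv ℝ (localMetric x₀) y X v w =
        fderiv ℝ (fun z => localMetric x₀ z v w) y X := by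
      rw [fderiv_clm_const_apply (A := fun z => localMetric x₀ z v) _ w,
        fderiv_clm_const_apply hG]
      exact hG.clm_apply (differentiableAt_const v)
    rw [e]
    exact h

/-- The curvature is defined through vector fields. In components the second derivatives of `Z`
cancel by symmetry and the derivatives of `X` and `Y` cancel against the bracket term, which leaves
a pointwise expression. -/
lemma coordField_curvature (hcov : IsLeviCivita cov) {X Y Z : ∀ x : M, TangentSpace 𝓘(ℝ, E) x}
    (hX : IsSmoothField (I := 𝓘(ℝ, E)) X) (hY : IsSmoothField (I := 𝓘(ℝ, E)) Y)
    (hZ : IsSmoothField (I := 𝓘(ℝ, E)) Z) (hy : y ∈ chartNhd E x₀) :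
    coordField x₀ (curvature cov X Y Z) y = localCurvature (localConn cov x₀) y
      (coordField x₀ X y) (coordField x₀ Y y) (coordField x₀ Z y) := by
  have hl := hcov.isLocalLeviCivita x₀
  have key : ∀ {X Y : ∀ x : M, TangentSpace 𝓘(ℝ, E) x}, IsSmoothField (I := 𝓘(ℝ, E)) Y →
      coordField x₀ (fun x => cov (fun y => cov Z y (Y y)) x (X x)) y =
      fderiv ℝ (fderiv ℝ (coordField x₀ Z)) y (coordField x₀ X y) (coordField x₀ Y y)
      + fderiv ℝ (coordField x₀ Z) y (fderiv ℝ (coordField x₀ Y) y (coordField x₀ X y))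
      + (fderiv ℝ (localConn cov x₀) y (coordField x₀ X y) (coordField x₀ Y y) (coordField x₀ Z y)
      + localConn cov x₀ y (fderiv ℝ (coordField x₀ Y) y (coordField x₀ X y)) (coordField x₀ Z y)
      + localConn cov x₀ y (coordField x₀ Y y)
        (fderiv ℝ (coordField x₀ Z) y (coordField x₀ X y)))
      + localConn cov x₀ y (coordField x₀ X y)
        (fderiv ℝ (coordField x₀ Z) y (coordField x₀ Y y) +
        localConn cov x₀ y (coordField x₀ Y y) (coordField x₀ Z y)) := by
    intro X Y hY
    have hs := IsSmoothField.covDeriv hcov.smooth hY hZ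
    rw [coordField_cov hs hy, coordField_cov hZ hy]
    congr 1
    have l1 := hasDerivAt_line (hs.differentiableAt_coordField hy) (coordField x₀ X y)
    have lC := hasDerivAt_line_of_contDiffOn hl.smooth_conn hl.isOpen hy (coordField x₀ X y)
    have lY := hasDerivAt_line (hY.differentiableAt_coordField hy) (coordField x₀ X y)
    have lZ := hasDerivAt_line (hZ.differentiableAt_coordField hy) (coordField x₀ X y)
    have lZ' := hasDerivAt_line_fderiv (hZ.contDiffOn_coordField x₀)
      (chartAt E x₀).open_target hy.1 (coordField x₀ X y)
    refine line_deriv_unique isOpen_chartNhd hy (fun z hz => coordField_cov hZ hz) l1 ?_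
    have := (lZ'.clm_apply lY).fun_add ((lC.clm_apply lY).clm_apply lZ)
    simpa using this
  have hb : coordField x₀ (fun x => cov Z x (VectorField.mlieBracket 𝓘(ℝ, E) X Y x)) y =
      fderiv ℝ (coordField x₀ Z) y (coordField x₀ (VectorField.mlieBracket 𝓘(ℝ, E) X Y) y) +
      localConn cov x₀ y (coordField x₀ (VectorField.mlieBracket 𝓘(ℝ, E) X Y) y)
        (coordField x₀ Z y) := coordField_cov hZ hy
  have hb2 : coordField x₀ (VectorField.mlieBracket 𝓘(ℝ, E) X Y) y =
      fderiv ℝ (coordField x₀ Y) y (coordField x₀ X y) -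
      fderiv ℝ (coordField x₀ X) y (coordField x₀ Y y) := by
    have e : VectorField.mlieBracket 𝓘(ℝ, E) X Y = fun x => cov Y x (X x) - cov X x (Y x) :=
      funext fun x => hcov.mlieBracket_eq hX hY x
    have e2 : coordField x₀ (fun x => cov Y x (X x) - cov X x (Y x)) y =
        coordField x₀ (fun x => cov Y x (X x)) y - coordField x₀ (fun x => cov X x (Y x)) y :=
      map_sub _ _ _
    rw [e, e2, coordField_cov hY hy, coordField_cov hX hy, hl.conn_symm y hy]
    abel
  have e : coordField x₀ (curvature cov X Y Z) y =
      coordField x₀ (fun x => cov (fun y => cov Z y (Y y)) x (X x)) y -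
      coordField x₀ (fun x => cov (fun y => cov Z y (X y)) x (Y x)) y -
      coordField x₀ (fun x => cov Z x (VectorField.mlieBracket 𝓘(ℝ, E) X Y x)) y := by
    simp only [coordField, curvature, map_sub]
  rw [e, key hY, key hX, hb, hb2, fderiv_fderiv_symm (hZ.contDiffOn_coordField x₀)
    (chartAt E x₀).open_target hy.1 (coordField x₀ Y y)]
  simp only [localCurvature, map_sub, map_add, sub_apply]
  abel

/-- An endomorphism field in the chart around `x₀`. -/
noncomputable def localEnd (φ : ∀ x : M, TangentSpace 𝓘(ℝ, E) x →L[ℝ] TangentSpace 𝓘(ℝ, E) x)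
    (x₀ : M) (y : E) : E →L[ℝ] E :=
  ((toChart x₀ ((chartAt E x₀).symm y)).comp (φ ((chartAt E x₀).symm y))).comp
    (ofChart x₀ ((chartAt E x₀).symm y))

/-- A one-form in the chart around `x₀`. -/
noncomputable def localForm (η : ∀ x : M, TangentSpace 𝓘(ℝ, E) x →L[ℝ] ℝ)
    (x₀ : M) (y : E) : E →L[ℝ] ℝ :=
  (η ((chartAt E x₀).symm y)).comp (ofChart x₀ ((chartAt E x₀).symm y))

variable {φ : ∀ x : M, TangentSpace 𝓘(ℝ, E) x →L[ℝ] TangentSpace 𝓘(ℝ, E) x}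
  {ξ : ∀ x : M, TangentSpace 𝓘(ℝ, E) x} {η : ∀ x : M, TangentSpace 𝓘(ℝ, E) x →L[ℝ] ℝ} {c : ℝ}

lemma toChart_end (hx : x ∈ (chartAt E x₀).source) (v : TangentSpace 𝓘(ℝ, E) x) :
    toChart x₀ x (φ x v) = localEnd φ x₀ (chartAt E x₀ x) (toChart x₀ x v) := by
  simp only [localEnd, ContinuousLinearMap.comp_apply]
  rw [(chartAt E x₀).left_inv hx, ofChart_toChart hx]

lemma form_eq_localForm (hx : x ∈ (chartAt E x₀).source) (v : TangentSpace 𝓘(ℝ, E) x) :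
    η x v = localForm η x₀ (chartAt E x₀ x) (toChart x₀ x v) := by
  simp only [localForm, ContinuousLinearMap.comp_apply]
  rw [(chartAt E x₀).left_inv hx, ofChart_toChart hx]

lemma coordField_end (hy : y ∈ (chartAt E x₀).target) (σ : ∀ x : M, TangentSpace 𝓘(ℝ, E) x) :
    coordField x₀ (fun x => φ x (σ x)) y = localEnd φ x₀ y (coordField x₀ σ y) := by
  rw [coordField, toChart_end ((chartAt E x₀).map_target hy), (chartAt E x₀).right_inv hy]
  rfl

lemma form_coord (hy : y ∈ (chartAt E x₀).target) (σ : ∀ x : M, TangentSpace 𝓘(ℝ, E) x) :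
    η ((chartAt E x₀).symm y) (σ ((chartAt E x₀).symm y)) =
      localForm η x₀ y (coordField x₀ σ y) := by
  rw [form_eq_localForm ((chartAt E x₀).map_target hy), (chartAt E x₀).right_inv hy]
  rfl

lemma IsAlmostContactMetric.isSmoothField_phi (h : IsAlmostContactMetric φ ξ η)
    {σ : ∀ x : M, TangentSpace 𝓘(ℝ, E) x} (hσ : IsSmoothField (I := 𝓘(ℝ, E)) σ) :
    IsSmoothField (I := 𝓘(ℝ, E)) (fun x => φ x (σ x)) :=
  ContMDiff.clm_bundle_apply h.smooth_phi hσ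

lemma IsAlmostContactMetric.contMDiff_eta (h : IsAlmostContactMetric φ ξ η)
    {σ : ∀ x : M, TangentSpace 𝓘(ℝ, E) x} (hσ : IsSmoothField (I := 𝓘(ℝ, E)) σ) :
    ContMDiff 𝓘(ℝ, E) 𝓘(ℝ, ℝ) ∞ (fun x => η x (σ x)) := by
  have := ContMDiff.clm_bundle_apply (E₂ := fun _ : M => ℝ) (F₂ := ℝ) h.smooth_eta hσ
  intro x
  exact (Bundle.contMDiffAt_totalSpace.mp (this x)).2

lemma IsAlmostContactMetric.contDiffOn_localEnd (h : IsAlmostContactMetric φ ξ η) (x₀ : M) :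
    ContDiffOn ℝ ∞ (localEnd φ x₀) (chartNhd E x₀) := by
  rw [contDiffOn_clm_apply]
  intro w
  refine (((h.isSmoothField_phi (isSmoothField_frame x₀ w)).contDiffOn_coordField x₀).mono
    inter_subset_left).congr fun y hy => ?_
  rw [coordField_end hy.1, coordField_frame hy]

lemma IsAlmostContactMetric.contDiffOn_localForm (h : IsAlmostContactMetric φ ξ η) (x₀ : M) :
    ContDiffOn ℝ ∞ (localForm η x₀) (chartNhd E x₀) := by
  rw [contDiffOn_clm_apply]
  intro w y hy
  have h1 := contDiffAt_comp_chart_symm hy.1 (h.contMDiff_eta (isSmoothField_frame x₀ w) _)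
  refine h1.contDiffWithinAt.congr_of_mem (fun z hz => ?_) hy
  rw [Function.comp_apply, form_coord hz.1, coordField_frame hz]

lemma mvfderiv_form (h : IsAlmostContactMetric φ ξ η) (hy : y ∈ chartNhd E x₀) (v w : E) :
    mvfderiv 𝓘(ℝ, E) (fun x => η x (frame x₀ w x)) ((chartAt E x₀).symm y)
      (frame x₀ v ((chartAt E x₀).symm y)) = fderiv ℝ (localForm η x₀) y v w := by
  have h1 := (h.contMDiff_eta (isSmoothField_frame x₀ w)
    ((chartAt E x₀).symm y)).mdifferentiableAt (by simp)
  rw [(hasFDerivAt_comp_chart_symm hy.2.1 h1).2, toChart_frame hy.2, chartAt_symm_chart hy,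
    ← fderiv_clm_const_apply (ContDiffOn.differentiableAt_of_isOpen (h.contDiffOn_localForm x₀)
      isOpen_chartNhd hy)]
  congr 1
  refine Filter.EventuallyEq.fderiv_eq ?_
  filter_upwards [isOpen_chartNhd.mem_nhds hy] with z hz
  rw [Function.comp_apply, form_coord hz.1, coordField_frame hz]

/-- A Sasakian space form in a chart. -/
lemma IsSasakian.isLocalSasakiSpaceForm (hcov : IsLeviCivita cov) (hS : IsSasakian φ ξ η)
    (hc : HasConstantPhiSectionalCurvature cov φ η c) (x₀ : M) :
    IsLocalSasakiSpaceForm (chartNhd E x₀) (localMetric x₀) (localConn cov x₀) (localEnd φ x₀)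
      (coordField x₀ ξ) (localForm η x₀) c := by
  have hA := hS.toIsAlmostContactMetric
  have hl := hcov.isLocalLeviCivita x₀
  -- The Nijenhuis tensor involves brackets of `φ` applied to coordinate fields, which do not
  -- vanish; in a torsion-free connection the Christoffel terms drop out of the bracket.
  have hbr : ∀ y ∈ chartNhd E x₀, ∀ σ τ : ∀ x : M, TangentSpace 𝓘(ℝ, E) x,
      IsSmoothField (I := 𝓘(ℝ, E)) σ → IsSmoothField (I := 𝓘(ℝ, E)) τ →
      toChart x₀ ((chartAt E x₀).symm y)
        (VectorField.mlieBracket 𝓘(ℝ, E) σ τ ((chartAt E x₀).symm y)) =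
      fderiv ℝ (coordField x₀ τ) y (coordField x₀ σ y) -
      fderiv ℝ (coordField x₀ σ) y (coordField x₀ τ y) := by
    intro y hy σ τ hσ hτ
    have e1 := coordField_cov (cov := cov) (τ := τ) hσ hy
    have e2 := coordField_cov (cov := cov) (τ := σ) hτ hy
    rw [coordField] at e1 e2
    rw [hcov.mlieBracket_eq hσ hτ, map_sub, e1, e2, hl.conn_symm y hy]
    abel
  have hcontact : ∀ y ∈ chartNhd E x₀, ∀ v w, extDeriv η (frame x₀ v) (frame x₀ w)
      ((chartAt E x₀).symm y) = localMetric x₀ y v (localEnd φ x₀ y w) := by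
    intro y hy v w
    rw [hS.contact _ _ (isSmoothField_frame x₀ v) (isSmoothField_frame x₀ w),
      inner_eq_localMetric hy.2, toChart_end hy.2.1, toChart_frame hy.2, toChart_frame hy.2,
      chartAt_symm_chart hy]
  have hphi : ∀ y ∈ chartNhd E x₀, ∀ v w, fderiv ℝ (coordField x₀ (fun x => φ x (frame x₀ w x))) y v
      = fderiv ℝ (localEnd φ x₀) y v w := by
    intro y hy v w
    rw [← fderiv_clm_const_apply (ContDiffOn.differentiableAt_of_isOpen
      (hA.contDiffOn_localEnd x₀) isOpen_chartNhd hy)]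
    congr 1
    refine Filter.EventuallyEq.fderiv_eq ?_
    filter_upwards [isOpen_chartNhd.mem_nhds hy] with z hz
    rw [coordField_end hz.1, coordField_frame hz]
  have hconst : ∀ y ∈ chartNhd E x₀, ∀ w, fderiv ℝ (coordField x₀ (frame x₀ w)) y = 0 := by
    intro y hy w
    have e : coordField x₀ (frame x₀ w) =ᶠ[𝓝 y] fun _ => w := by
      filter_upwards [isOpen_chartNhd.mem_nhds hy] with z hz using coordField_frame hz w
    rw [e.fderiv_eq, fderiv_fun_const]
    rfl
  refine { hl with
    smooth_phi := hA.contDiffOn_localEnd x₀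
    smooth_xi := ((hA.smooth_xi : IsSmoothField ξ).contDiffOn_coordField x₀).mono inter_subset_left
    smooth_eta := hA.contDiffOn_localForm x₀
    contactSpace := fun y hy =>
      { symm := hl.inner_symm y hy
        pos := hl.inner_pos y hy
        phi_phi := fun v => ?_
        eta_xi := ?_
        inner_phi_phi := fun v w => ?_ }
    contact := fun y hy v w => ?_
    normal := fun y hy v w => ?_
    phi_sectional := fun y hy v hv hv1 => ?_ }
  · have e := congrArg (toChart x₀ ((chartAt E x₀).symm y))
      (hA.phi_phi ((chartAt E x₀).symm y) (frame x₀ v ((chartAt E x₀).symm y)))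
    rw [toChart_end hy.2.1, toChart_end hy.2.1, map_add, map_neg, map_smul, toChart_frame hy.2,
      chartAt_symm_chart hy, form_coord hy.1, coordField_frame hy] at e
    exact e
  · rw [← form_coord hy.1, hA.eta_xi]
  · have e := hA.inner_phi_phi ((chartAt E x₀).symm y) (frame x₀ v ((chartAt E x₀).symm y))
      (frame x₀ w ((chartAt E x₀).symm y))
    rw [inner_eq_localMetric hy.2, inner_eq_localMetric hy.2, toChart_end hy.2.1,
      toChart_end hy.2.1, toChart_frame hy.2, toChart_frame hy.2, chartAt_symm_chart hy,
      form_coord hy.1, form_coord hy.1, coordField_frame hy, coordField_frame hy] at e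
    exact e
  · have e := hcontact y hy v w
    rw [extDeriv, mvfderiv_form hA hy, mvfderiv_form hA hy, mlieBracket_frame hy.2, map_zero] at e
    linarith
  · have e := congrArg (toChart x₀ ((chartAt E x₀).symm y))
      (hS.normal _ _ (isSmoothField_frame x₀ v) (isSmoothField_frame x₀ w)
        ((chartAt E x₀).symm y))
    have sv := hA.isSmoothField_phi (isSmoothField_frame x₀ v)
    have sw := hA.isSmoothField_phi (isSmoothField_frame x₀ w)
    -- Coordinate fields have constant components and commute, so only derivatives of `φ` survive in
    -- `N_φ`.
    rw [hcontact y hy, nijenhuis, mlieBracket_frame hy.2, map_zero, map_zero, zero_add, map_sub,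
      map_sub, map_neg, map_smul, toChart_end hy.2.1, toChart_end hy.2.1, hbr y hy _ _ sv sw,
      hbr y hy _ _ sv (isSmoothField_frame x₀ w), hbr y hy _ _ (isSmoothField_frame x₀ v) sw,
      hphi y hy, hphi y hy, hphi y hy, hphi y hy, hconst y hy, hconst y hy,
      coordField_end hy.1, coordField_end hy.1, coordField_frame hy, coordField_frame hy,
      chartAt_symm_chart hy] at e
    simp only [zero_apply, zero_sub, sub_zero, map_neg] at e
    rw [coordField, ← e]
    abel
  · have sv := isSmoothField_frame (E := E) x₀ v
    have e := hc (frame x₀ v) sv ((chartAt E x₀).symm y)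
      (by rw [form_coord hy.1, coordField_frame hy, hv])
      (by
        rw [← sq_eq_sq₀ (norm_nonneg _) zero_le_one, ← real_inner_self_eq_norm_sq,
          inner_eq_localMetric hy.2, toChart_frame hy.2, chartAt_symm_chart hy, hv1, one_pow])
    have sp := hA.isSmoothField_phi sv
    have ek := coordField_curvature (x₀ := x₀) hcov sv sp sp hy
    rw [coordField_end hy.1, coordField_frame hy, coordField] at ek
    rw [inner_eq_localMetric hy.2, ek, toChart_frame hy.2, chartAt_symm_chart hy] at e
    exact e

end LocalSasaki

end SesquiHarmonic

namespace SesquiHarmonic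

/-! ### Vector fields along curves -/

section AlongCurves

set_option linter.unusedSectionVars false

variable {E : Type*} [NormedAddCommGroup E] [NormedSpace ℝ E] [FiniteDimensional ℝ E]
  {M : Type*} [TopologicalSpace M] [T2Space M] [ChartedSpace E M] [IsManifold 𝓘(ℝ, E) ∞ M]
  {x₀ : M} {γ : ℝ → M} {t : ℝ}

/-- A smooth vector field along a curve. -/
def SmoothAlong (J : Set ℝ) (γ : ℝ → M) (V : ∀ t, TangentSpace 𝓘(ℝ, E) (γ t)) : Prop :=
  ContMDiffOn 𝓘(ℝ, ℝ) (𝓘(ℝ, E)).tangent ∞ (fun t => (⟨γ t, V t⟩ : TangentBundle 𝓘(ℝ, E) M)) J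

/-- The components of a vector field along a curve. -/
noncomputable def coordAlong (x₀ : M) (γ : ℝ → M) (V : ∀ t, TangentSpace 𝓘(ℝ, E) (γ t)) (t : ℝ) :
    E := toChart x₀ (γ t) (V t)

/-- A curve in the chart around `x₀`. -/
noncomputable def coordCurve (E : Type*) [NormedAddCommGroup E] {M : Type*} [TopologicalSpace M]
    [ChartedSpace E M] (x₀ : M) (γ : ℝ → M) (t : ℝ) : E := chartAt E x₀ (γ t)

lemma hasDerivAt_coordCurve (hx : γ t ∈ (chartAt E x₀).source)
    (hγ : MDifferentiableAt 𝓘(ℝ, ℝ) 𝓘(ℝ, E) γ t) :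
    HasDerivAt (coordCurve E x₀ γ)
      (coordAlong x₀ γ (velocity (I := 𝓘(ℝ, E)) γ) t) t := by
  have hc := (contMDiffAt_chart hx).mdifferentiableAt (by simp : (∞ : ℕ∞ω) ≠ 0)
  have h1 : HasMFDerivAt 𝓘(ℝ, ℝ) 𝓘(ℝ, E) (coordCurve E x₀ γ) t
      ((mfderiv 𝓘(ℝ, E) 𝓘(ℝ, E) (chartAt E x₀) (γ t)).comp
        (mfderiv 𝓘(ℝ, ℝ) 𝓘(ℝ, E) γ t)) := hc.hasMFDerivAt.comp t hγ.hasMFDerivAt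
  have h2 : HasFDerivAt (𝕜 := ℝ) (E := ℝ) (F := E) (coordCurve E x₀ γ) _ t :=
    hasMFDerivAt_iff_hasFDerivAt.mp h1
  rw [coordAlong, velocity, toChart_eq_mfderiv hx]
  exact h2.hasDerivAt

lemma eventually_mem_frameNhd (hγ : ContinuousAt γ t) (hx : γ t ∈ frameNhd E x₀) :
    ∀ᶠ s in 𝓝 t, γ s ∈ frameNhd E x₀ :=
  hγ.preimage_mem_nhds (isOpen_frameNhd.mem_nhds hx)

/-- The change of components between two charts, along a curve. -/
lemma differentiableAt_changeChart {x₁ : M} (h0 : γ t ∈ (chartAt E x₀).source)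
    (h1 : γ t ∈ (chartAt E x₁).source) (hγ : MDifferentiableAt 𝓘(ℝ, ℝ) 𝓘(ℝ, E) γ t) :
    ∃ A : ℝ → E →L[ℝ] E, DifferentiableAt ℝ A t ∧
      ∀ᶠ s in 𝓝 t, ∀ v : TangentSpace 𝓘(ℝ, E) (γ s),
        toChart x₀ (γ s) v = A s (toChart x₁ (γ s) v) := by
  refine ⟨fun s => ((trivializationAt E (fun x : M => TangentSpace 𝓘(ℝ, E) x) x₁).coordChangeL ℝ
    (trivializationAt E (fun x : M => TangentSpace 𝓘(ℝ, E) x) x₀) (γ s) : E →L[ℝ] E), ?_, ?_⟩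
  · have h2 := (contMDiffOn_coordChangeL (n := 1) (IB := 𝓘(ℝ, E))
      (trivializationAt E (fun x : M => TangentSpace 𝓘(ℝ, E) x) x₁)
      (trivializationAt E (fun x : M => TangentSpace 𝓘(ℝ, E) x) x₀)).contMDiffAt
      (x := γ t) (((chartAt E x₁).open_source.inter (chartAt E x₀).open_source).mem_nhds ⟨h1, h0⟩)
    exact ((h2.mdifferentiableAt one_ne_zero).comp t hγ).differentiableAt
  · filter_upwards [hγ.continuousAt.preimage_mem_nhds ((chartAt E x₀).open_source.mem_nhds h0),
      hγ.continuousAt.preimage_mem_nhds ((chartAt E x₁).open_source.mem_nhds h1)] with s hs0 hs1 v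
    have h3 := (trivializationAt E (fun x : M => TangentSpace 𝓘(ℝ, E) x) x₁).coordChangeL_apply
      (R := ℝ) (trivializationAt E (fun x : M => TangentSpace 𝓘(ℝ, E) x) x₀) (b := γ s) ⟨hs1, hs0⟩
      (toChart x₁ (γ s) v)
    refine Eq.trans ?_ h3.symm
    rw [← ofChart_apply hs1, ofChart_toChart hs1, toChart_apply hs0]

section CovDeriv

variable (cov : CovariantDerivative 𝓘(ℝ, E) E (fun x : M => TangentSpace 𝓘(ℝ, E) x))

/-- The covariant derivative along a curve in components. -/
lemma toChart_covDerivAlong (hx : γ t ∈ frameNhd E x₀)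
    (hγ : MDifferentiableAt 𝓘(ℝ, ℝ) 𝓘(ℝ, E) γ t) {V : ∀ t, TangentSpace 𝓘(ℝ, E) (γ t)}
    (hV : DifferentiableAt ℝ (coordAlong x₀ γ V) t) :
    coordAlong x₀ γ (covDerivAlong cov γ V) t = deriv (coordAlong x₀ γ V) t +
      localConn cov x₀ (coordCurve E x₀ γ t) (deriv (coordCurve E x₀ γ) t)
        (coordAlong x₀ γ V t) := by
  -- `covDerivAlong` is defined through the chart at `γ t`, which moves with `t`. Here it is
  -- transferred to a fixed chart at `x₀`, with `A` and `B` the changes of components along the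
  -- curve.
  set x₁ := γ t with hx₁
  have h1 : γ t ∈ (chartAt E x₁).source := mem_chart_source E x₁
  obtain ⟨A, hA, hAv⟩ := differentiableAt_changeChart (x₁ := x₁) hx.1 h1 hγ
  obtain ⟨B, hB, hBv⟩ := differentiableAt_changeChart (x₁ := x₀) h1 hx.1 hγ
  set σ := FiberBundle.extend E (V t) with hσ
  have hσd : MDifferentiableAt 𝓘(ℝ, E) (𝓘(ℝ, E)).tangent
      (fun x : M => (⟨x, σ x⟩ : TangentBundle 𝓘(ℝ, E) M)) (γ t) :=
    FiberBundle.mdifferentiableAt_extend 𝓘(ℝ, E) E (V t)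
  have hσ1 : ∀ z ∈ (chartAt E x₁).source, toChart x₁ z (σ z) = toChart x₁ (γ t) (V t) := by
    intro z hz
    rw [toChart_apply hz, toChart_apply h1]
    have hz' : z ∈ (trivializationAt E (fun x : M => TangentSpace 𝓘(ℝ, E) x) (γ t)).baseSet := hz
    rw [hσ, FiberBundle.extend, Bundle.Trivialization.apply_mk_symm _ hz']
  have hs1 := hγ.continuousAt.preimage_mem_nhds ((chartAt E x₁).open_source.mem_nhds h1)
  have hs0 := hγ.continuousAt.preimage_mem_nhds ((chartAt E x₀).open_source.mem_nhds hx.1)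
  -- components in the chart at `γ t`
  have hV1 : DifferentiableAt ℝ (coordAlong x₁ γ V) t := by
    refine (hB.clm_apply hV).congr_of_eventuallyEq ?_
    filter_upwards [hBv] with s hs using hs _
  have e1 : HasDerivAt (coordAlong x₀ γ V) (deriv A t (coordAlong x₁ γ V t) +
      A t (deriv (coordAlong x₁ γ V) t)) t := by
    refine (hA.hasDerivAt.clm_apply hV1.hasDerivAt).congr_of_eventuallyEq ?_
    filter_upwards [hAv] with s hs using hs _
  -- The extension `σ` has constant components in the chart at `x₁`, so its components in the other
  -- chart vary only through `A`. Together with the chain rule in `e3` this expresses `A'` by the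
  -- derivative of `σ`, the term needed in the transformation rule.
  have e2 : HasDerivAt (fun s => coordField x₀ σ (coordCurve E x₀ γ s))
      (deriv A t (coordAlong x₁ γ V t)) t := by
    have := hA.hasDerivAt.clm_apply (hasDerivAt_const t (coordAlong x₁ γ V t))
    rw [map_zero, add_zero] at this
    refine this.congr_of_eventuallyEq ?_
    filter_upwards [hAv, hs1, hs0] with s hs h1 h0
    rw [coordCurve, coordField_chartAt h0, hs, hσ1 _ h1]
    rfl
  have hu := hasDerivAt_coordCurve hx.1 hγ
  have e3 : HasDerivAt (fun s => coordField x₀ σ (coordCurve E x₀ γ s))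
      (fderiv ℝ (coordField x₀ σ) (coordCurve E x₀ γ t)
        (coordAlong x₀ γ (velocity (I := 𝓘(ℝ, E)) γ) t)) t := by
    have := (hasFDerivAt_comp_chart_symm hx.1 ((mdifferentiableAt_section_iff_coord hx.1).mp hσd)).1
    exact (this.hasFDerivAt.comp_hasDerivAt t hu)
  have e4 : coordAlong x₀ γ (covDerivAlong cov γ V) t = A t (deriv (coordAlong x₁ γ V) t) +
      toChart x₀ (γ t) (cov σ (γ t) (velocity (I := 𝓘(ℝ, E)) γ t)) := by
    rw [coordAlong, covDerivAlong, map_add]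
    congr 1
    rw [← ofChart_apply h1, hAv.self_of_nhds, toChart_ofChart h1]
    congr 1
    refine Filter.EventuallyEq.deriv_eq ?_
    filter_upwards [hs1] with s hs
    rw [coordAlong, toChart_apply hs]
  rw [e4, toChart_cov_eq cov hx hσd, hu.deriv, e1.deriv]
  have e5 := e2.unique e3
  rw [e5]
  have e6 : σ (γ t) = V t := FiberBundle.extend_apply_self E (V t)
  rw [e6]
  simp only [coordCurve, coordAlong]
  abel

end CovDeriv

section Smooth

variable {J : Set ℝ} {V W : ∀ t, TangentSpace 𝓘(ℝ, E) (γ t)}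

lemma mdifferentiableAt_curve (hJ : IsOpen J) (hγ : ContMDiffOn 𝓘(ℝ, ℝ) 𝓘(ℝ, E) ∞ γ J)
    (ht : t ∈ J) : MDifferentiableAt 𝓘(ℝ, ℝ) 𝓘(ℝ, E) γ t :=
  (hγ.contMDiffAt (hJ.mem_nhds ht)).mdifferentiableAt (by simp)

lemma contDiffAt_coordCurve (hJ : IsOpen J) (hγ : ContMDiffOn 𝓘(ℝ, ℝ) 𝓘(ℝ, E) ∞ γ J)
    (ht : t ∈ J) (hx : γ t ∈ (chartAt E x₀).source) : ContDiffAt ℝ ∞ (coordCurve E x₀ γ) t :=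
  ((contMDiffAt_chart hx).comp t (hγ.contMDiffAt (hJ.mem_nhds ht))).contDiffAt

lemma SmoothAlong.contDiffAt (hV : SmoothAlong J γ V) (hJ : IsOpen J) (ht : t ∈ J)
    (hx : γ t ∈ (chartAt E x₀).source) : ContDiffAt ℝ ∞ (coordAlong x₀ γ V) t :=
  (((contMDiffWithinAt_field_iff_coord hx).mp (hV t ht)).2.contMDiffAt (hJ.mem_nhds ht)).contDiffAt

lemma smoothAlong_of_contDiffAt (hγ : ContMDiffOn 𝓘(ℝ, ℝ) 𝓘(ℝ, E) ∞ γ J)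
    (h : ∀ t ∈ J, ContDiffAt ℝ ∞ (coordAlong (γ t) γ V) t) : SmoothAlong J γ V := fun t ht =>
  (contMDiffWithinAt_field_iff_coord (mem_chart_source E (γ t))).mpr
    ⟨hγ t ht, (h t ht).contMDiffAt.contMDiffWithinAt⟩

lemma SmoothAlong.differentiableAt (hV : SmoothAlong J γ V) (hJ : IsOpen J) (ht : t ∈ J)
    (hx : γ t ∈ (chartAt E x₀).source) : DifferentiableAt ℝ (coordAlong x₀ γ V) t :=
  (hV.contDiffAt hJ ht hx).differentiableAt (by simp)

lemma eventually_mem_curve (hJ : IsOpen J) (hγ : ContMDiffOn 𝓘(ℝ, ℝ) 𝓘(ℝ, E) ∞ γ J)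
    (ht : t ∈ J) (hx : γ t ∈ frameNhd E x₀) : ∀ᶠ s in 𝓝 t, s ∈ J ∧ γ s ∈ frameNhd E x₀ :=
  Filter.Eventually.and (hJ.mem_nhds ht)
    (eventually_mem_frameNhd (mdifferentiableAt_curve hJ hγ ht).continuousAt hx)

lemma coordAlong_velocity (hJ : IsOpen J) (hγ : ContMDiffOn 𝓘(ℝ, ℝ) 𝓘(ℝ, E) ∞ γ J)
    (ht : t ∈ J) (hx : γ t ∈ (chartAt E x₀).source) :
    coordAlong x₀ γ (velocity (I := 𝓘(ℝ, E)) γ) t = deriv (coordCurve E x₀ γ) t :=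
  (hasDerivAt_coordCurve hx (mdifferentiableAt_curve hJ hγ ht)).deriv.symm

lemma contDiffAt_deriv_infty {F : Type*} [NormedAddCommGroup F] [NormedSpace ℝ F] {f : ℝ → F}
    (hf : ContDiffAt ℝ ∞ f t) : ContDiffAt ℝ ∞ (deriv f) t := by
  have := hf.fderiv_right (m := ∞) (by simp)
  exact this.clm_apply contDiffAt_const

lemma smoothAlong_velocity (hJ : IsOpen J) (hγ : ContMDiffOn 𝓘(ℝ, ℝ) 𝓘(ℝ, E) ∞ γ J) :
    SmoothAlong J γ (velocity (I := 𝓘(ℝ, E)) γ) := by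
  refine smoothAlong_of_contDiffAt hγ fun t ht => ?_
  refine (contDiffAt_deriv_infty (contDiffAt_coordCurve hJ hγ ht
    (mem_chart_source E _))).congr_of_eventuallyEq ?_
  filter_upwards [eventually_mem_curve hJ hγ ht mem_frameNhd_self] with s hs
  exact coordAlong_velocity hJ hγ hs.1 hs.2.1

lemma SmoothAlong.add (hV : SmoothAlong J γ V) (hW : SmoothAlong J γ W) (hJ : IsOpen J)
    (hγ : ContMDiffOn 𝓘(ℝ, ℝ) 𝓘(ℝ, E) ∞ γ J) : SmoothAlong J γ (fun t => V t + W t) := by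
  refine smoothAlong_of_contDiffAt hγ fun t ht => ?_
  have := (hV.contDiffAt hJ ht (mem_chart_source E _)).add
    (hW.contDiffAt hJ ht (mem_chart_source E _))
  refine this.congr_of_eventuallyEq (Filter.Eventually.of_forall fun s => ?_)
  simp [coordAlong]

lemma SmoothAlong.smul {f : ℝ → ℝ} (hf : ContDiffOn ℝ ∞ f J) (hV : SmoothAlong J γ V)
    (hJ : IsOpen J) (hγ : ContMDiffOn 𝓘(ℝ, ℝ) 𝓘(ℝ, E) ∞ γ J) :
    SmoothAlong J γ (fun t => f t • V t) := by
  refine smoothAlong_of_contDiffAt hγ fun t ht => ?_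
  have := (hf.contDiffAt (hJ.mem_nhds ht)).smul (hV.contDiffAt hJ ht (mem_chart_source E _))
  refine this.congr_of_eventuallyEq (Filter.Eventually.of_forall fun s => ?_)
  simp [coordAlong]

lemma SmoothAlong.congr (hV : SmoothAlong J γ V) (h : ∀ t ∈ J, W t = V t) :
    SmoothAlong J γ W :=
  ContMDiffOn.congr hV fun t ht => by rw [h t ht]

end Smooth

section CovDerivRules

variable {cov : CovariantDerivative 𝓘(ℝ, E) E (fun x : M => TangentSpace 𝓘(ℝ, E) x)}
  {J : Set ℝ} {V W : ∀ t, TangentSpace 𝓘(ℝ, E) (γ t)}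

lemma covDerivAlong_congr (hJ : IsOpen J) (ht : t ∈ J) (h : ∀ t ∈ J, V t = W t) :
    covDerivAlong cov γ V t = covDerivAlong cov γ W t := by
  rw [covDerivAlong, covDerivAlong, h t ht]
  congr 2
  refine Filter.EventuallyEq.deriv_eq ?_
  filter_upwards [hJ.mem_nhds ht] with s hs
  rw [h s hs]

lemma SmoothAlong.covDerivAlong_coord (hV : SmoothAlong J γ V) (hJ : IsOpen J)
    (hγ : ContMDiffOn 𝓘(ℝ, ℝ) 𝓘(ℝ, E) ∞ γ J) (ht : t ∈ J) (hx : γ t ∈ frameNhd E x₀) :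
    coordAlong x₀ γ (covDerivAlong cov γ V) t = deriv (coordAlong x₀ γ V) t +
      localConn cov x₀ (coordCurve E x₀ γ t) (deriv (coordCurve E x₀ γ) t)
        (coordAlong x₀ γ V t) :=
  toChart_covDerivAlong cov hx (mdifferentiableAt_curve hJ hγ ht) (hV.differentiableAt hJ ht hx.1)

lemma SmoothAlong.covDerivAlong (hV : SmoothAlong J γ V) (hJ : IsOpen J)
    (hγ : ContMDiffOn 𝓘(ℝ, ℝ) 𝓘(ℝ, E) ∞ γ J) (hcov : cov.ContMDiffCovariantDerivative ∞) :
    SmoothAlong J γ (covDerivAlong cov γ V) := by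
  refine smoothAlong_of_contDiffAt hγ fun t ht => ?_
  have hu := contDiffAt_coordCurve hJ hγ ht (mem_chart_source E (γ t))
  have hv := hV.contDiffAt hJ ht (mem_chart_source E (γ t))
  have hC : ContDiffAt ℝ ∞ (localConn cov (γ t)) (coordCurve E (γ t) γ t) :=
    (contDiffOn_localConn hcov (γ t)).contDiffAt
      (isOpen_chartNhd.mem_nhds (chartAt_mem_chartNhd mem_frameNhd_self))
  refine ((contDiffAt_deriv_infty hv).add (((hC.comp t hu).clm_apply
    (contDiffAt_deriv_infty hu)).clm_apply hv)).congr_of_eventuallyEq ?_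
  filter_upwards [eventually_mem_curve hJ hγ ht mem_frameNhd_self] with s hs
  exact hV.covDerivAlong_coord hJ hγ hs.1 hs.2

lemma covDerivAlong_add (hV : SmoothAlong J γ V) (hW : SmoothAlong J γ W) (hJ : IsOpen J)
    (hγ : ContMDiffOn 𝓘(ℝ, ℝ) 𝓘(ℝ, E) ∞ γ J) (ht : t ∈ J) :
    SesquiHarmonic.covDerivAlong cov γ (fun t => V t + W t) t =
      SesquiHarmonic.covDerivAlong cov γ V t + SesquiHarmonic.covDerivAlong cov γ W t := by
  have hx := mem_chart_source E (γ t)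
  have hx' : γ t ∈ frameNhd E (γ t) := mem_frameNhd_self
  have e : coordAlong (γ t) γ (fun t => V t + W t) =
      coordAlong (γ t) γ V + coordAlong (γ t) γ W := by
    ext s; simp [coordAlong]
  refine toChart_injective hx ?_
  have h := (hV.add hW hJ hγ).covDerivAlong_coord (cov := cov) hJ hγ ht hx'
  have h1 := hV.covDerivAlong_coord (cov := cov) hJ hγ ht hx'
  have h2 := hW.covDerivAlong_coord (cov := cov) hJ hγ ht hx'
  rw [e, deriv_add (hV.differentiableAt hJ ht hx) (hW.differentiableAt hJ ht hx), Pi.add_apply,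
    map_add] at h
  rw [coordAlong] at h h1 h2
  rw [map_add, h, h1, h2]
  abel

lemma covDerivAlong_smul {f : ℝ → ℝ} (hf : ContDiffOn ℝ ∞ f J) (hV : SmoothAlong J γ V)
    (hJ : IsOpen J) (hγ : ContMDiffOn 𝓘(ℝ, ℝ) 𝓘(ℝ, E) ∞ γ J) (ht : t ∈ J) :
    SesquiHarmonic.covDerivAlong cov γ (fun t => f t • V t) t =
      deriv f t • V t + f t • SesquiHarmonic.covDerivAlong cov γ V t := by
  have hx := mem_chart_source E (γ t)
  have hx' : γ t ∈ frameNhd E (γ t) := mem_frameNhd_self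
  have e : coordAlong (γ t) γ (fun t => f t • V t) = fun s => f s • coordAlong (γ t) γ V s := by
    ext s; simp [coordAlong]
  refine toChart_injective hx ?_
  have h := (hV.smul hf hJ hγ).covDerivAlong_coord (cov := cov) hJ hγ ht hx'
  have h1 := hV.covDerivAlong_coord (cov := cov) hJ hγ ht hx'
  have hfd : DifferentiableAt ℝ f t := ContDiffOn.differentiableAt_of_isOpen hf hJ ht
  rw [e, deriv_fun_smul hfd (hV.differentiableAt hJ ht hx), map_smul] at h
  rw [coordAlong] at h h1
  rw [map_add, map_smul, map_smul, h, h1]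
  simp only [coordAlong, smul_add]
  abel

end CovDerivRules

section Metric

variable [Bundle.RiemannianBundle (fun x : M => TangentSpace 𝓘(ℝ, E) x)]
  [IsContMDiffRiemannianBundle 𝓘(ℝ, E) ∞ E (fun x : M => TangentSpace 𝓘(ℝ, E) x)]
  {cov : CovariantDerivative 𝓘(ℝ, E) E (fun x : M => TangentSpace 𝓘(ℝ, E) x)}
  {J : Set ℝ} {V W : ∀ t, TangentSpace 𝓘(ℝ, E) (γ t)}

lemma inner_eq_coordAlong (hx : γ t ∈ frameNhd E x₀) : (inner ℝ (V t) (W t) : ℝ) =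
    localMetric x₀ (coordCurve E x₀ γ t) (coordAlong x₀ γ V t) (coordAlong x₀ γ W t) :=
  inner_eq_localMetric hx _ _

lemma contDiffOn_inner_along (hV : SmoothAlong J γ V) (hW : SmoothAlong J γ W) (hJ : IsOpen J)
    (hγ : ContMDiffOn 𝓘(ℝ, ℝ) 𝓘(ℝ, E) ∞ γ J) :
    ContDiffOn ℝ ∞ (fun t => (inner ℝ (V t) (W t) : ℝ)) J := by
  intro t ht
  have hx := mem_chart_source E (γ t)
  have hG : ContDiffAt ℝ ∞ (localMetric (E := E) (γ t)) (coordCurve E (γ t) γ t) :=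
    (contDiffOn_localMetric (γ t)).contDiffAt
      (isOpen_chartNhd.mem_nhds (chartAt_mem_chartNhd mem_frameNhd_self))
  refine ContDiffAt.contDiffWithinAt ((((hG.comp t (contDiffAt_coordCurve hJ hγ ht hx)).clm_apply
    (hV.contDiffAt hJ ht hx)).clm_apply (hW.contDiffAt hJ ht hx)).congr_of_eventuallyEq ?_)
  filter_upwards [eventually_mem_curve hJ hγ ht mem_frameNhd_self] with s hs
  exact inner_eq_coordAlong hs.2

set_option synthInstance.maxHeartbeats 400000 in
set_option maxHeartbeats 2000000 in
/-- The Levi-Civita connection is metric along curves. -/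
lemma hasDerivAt_inner_along (hcov : IsLeviCivita cov) (hV : SmoothAlong J γ V)
    (hW : SmoothAlong J γ W) (hJ : IsOpen J) (hγ : ContMDiffOn 𝓘(ℝ, ℝ) 𝓘(ℝ, E) ∞ γ J)
    (ht : t ∈ J) : HasDerivAt (fun t => (inner ℝ (V t) (W t) : ℝ))
      (inner ℝ (SesquiHarmonic.covDerivAlong cov γ V t) (W t) +
        inner ℝ (V t) (SesquiHarmonic.covDerivAlong cov γ W t)) t := by
  have hx := mem_chart_source E (γ t)
  have hx' : γ t ∈ frameNhd E (γ t) := mem_frameNhd_self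
  have hl := hcov.isLocalLeviCivita (γ t)
  have hy : coordCurve E (γ t) γ t ∈ chartNhd E (γ t) := chartAt_mem_chartNhd mem_frameNhd_self
  have hG := ContDiffOn.differentiableAt_of_isOpen hl.smooth_metric hl.isOpen hy
  have hu := (contDiffAt_coordCurve hJ hγ ht hx).differentiableAt (by simp)
  have h := ((hG.hasFDerivAt.comp_hasDerivAt t hu.hasDerivAt).clm_apply
    (hV.differentiableAt hJ ht hx).hasDerivAt).clm_apply (hW.differentiableAt hJ ht hx).hasDerivAt
  rw [inner_eq_coordAlong (V := SesquiHarmonic.covDerivAlong cov γ V) hx',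
    inner_eq_coordAlong (W := SesquiHarmonic.covDerivAlong cov γ W) hx',
    hV.covDerivAlong_coord hJ hγ ht hx', hW.covDerivAlong_coord hJ hγ ht hx']
  refine (h.congr_of_eventuallyEq ?_).congr_deriv ?_
  · filter_upwards [eventually_mem_curve hJ hγ ht mem_frameNhd_self] with s hs
    exact inner_eq_coordAlong hs.2
  · simp only [Function.comp_apply, add_apply, map_add, hl.metric _ hy]
    ring

end Metric

/-! ### The structure tensors along a curve -/

section Sasaki

variable [Bundle.RiemannianBundle (fun x : M => TangentSpace 𝓘(ℝ, E) x)]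
  [IsContMDiffRiemannianBundle 𝓘(ℝ, E) ∞ E (fun x : M => TangentSpace 𝓘(ℝ, E) x)]
  {cov : CovariantDerivative 𝓘(ℝ, E) E (fun x : M => TangentSpace 𝓘(ℝ, E) x)}
  {φ : ∀ x : M, TangentSpace 𝓘(ℝ, E) x →L[ℝ] TangentSpace 𝓘(ℝ, E) x}
  {ξ : ∀ x : M, TangentSpace 𝓘(ℝ, E) x} {η : ∀ x : M, TangentSpace 𝓘(ℝ, E) x →L[ℝ] ℝ} {c : ℝ}
  {J : Set ℝ} {V : ∀ t, TangentSpace 𝓘(ℝ, E) (γ t)}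

lemma SmoothAlong.phi (hV : SmoothAlong J γ V) (h : IsAlmostContactMetric φ ξ η) (hJ : IsOpen J)
    (hγ : ContMDiffOn 𝓘(ℝ, ℝ) 𝓘(ℝ, E) ∞ γ J) :
    SmoothAlong J γ (fun t => φ (γ t) (V t)) := by
  refine smoothAlong_of_contDiffAt hγ fun t ht => ?_
  have hx := mem_chart_source E (γ t)
  have hP : ContDiffAt ℝ ∞ (localEnd φ (γ t)) (coordCurve E (γ t) γ t) :=
    (h.contDiffOn_localEnd (γ t)).contDiffAt
      (isOpen_chartNhd.mem_nhds (chartAt_mem_chartNhd mem_frameNhd_self))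
  refine ((hP.comp t (contDiffAt_coordCurve hJ hγ ht hx)).clm_apply
    (hV.contDiffAt hJ ht hx)).congr_of_eventuallyEq ?_
  filter_upwards [eventually_mem_curve hJ hγ ht mem_frameNhd_self] with s hs
  exact toChart_end hs.2.1 _

lemma IsSmoothField.smoothAlong {X : ∀ x : M, TangentSpace 𝓘(ℝ, E) x}
    (hX : IsSmoothField (I := 𝓘(ℝ, E)) X) (hγ : ContMDiffOn 𝓘(ℝ, ℝ) 𝓘(ℝ, E) ∞ γ J) :
    SmoothAlong J γ (fun t => X (γ t)) :=
  ContMDiff.comp_contMDiffOn hX hγ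

/-- `∇_T (φ V) = φ ∇_T V + g(T, V) ξ - η(V) T` along a curve in a Sasakian manifold. -/
lemma covDerivAlong_phi (hcov : IsLeviCivita cov) (hS : IsSasakian φ ξ η)
    (hc : HasConstantPhiSectionalCurvature cov φ η c) (hV : SmoothAlong J γ V) (hJ : IsOpen J)
    (hγ : ContMDiffOn 𝓘(ℝ, ℝ) 𝓘(ℝ, E) ∞ γ J) (ht : t ∈ J) :
    covDerivAlong cov γ (fun t => φ (γ t) (V t)) t = φ (γ t) (covDerivAlong cov γ V t) +
      ((inner ℝ (velocity (I := 𝓘(ℝ, E)) γ t) (V t) : ℝ) • ξ (γ t) -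
        η (γ t) (V t) • velocity (I := 𝓘(ℝ, E)) γ t) := by
  have hx := mem_chart_source E (γ t)
  have hx' : γ t ∈ frameNhd E (γ t) := mem_frameNhd_self
  have hl := hS.isLocalSasakiSpaceForm hcov hc (γ t)
  have hy : coordCurve E (γ t) γ t ∈ chartNhd E (γ t) := chartAt_mem_chartNhd mem_frameNhd_self
  have hP := ContDiffOn.differentiableAt_of_isOpen hl.smooth_phi hl.isOpen hy
  have hu := (contDiffAt_coordCurve hJ hγ ht hx).differentiableAt (by simp)
  have hd : HasDerivAt (coordAlong (γ t) γ (fun t => φ (γ t) (V t))) _ t :=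
    ((hP.hasFDerivAt.comp_hasDerivAt t hu.hasDerivAt).clm_apply
    (hV.differentiableAt hJ ht hx).hasDerivAt).congr_of_eventuallyEq (by
      filter_upwards [eventually_mem_curve hJ hγ ht mem_frameNhd_self] with s hs
      exact toChart_end hs.2.1 _)
  have h1 := (hV.phi hS.toIsAlmostContactMetric hJ hγ).covDerivAlong_coord (cov := cov) hJ hγ ht hx'
  have h2 := hV.covDerivAlong_coord (cov := cov) hJ hγ ht hx'
  have e1 : coordAlong (γ t) γ (fun t => φ (γ t) (V t)) t = localEnd φ (γ t)
    (coordCurve E (γ t) γ t) (coordAlong (γ t) γ V t) := toChart_end hx _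
  have e2 : toChart (γ t) (γ t) (ξ (γ t)) = coordField (γ t) ξ (coordCurve E (γ t) γ t) :=
    (coordField_chartAt hx ξ).symm
  have e3 := coordAlong_velocity hJ hγ ht hx
  have e4 := inner_eq_coordAlong (V := velocity (I := 𝓘(ℝ, E)) γ) (W := V) hx'
  rw [e3] at e4
  rw [hd.deriv, e1] at h1
  refine toChart_injective hx ?_
  rw [coordAlong] at h1 h2 e3
  rw [h1, map_add, map_sub, map_smul, map_smul, toChart_end hx, h2, e2, e3,
    e4, form_eq_localForm hx]
  have h3 := hl.nabla_phi hy (deriv (coordCurve E (γ t) γ) t) (coordAlong (γ t) γ V t)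
  simp only [Function.comp_apply]
  rw [h3]
  simp only [map_add, coordAlong, coordCurve]
  abel

/-- `∇_T ξ = -φ T` along a curve in a Sasakian manifold. -/
lemma covDerivAlong_xi (hcov : IsLeviCivita cov) (hS : IsSasakian φ ξ η)
    (hc : HasConstantPhiSectionalCurvature cov φ η c) (hJ : IsOpen J)
    (hγ : ContMDiffOn 𝓘(ℝ, ℝ) 𝓘(ℝ, E) ∞ γ J) (ht : t ∈ J) :
    covDerivAlong cov γ (fun t => ξ (γ t)) t = -φ (γ t) (velocity (I := 𝓘(ℝ, E)) γ t) := by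
  have hx := mem_chart_source E (γ t)
  have hx' : γ t ∈ frameNhd E (γ t) := mem_frameNhd_self
  have hl := hS.isLocalSasakiSpaceForm hcov hc (γ t)
  have hy : coordCurve E (γ t) γ t ∈ chartNhd E (γ t) := chartAt_mem_chartNhd mem_frameNhd_self
  have hP := ContDiffOn.differentiableAt_of_isOpen hl.smooth_xi hl.isOpen hy
  have hu := (contDiffAt_coordCurve hJ hγ ht hx).differentiableAt (by simp)
  have hd : HasDerivAt (coordAlong (γ t) γ (fun t => ξ (γ t))) _ t :=
    (hP.hasFDerivAt.comp_hasDerivAt t hu.hasDerivAt).congr_of_eventuallyEq (by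
      filter_upwards [eventually_mem_curve hJ hγ ht mem_frameNhd_self] with s hs
      exact (coordField_chartAt hs.2.1 ξ).symm)
  have h1 := (hS.smooth_xi.smoothAlong hγ).covDerivAlong_coord (cov := cov) hJ hγ ht hx'
  have e2 : coordAlong (γ t) γ (fun t => ξ (γ t)) t =
    coordField (γ t) ξ (coordCurve E (γ t) γ t) := (coordField_chartAt hx ξ).symm
  have e3 := coordAlong_velocity hJ hγ ht hx
  rw [hd.deriv, e2, hl.nabla_xi hy] at h1
  refine toChart_injective hx ?_
  rw [coordAlong] at h1 e3
  rw [h1, map_neg, toChart_end hx, e3]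
  simp only [coordCurve]
  abel

end Sasaki

end AlongCurves

end SesquiHarmonic

namespace SesquiHarmonic

/-! ### Covariant derivatives along maps, in coordinates -/

section AlongMap

set_option synthInstance.maxHeartbeats 400000
set_option maxHeartbeats 2000000

variable {E : Type*} [NormedAddCommGroup E] [NormedSpace ℝ E]
  {Q : Type*} [NormedAddCommGroup Q] [NormedSpace ℝ Q]
  {U : Set E} {G : E → E →L[ℝ] E →L[ℝ] ℝ} {C : E → E →L[ℝ] E →L[ℝ] E}
  {O : Set Q} {u W Z : Q → E} {p e e' : Q}

/-- The covariant derivative in the direction `e` of a vector field `W` along the map `u`, in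
coordinates. -/
noncomputable def covAlong (C : E → E →L[ℝ] E →L[ℝ] E) (u : Q → E) (e : Q) (W : Q → E) (p : Q) : E :=
  fderiv ℝ W p e + C (u p) (fderiv ℝ u p e) (W p)

lemma contDiffOn_fderiv_apply {F : Type*} [NormedAddCommGroup F] [NormedSpace ℝ F] {f : Q → F}
    (hO : IsOpen O) (hf : ContDiffOn ℝ ∞ f O) (e : Q) :
    ContDiffOn ℝ ∞ (fun p => fderiv ℝ f p e) O :=
  (ContDiffOn.fderiv_of_isOpen_infty hf hO).clm_apply contDiffOn_const

lemma contDiffOn_covAlong (hO : IsOpen O) (hC : ContDiffOn ℝ ∞ C U) (hu : ContDiffOn ℝ ∞ u O)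
    (hm : MapsTo u O U) (hW : ContDiffOn ℝ ∞ W O) (e : Q) :
    ContDiffOn ℝ ∞ (covAlong C u e W) O :=
  (contDiffOn_fderiv_apply hO hW e).add
    (((hC.comp hu hm).clm_apply (contDiffOn_fderiv_apply hO hu e)).clm_apply hW)

lemma fderiv_fderiv_apply {F : Type*} [NormedAddCommGroup F] [NormedSpace ℝ F] {f : Q → F}
    (hO : IsOpen O) (hf : ContDiffOn ℝ ∞ f O) (hp : p ∈ O) (e e' : Q) :
    fderiv ℝ (fun p => fderiv ℝ f p e') p e = fderiv ℝ (fderiv ℝ f) p e e' := by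
  have h := (ContDiffOn.differentiableAt_of_isOpen
    (ContDiffOn.fderiv_of_isOpen_infty hf hO) hO hp).hasFDerivAt
  rw [(h.clm_apply (hasFDerivAt_const e' p)).fderiv]
  simp

lemma fderiv_fderiv_apply_comm {F : Type*} [NormedAddCommGroup F] [NormedSpace ℝ F] {f : Q → F}
    (hO : IsOpen O) (hf : ContDiffOn ℝ ∞ f O) (hp : p ∈ O) (e e' : Q) :
    fderiv ℝ (fun p => fderiv ℝ f p e') p e = fderiv ℝ (fun p => fderiv ℝ f p e) p e' := by
  rw [fderiv_fderiv_apply hO hf hp, fderiv_fderiv_apply hO hf hp, fderiv_fderiv_symm hf hO hp]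

/-- `∇_s ∂_t = ∇_t ∂_s`, from symmetry of second derivatives and vanishing torsion. -/
lemma covAlong_comm (h : IsLocalLeviCivita U G C) (hO : IsOpen O) (hu : ContDiffOn ℝ ∞ u O)
    (hm : MapsTo u O U) (hp : p ∈ O) (e e' : Q) :
    covAlong C u e (fun p => fderiv ℝ u p e') p = covAlong C u e' (fun p => fderiv ℝ u p e) p := by
  rw [covAlong, covAlong, fderiv_fderiv_apply_comm hO hu hp, h.conn_symm _ (hm hp)]

lemma covAlong_congr {W' : Q → E} (hO : IsOpen O) (hp : p ∈ O) (hW : ∀ q ∈ O, W q = W' q) :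
    covAlong C u e W p = covAlong C u e W' p := by
  have : W =ᶠ[𝓝 p] W' := by
    filter_upwards [hO.mem_nhds hp] with q hq using hW q hq
  rw [covAlong, covAlong, this.fderiv_eq, hW p hp]

lemma fderiv_conn_along (h : IsLocalLeviCivita U G C) (hO : IsOpen O) (hu : ContDiffOn ℝ ∞ u O)
    (hm : MapsTo u O U) (hW : ContDiffOn ℝ ∞ W O) (hp : p ∈ O) (e e' : Q) :
    fderiv ℝ (covAlong C u e' W) p e = fderiv ℝ (fun p => fderiv ℝ W p e') p e +
      (fderiv ℝ C (u p) (fderiv ℝ u p e) (fderiv ℝ u p e') (W p) +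
      C (u p) (fderiv ℝ (fun p => fderiv ℝ u p e') p e) (W p) +
      C (u p) (fderiv ℝ u p e') (fderiv ℝ W p e)) := by
  have hC := (ContDiffOn.differentiableAt_of_isOpen h.smooth_conn h.isOpen (hm hp)).hasFDerivAt
  have hu' := (ContDiffOn.differentiableAt_of_isOpen hu hO hp).hasFDerivAt
  have hW' := (ContDiffOn.differentiableAt_of_isOpen hW hO hp).hasFDerivAt
  have hu2 := (ContDiffOn.differentiableAt_of_isOpen
    (contDiffOn_fderiv_apply hO hu e') hO hp).hasFDerivAt
  have hW2 := (ContDiffOn.differentiableAt_of_isOpen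
    (contDiffOn_fderiv_apply hO hW e') hO hp).hasFDerivAt
  have key := hW2.fun_add (((hC.comp p hu').clm_apply hu2).clm_apply hW')
  have e1 : fderiv ℝ (covAlong C u e' W) p = _ := key.fderiv
  rw [e1]
  simp
  abel

/-- Covariant derivatives along a map commute up to curvature. -/
lemma covAlong_covAlong (h : IsLocalLeviCivita U G C) (hO : IsOpen O) (hu : ContDiffOn ℝ ∞ u O)
    (hm : MapsTo u O U) (hW : ContDiffOn ℝ ∞ W O) (hp : p ∈ O) (e e' : Q) :
    covAlong C u e (covAlong C u e' W) p = covAlong C u e' (covAlong C u e W) p +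
      localCurvature C (u p) (fderiv ℝ u p e) (fderiv ℝ u p e') (W p) := by
  have h1 : ∀ e e', covAlong C u e (covAlong C u e' W) p = fderiv ℝ (covAlong C u e' W) p e +
    C (u p) (fderiv ℝ u p e) (covAlong C u e' W p) := fun _ _ => rfl
  rw [h1, h1, fderiv_conn_along h hO hu hm hW hp, fderiv_conn_along h hO hu hm hW hp,
    fderiv_fderiv_apply_comm hO hW hp, fderiv_fderiv_apply_comm hO hu hp]
  simp only [covAlong, localCurvature, map_add]
  abel

lemma fderiv_metric_along (h : IsLocalLeviCivita U G C) (hO : IsOpen O) (hu : ContDiffOn ℝ ∞ u O)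
    (hm : MapsTo u O U) (hW : ContDiffOn ℝ ∞ W O) (hZ : ContDiffOn ℝ ∞ Z O) (hp : p ∈ O) (e : Q) :
    fderiv ℝ (fun p => G (u p) (W p) (Z p)) p e =
      G (u p) (covAlong C u e W p) (Z p) + G (u p) (W p) (covAlong C u e Z p) := by
  have hG := (ContDiffOn.differentiableAt_of_isOpen h.smooth_metric h.isOpen (hm hp)).hasFDerivAt
  have hu' := (ContDiffOn.differentiableAt_of_isOpen hu hO hp).hasFDerivAt
  have hW' := (ContDiffOn.differentiableAt_of_isOpen hW hO hp).hasFDerivAt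
  have hZ' := (ContDiffOn.differentiableAt_of_isOpen hZ hO hp).hasFDerivAt
  have key := ((hG.comp p hu').clm_apply hW').clm_apply hZ'
  have e1 : fderiv ℝ (fun p => G (u p) (W p) (Z p)) p = _ := key.fderiv
  rw [e1]
  simp [covAlong, h.metric _ (hm hp)]
  ring

lemma contDiffOn_metric_along (hG : ContDiffOn ℝ ∞ G U) (hu : ContDiffOn ℝ ∞ u O)
    (hm : MapsTo u O U) (hW : ContDiffOn ℝ ∞ W O) (hZ : ContDiffOn ℝ ∞ Z O) :
    ContDiffOn ℝ ∞ (fun p => G (u p) (W p) (Z p)) O :=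
  ((hG.comp hu hm).clm_apply hW).clm_apply hZ

/-- First variation of the energy density. -/
lemma fderiv_energy (h : IsLocalLeviCivita U G C) (hO : IsOpen O) (hu : ContDiffOn ℝ ∞ u O)
    (hm : MapsTo u O U) (hp : p ∈ O) (e e' : Q) :
    fderiv ℝ (fun p => G (u p) (fderiv ℝ u p e') (fderiv ℝ u p e')) p e =
      2 * G (u p) (covAlong C u e' (fun p => fderiv ℝ u p e) p) (fderiv ℝ u p e') := by
  have hT := contDiffOn_fderiv_apply hO hu e'
  rw [fderiv_metric_along h hO hu hm hT hT hp, covAlong_comm h hO hu hm hp e e',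
    h.inner_symm _ (hm hp) (fderiv ℝ u p e')]
  ring

/-- First variation of the bienergy density. -/
lemma fderiv_bienergy (h : IsLocalLeviCivita U G C) (hO : IsOpen O) (hu : ContDiffOn ℝ ∞ u O)
    (hm : MapsTo u O U) (hp : p ∈ O) (e e' : Q) :
    fderiv ℝ (fun p => G (u p) (covAlong C u e' (fun p => fderiv ℝ u p e') p)
      (covAlong C u e' (fun p => fderiv ℝ u p e') p)) p e =
      2 * (G (u p) (covAlong C u e' (covAlong C u e' (fun p => fderiv ℝ u p e)) p)
        (covAlong C u e' (fun p => fderiv ℝ u p e') p) +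
      G (u p) (localCurvature C (u p) (fderiv ℝ u p e) (fderiv ℝ u p e') (fderiv ℝ u p e'))
        (covAlong C u e' (fun p => fderiv ℝ u p e') p)) := by
  have hT := contDiffOn_fderiv_apply hO hu e'
  have hτ := contDiffOn_covAlong hO h.smooth_conn hu hm hT e'
  -- With `e = ∂_s` and `e' = ∂_t`: `∇_s∇_t∂_t = ∇_t∇_s∂_t + R(∂_s,∂_t)∂_t`, and `∇_s∂_t = ∇_t∂_s`.
  rw [fderiv_metric_along h hO hu hm hτ hτ hp, covAlong_covAlong h hO hu hm hT hp,
    covAlong_congr hO hp (fun q hq => covAlong_comm h hO hu hm hq e e'),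
    h.inner_symm _ (hm hp) (covAlong C u e' (fun p => fderiv ℝ u p e') p)]
  rw [ContinuousLinearMap.map_add₂]
  ring

/-- `X ↦ R(X,v)v` is self-adjoint by pair symmetry, so its eigenvector `φv` can be moved to the
other side. This evaluates the curvature term of the bienergy when the tension is a multiple of
`φT`. -/
lemma IsLocalSasakiSpaceForm.inner_curvature_phi {P : E → E →L[ℝ] E} {ξ : E → E} {η : E → E →L[ℝ] ℝ}
    {c : ℝ} {y : E} (h : IsLocalSasakiSpaceForm U G C P ξ η c) (hy : y ∈ U) {v : E}
    (hv : η y v = 0) (hv1 : G y v v = 1) (X : E) :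
    G y (localCurvature C y X v v) (P y v) = c * G y X (P y v) := by
  rw [h.curvature_pair_symm hy, h.curvature_skew hy, IsLocalLeviCivita.curvature_antisymm,
    h.curvature_phi_section hy hv hv1]
  simp

end AlongMap

end SesquiHarmonic

namespace SesquiHarmonic

/-! ### Variations of a curve -/

section Variations

set_option linter.unusedSectionVars false

lemma hasDerivAt_slice_right {F : Type*} [NormedAddCommGroup F] [NormedSpace ℝ F] {f : ℝ × ℝ → F}
    {s t : ℝ} (h : DifferentiableAt ℝ f (s, t)) :
    HasDerivAt (fun t => f (s, t)) (fderiv ℝ f (s, t) (0, 1)) t :=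
  h.hasFDerivAt.comp_hasDerivAt t ((hasDerivAt_const t s).prodMk (hasDerivAt_id t))

lemma hasDerivAt_slice_left {F : Type*} [NormedAddCommGroup F] [NormedSpace ℝ F] {f : ℝ × ℝ → F}
    {s t : ℝ} (h : DifferentiableAt ℝ f (s, t)) :
    HasDerivAt (fun s => f (s, t)) (fderiv ℝ f (s, t) (1, 0)) s :=
  h.hasFDerivAt.comp_hasDerivAt s ((hasDerivAt_id s).prodMk (hasDerivAt_const s t))

variable {E : Type*} [NormedAddCommGroup E] [NormedSpace ℝ E] [FiniteDimensional ℝ E]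
  {M : Type*} [TopologicalSpace M] [T2Space M] [ChartedSpace E M] [IsManifold 𝓘(ℝ, E) ∞ M]
  {x₀ : M} {γ : ℝ → M} {Γ : ℝ → ℝ → M} {S J : Set ℝ} {s t : ℝ}

/-- A variation in the chart around `x₀`. -/
noncomputable def coordVariation (E : Type*) [NormedAddCommGroup E] {M : Type*} [TopologicalSpace M]
    [ChartedSpace E M] (x₀ : M) (Γ : ℝ → ℝ → M) (p : ℝ × ℝ) : E := chartAt E x₀ (Γ p.1 p.2)

/-- The set of parameters for which the variation lies in the domain of the chart around `x₀`. -/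
def variationDomain (E : Type*) [NormedAddCommGroup E] [NormedSpace ℝ E] [FiniteDimensional ℝ E]
    {M : Type*} [TopologicalSpace M] [ChartedSpace E M] (S J : Set ℝ) (x₀ : M)
    (Γ : ℝ → ℝ → M) : Set (ℝ × ℝ) :=
  (S ×ˢ J) ∩ (fun p : ℝ × ℝ => Γ p.1 p.2) ⁻¹' frameNhd E x₀

/-- The variation field of a variation `Γ` of `γ`. -/
noncomputable def variationField (E : Type*) [NormedAddCommGroup E] [NormedSpace ℝ E] {M : Type*}
    [TopologicalSpace M] [ChartedSpace E M] (γ : ℝ → M) (Γ : ℝ → ℝ → M) (t : ℝ) :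
    TangentSpace 𝓘(ℝ, E) (γ t) :=
  -- Tangent spaces at different points are all the model `E`, so a vector at `Γ 0 t` can be read at
  -- `γ t`; this is meaningful where the two points agree.
  (velocity (I := 𝓘(ℝ, E)) (fun s => Γ s t) 0 : TangentSpace 𝓘(ℝ, E) (Γ 0 t))

section Coord

variable (hS : IsOpen S) (hJ : IsOpen J)
  (hΓ : ContMDiffOn 𝓘(ℝ, ℝ × ℝ) 𝓘(ℝ, E) ∞ (fun p : ℝ × ℝ => Γ p.1 p.2) (S ×ˢ J))

include hS hJ hΓ

lemma isOpen_variationDomain : IsOpen (variationDomain E S J x₀ Γ) :=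
  hΓ.continuousOn.isOpen_inter_preimage (hS.prod hJ) isOpen_frameNhd

lemma contDiffOn_coordVariation :
    ContDiffOn ℝ ∞ (coordVariation E x₀ Γ) (variationDomain E S J x₀ Γ) := by
  intro p hp
  exact (((contMDiffAt_chart hp.2.1).comp p
    (hΓ.contMDiffAt ((hS.prod hJ).mem_nhds hp.1))).contDiffAt).contDiffWithinAt

omit hS hJ hΓ in
lemma mapsTo_coordVariation :
    MapsTo (coordVariation E x₀ Γ) (variationDomain E S J x₀ Γ) (chartNhd E x₀) :=
  fun _ hp => chartAt_mem_chartNhd hp.2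

variable (hs : s ∈ S) (hγ : ∀ t ∈ J, Γ s t = γ t)

include hs hγ

omit hS hJ in
lemma contMDiffOn_slice : ContMDiffOn 𝓘(ℝ, ℝ) 𝓘(ℝ, E) ∞ γ J := by
  have h1 : ContMDiff 𝓘(ℝ, ℝ) 𝓘(ℝ, ℝ × ℝ) ∞ (fun t : ℝ => (s, t)) := by
    rw [contMDiff_iff_contDiff]; fun_prop
  exact (hΓ.comp h1.contMDiffOn fun t ht => ⟨hs, ht⟩).congr fun t ht => (hγ t ht).symm

omit hS hJ hΓ hs in
lemma coordCurve_slice (ht : t ∈ J) : coordCurve E x₀ γ t = coordVariation E x₀ Γ (s, t) := by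
  rw [coordCurve, coordVariation, ← hγ t ht]

lemma eventually_mem_variationDomain (hp : (s, t) ∈ variationDomain E S J x₀ Γ) :
    ∀ᶠ t' in 𝓝 t, t' ∈ J ∧ (s, t') ∈ variationDomain E S J x₀ Γ := by
  have hc : ContinuousAt (fun t' : ℝ => (s, t')) t := by fun_prop
  have := hc.preimage_mem_nhds ((isOpen_variationDomain (E := E) hS hJ hΓ).mem_nhds hp)
  filter_upwards [this] with t' h'
  exact ⟨h'.1.2, h'⟩

lemma deriv_coordCurve_slice (hp : (s, t) ∈ variationDomain E S J x₀ Γ) :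
    deriv (coordCurve E x₀ γ) t = fderiv ℝ (coordVariation E x₀ Γ) (s, t) (0, 1) := by
  have hu := ContDiffOn.differentiableAt_of_isOpen (contDiffOn_coordVariation (x₀ := x₀) hS hJ hΓ)
    (isOpen_variationDomain hS hJ hΓ) hp
  rw [← (hasDerivAt_slice_right hu).deriv]
  refine Filter.EventuallyEq.deriv_eq ?_
  filter_upwards [hJ.mem_nhds hp.1.2] with t' ht'
  exact coordCurve_slice hγ ht'

lemma coordAlong_velocity_slice (hp : (s, t) ∈ variationDomain E S J x₀ Γ) :
    coordAlong x₀ γ (velocity (I := 𝓘(ℝ, E)) γ) t =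
      fderiv ℝ (coordVariation E x₀ Γ) (s, t) (0, 1) := by
  have hx : γ t ∈ frameNhd E x₀ := by rw [← hγ t hp.1.2]; exact hp.2
  rw [coordAlong_velocity hJ (contMDiffOn_slice hΓ hs hγ) hp.1.2 hx.1,
    deriv_coordCurve_slice hS hJ hΓ hs hγ hp]

/-- Along a slice `∇_T` is the partial covariant derivative in the direction `(0, 1)`, so the
calculus of `covAlong` on the parameter plane applies. The curve only has to agree with `Γ s` on
`J`, which covers both `γ` at `s = 0` and the curves `Γ s` themselves. -/
lemma coordAlong_covDerivAlong_slice
    (cov : CovariantDerivative 𝓘(ℝ, E) E (fun x : M => TangentSpace 𝓘(ℝ, E) x))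
    {V : ∀ t, TangentSpace 𝓘(ℝ, E) (γ t)} {W : ℝ × ℝ → E} (hV : SmoothAlong J γ V)
    (hW : ContDiffOn ℝ ∞ W (variationDomain E S J x₀ Γ))
    (hVW : ∀ t, (s, t) ∈ variationDomain E S J x₀ Γ → coordAlong x₀ γ V t = W (s, t))
    (hp : (s, t) ∈ variationDomain E S J x₀ Γ) :
    coordAlong x₀ γ (covDerivAlong cov γ V) t =
      covAlong (localConn cov x₀) (coordVariation E x₀ Γ) (0, 1) W (s, t) := by
  have hx : γ t ∈ frameNhd E x₀ := by rw [← hγ t hp.1.2]; exact hp.2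
  have hWd := ContDiffOn.differentiableAt_of_isOpen hW (isOpen_variationDomain hS hJ hΓ) hp
  have e : coordAlong x₀ γ V =ᶠ[𝓝 t] fun t => W (s, t) := by
    filter_upwards [eventually_mem_variationDomain hS hJ hΓ hs hγ hp] with t' ht'
    exact hVW t' ht'.2
  rw [hV.covDerivAlong_coord hJ (contMDiffOn_slice hΓ hs hγ) hp.1.2 hx, e.deriv_eq,
    (hasDerivAt_slice_right hWd).deriv, deriv_coordCurve_slice hS hJ hΓ hs hγ hp,
    coordCurve_slice hγ hp.1.2, hVW t hp, covAlong]

lemma coordAlong_tension_slice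
    (cov : CovariantDerivative 𝓘(ℝ, E) E (fun x : M => TangentSpace 𝓘(ℝ, E) x))
    (hp : (s, t) ∈ variationDomain E S J x₀ Γ) :
    coordAlong x₀ γ (tension cov γ) t =
      covAlong (localConn cov x₀) (coordVariation E x₀ Γ) (0, 1)
        (fun p => fderiv ℝ (coordVariation E x₀ Γ) p (0, 1)) (s, t) :=
  coordAlong_covDerivAlong_slice hS hJ hΓ hs hγ cov
    (smoothAlong_velocity hJ (contMDiffOn_slice hΓ hs hγ))
    (contDiffOn_fderiv_apply (isOpen_variationDomain hS hJ hΓ)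
      (contDiffOn_coordVariation hS hJ hΓ) _)
    (fun _ h => coordAlong_velocity_slice hS hJ hΓ hs hγ h) hp

end Coord

section Field

variable (hS : IsOpen S) (hJ : IsOpen J)
  (hΓ : ContMDiffOn 𝓘(ℝ, ℝ × ℝ) 𝓘(ℝ, E) ∞ (fun p : ℝ × ℝ => Γ p.1 p.2) (S ×ˢ J))
  (hs : (0 : ℝ) ∈ S) (hγ : ∀ t ∈ J, Γ 0 t = γ t)

include hS hJ hΓ hs hγ

lemma coordAlong_variationField (ht : t ∈ J) (hx : γ t ∈ (chartAt E x₀).source) :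
    coordAlong x₀ γ (variationField E γ Γ) t =
      deriv (fun s => coordVariation E x₀ Γ (s, t)) 0 := by
  have h1 : MDifferentiableAt 𝓘(ℝ, ℝ) 𝓘(ℝ, E) (fun s => Γ s t) 0 := by
    have h2 : ContMDiff 𝓘(ℝ, ℝ) 𝓘(ℝ, ℝ × ℝ) ∞ (fun s : ℝ => (s, t)) := by
      rw [contMDiff_iff_contDiff]; fun_prop
    have h3 := hΓ.contMDiffAt (x := (0, t)) ((hS.prod hJ).mem_nhds ⟨hs, ht⟩)
    exact (h3.comp (0 : ℝ) (h2 0)).mdifferentiableAt (by simp)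
  have hx' : (fun s => Γ s t) 0 ∈ (chartAt E x₀).source := by
    change Γ 0 t ∈ _
    rw [hγ t ht]; exact hx
  have h4 := hasDerivAt_coordCurve (γ := fun s => Γ s t) (t := 0) hx' h1
  -- Justifies the identification of tangent spaces in `variationField`: components do not change
  -- when the base point is replaced by an equal one.
  have e : ∀ (x y : M) (_ : x = y) (v : E),
      toChart x₀ x (v : TangentSpace 𝓘(ℝ, E) x) = toChart x₀ y (v : TangentSpace 𝓘(ℝ, E) y) := by
    rintro x y rfl v; rfl
  exact (e _ _ (hγ t ht).symm _).trans h4.deriv.symm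

lemma coordAlong_variationField_slice (hp : (0, t) ∈ variationDomain E S J x₀ Γ) :
    coordAlong x₀ γ (variationField E γ Γ) t =
      fderiv ℝ (coordVariation E x₀ Γ) (0, t) (1, 0) := by
  have hx : γ t ∈ frameNhd E x₀ := by rw [← hγ t hp.1.2]; exact hp.2
  have hu := ContDiffOn.differentiableAt_of_isOpen (contDiffOn_coordVariation (x₀ := x₀) hS hJ hΓ)
    (isOpen_variationDomain hS hJ hΓ) hp
  rw [coordAlong_variationField hS hJ hΓ hs hγ hp.1.2 hx.1, (hasDerivAt_slice_left hu).deriv]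

lemma mem_variationDomain (ht : t ∈ J) (hx : γ t ∈ frameNhd E x₀) :
    (0, t) ∈ variationDomain E S J x₀ Γ := by
  refine ⟨⟨hs, ht⟩, ?_⟩
  change Γ 0 t ∈ frameNhd E x₀
  rw [hγ t ht]; exact hx

lemma smoothAlong_variationField : SmoothAlong J γ (variationField E γ Γ) := by
  refine smoothAlong_of_contDiffAt (contMDiffOn_slice hΓ hs hγ) fun t ht => ?_
  have hp := mem_variationDomain hS hJ hΓ hs hγ ht (x₀ := γ t) mem_frameNhd_self
  have h1 := (contDiffOn_fderiv_apply (isOpen_variationDomain hS hJ hΓ)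
    (contDiffOn_coordVariation (x₀ := γ t) hS hJ hΓ) (1, 0)).contDiffAt
    ((isOpen_variationDomain hS hJ hΓ).mem_nhds hp)
  have h2 : ContDiffAt ℝ ∞ (fun t : ℝ => ((0 : ℝ), t)) t := by fun_prop
  refine (h1.comp t h2).congr_of_eventuallyEq ?_
  filter_upwards [eventually_mem_variationDomain hS hJ hΓ hs hγ hp] with t' ht'
  exact coordAlong_variationField_slice hS hJ hΓ hs hγ ht'.2

end Field

/-! ### Smoothness and first variation of the energy densities -/

section Density

variable [Bundle.RiemannianBundle (fun x : M => TangentSpace 𝓘(ℝ, E) x)]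
  [IsContMDiffRiemannianBundle 𝓘(ℝ, E) ∞ E (fun x : M => TangentSpace 𝓘(ℝ, E) x)]
  {cov : CovariantDerivative 𝓘(ℝ, E) E (fun x : M => TangentSpace 𝓘(ℝ, E) x)}

section

variable (hS : IsOpen S) (hJ : IsOpen J)
  (hΓ : ContMDiffOn 𝓘(ℝ, ℝ × ℝ) 𝓘(ℝ, E) ∞ (fun p : ℝ × ℝ => Γ p.1 p.2) (S ×ˢ J))

include hS hJ hΓ

lemma norm_sq_velocity_slice :
    EqOn (fun p : ℝ × ℝ => ‖velocity (I := 𝓘(ℝ, E)) (Γ p.1) p.2‖ ^ 2)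
      (fun p => localMetric x₀ (coordVariation E x₀ Γ p)
      (fderiv ℝ (coordVariation E x₀ Γ) p (0, 1)) (fderiv ℝ (coordVariation E x₀ Γ) p (0, 1)))
      (variationDomain E S J x₀ Γ) := by
  intro p hp
  beta_reduce
  rw [← real_inner_self_eq_norm_sq, inner_eq_coordAlong hp.2,
    coordAlong_velocity_slice hS hJ hΓ hp.1.1 (fun _ _ => rfl) hp]
  rfl

lemma norm_sq_tension_slice :
    EqOn (fun p : ℝ × ℝ => ‖tension cov (Γ p.1) p.2‖ ^ 2)
      (fun p => localMetric x₀ (coordVariation E x₀ Γ p)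
      (covAlong (localConn cov x₀) (coordVariation E x₀ Γ) (0, 1)
        (fun p => fderiv ℝ (coordVariation E x₀ Γ) p (0, 1)) p)
      (covAlong (localConn cov x₀) (coordVariation E x₀ Γ) (0, 1)
        (fun p => fderiv ℝ (coordVariation E x₀ Γ) p (0, 1)) p))
      (variationDomain E S J x₀ Γ) := by
  intro p hp
  beta_reduce
  rw [← real_inner_self_eq_norm_sq, inner_eq_coordAlong hp.2,
    coordAlong_tension_slice hS hJ hΓ hp.1.1 (fun _ _ => rfl) cov hp]
  rfl

lemma mem_variationDomain_self {p : ℝ × ℝ} (hp : p ∈ S ×ˢ J) :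
    p ∈ variationDomain E S J (Γ p.1 p.2) Γ := ⟨hp, mem_frameNhd_self⟩

lemma contDiffOn_norm_sq_velocity :
    ContDiffOn ℝ ∞ (fun p : ℝ × ℝ => ‖velocity (I := 𝓘(ℝ, E)) (Γ p.1) p.2‖ ^ 2) (S ×ˢ J) := by
  intro p hp
  have hp' := mem_variationDomain_self hS hJ hΓ hp
  have hO := isOpen_variationDomain (x₀ := Γ p.1 p.2) hS hJ hΓ
  have hu := contDiffOn_coordVariation (x₀ := Γ p.1 p.2) hS hJ hΓ
  have hT := contDiffOn_fderiv_apply hO hu (0, 1)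
  refine ((contDiffOn_metric_along (contDiffOn_localMetric _) hu mapsTo_coordVariation hT
    hT).contDiffAt (hO.mem_nhds hp')).congr_of_eventuallyEq ?_ |>.contDiffWithinAt
  filter_upwards [hO.mem_nhds hp'] with q hq
  exact norm_sq_velocity_slice hS hJ hΓ hq

lemma contDiffOn_norm_sq_tension (hcov : IsLeviCivita cov) :
    ContDiffOn ℝ ∞ (fun p : ℝ × ℝ => ‖tension cov (Γ p.1) p.2‖ ^ 2) (S ×ˢ J) := by
  intro p hp
  have hp' := mem_variationDomain_self hS hJ hΓ hp
  have hO := isOpen_variationDomain (x₀ := Γ p.1 p.2) hS hJ hΓ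
  have hu := contDiffOn_coordVariation (x₀ := Γ p.1 p.2) hS hJ hΓ
  have hT := contDiffOn_covAlong hO (contDiffOn_localConn hcov.smooth (Γ p.1 p.2)) hu
    mapsTo_coordVariation (contDiffOn_fderiv_apply hO hu (0, 1)) (0, 1)
  refine ((contDiffOn_metric_along (contDiffOn_localMetric _) hu mapsTo_coordVariation hT
    hT).contDiffAt (hO.mem_nhds hp')).congr_of_eventuallyEq ?_ |>.contDiffWithinAt
  filter_upwards [hO.mem_nhds hp'] with q hq
  exact norm_sq_tension_slice hS hJ hΓ hq

end

variable (hS : IsOpen S) (hJ : IsOpen J)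
  (hΓ : ContMDiffOn 𝓘(ℝ, ℝ × ℝ) 𝓘(ℝ, E) ∞ (fun p : ℝ × ℝ => Γ p.1 p.2) (S ×ˢ J))
  (hs : (0 : ℝ) ∈ S) (hγ : ∀ t ∈ J, Γ 0 t = γ t)

include hS hJ hΓ hs hγ

/-- First variation of the energy density. -/
lemma fderiv_norm_sq_velocity (hcov : IsLeviCivita cov) (ht : t ∈ J) :
    fderiv ℝ (fun p : ℝ × ℝ => ‖velocity (I := 𝓘(ℝ, E)) (Γ p.1) p.2‖ ^ 2) (0, t) (1, 0) =
      2 * inner ℝ (covDerivAlong cov γ (variationField E γ Γ) t)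
        (velocity (I := 𝓘(ℝ, E)) γ t) := by
  have hp := mem_variationDomain hS hJ hΓ hs hγ ht (x₀ := γ t) mem_frameNhd_self
  have hO := isOpen_variationDomain (x₀ := γ t) hS hJ hΓ
  have hu := contDiffOn_coordVariation (x₀ := γ t) hS hJ hΓ
  have e := (norm_sq_velocity_slice (x₀ := γ t) hS hJ hΓ).eventuallyEq_of_mem (hO.mem_nhds hp)
  rw [e.fderiv_eq, fderiv_energy (hcov.isLocalLeviCivita (γ t)) hO hu mapsTo_coordVariation hp,
    inner_eq_coordAlong (V := covDerivAlong cov γ (variationField E γ Γ)) mem_frameNhd_self,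
    coordAlong_velocity_slice hS hJ hΓ hs hγ hp, coordCurve_slice hγ ht,
    coordAlong_covDerivAlong_slice hS hJ hΓ hs hγ cov
      (smoothAlong_variationField hS hJ hΓ hs hγ) (contDiffOn_fderiv_apply hO hu (1, 0))
      (fun t ht => coordAlong_variationField_slice hS hJ hΓ hs hγ ht) hp]

/-- First variation of the bienergy density, for a Legendre curve in a Sasakian space form with
`∇_T T` parallel to `φ T`. -/
lemma fderiv_norm_sq_tension (hcov : IsLeviCivita cov)
    {φ : ∀ x : M, TangentSpace 𝓘(ℝ, E) x →L[ℝ] TangentSpace 𝓘(ℝ, E) x}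
    {ξ : ∀ x : M, TangentSpace 𝓘(ℝ, E) x} {η : ∀ x : M, TangentSpace 𝓘(ℝ, E) x →L[ℝ] ℝ} {c : ℝ}
    (hSas : IsSasakian φ ξ η) (hc : HasConstantPhiSectionalCurvature cov φ η c) (ht : t ∈ J)
    (h1 : ‖velocity (I := 𝓘(ℝ, E)) γ t‖ = 1) (h0 : η (γ t) (velocity (I := 𝓘(ℝ, E)) γ t) = 0)
    (hτ : ∃ b : ℝ, tension cov γ t = b • φ (γ t) (velocity (I := 𝓘(ℝ, E)) γ t)) :
    fderiv ℝ (fun p : ℝ × ℝ => ‖tension cov (Γ p.1) p.2‖ ^ 2) (0, t) (1, 0) =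
      2 * (inner ℝ (covDerivAlong cov γ (covDerivAlong cov γ (variationField E γ Γ)) t)
        (tension cov γ t) + c * inner ℝ (variationField E γ Γ t) (tension cov γ t)) := by
  have hx : γ t ∈ frameNhd E (γ t) := mem_frameNhd_self
  have hp := mem_variationDomain hS hJ hΓ hs hγ ht (x₀ := γ t) hx
  have hO := isOpen_variationDomain (x₀ := γ t) hS hJ hΓ
  have hu := contDiffOn_coordVariation (x₀ := γ t) hS hJ hΓ
  have hl := hSas.isLocalSasakiSpaceForm hcov hc (γ t)
  have hy := mapsTo_coordVariation hp
  have e := (norm_sq_tension_slice (x₀ := γ t) (cov := cov) hS hJ hΓ).eventuallyEq_of_mem (hO.mem_nhds hp)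
  have hV := smoothAlong_variationField hS hJ hΓ hs hγ
  have hS1 := contDiffOn_fderiv_apply hO hu (1, 0)
  have hγ' := contMDiffOn_slice hΓ hs hγ
  have eT := coordAlong_velocity_slice hS hJ hΓ hs hγ hp
  have eτ := coordAlong_tension_slice hS hJ hΓ hs hγ cov hp
  have eu := coordCurve_slice (E := E) (x₀ := γ t) hγ ht
  rw [e.fderiv_eq, fderiv_bienergy hl.toIsLocalLeviCivita hO hu mapsTo_coordVariation hp,
    inner_eq_coordAlong (V := covDerivAlong cov γ (covDerivAlong cov γ (variationField E γ Γ)))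
      (W := tension cov γ) hx,
    inner_eq_coordAlong (V := variationField E γ Γ) (W := tension cov γ) hx, eτ, eu,
    coordAlong_variationField_slice hS hJ hΓ hs hγ hp,
    coordAlong_covDerivAlong_slice hS hJ hΓ hs hγ cov (hV.covDerivAlong hJ hγ' hcov.smooth)
      (contDiffOn_covAlong hO hl.smooth_conn hu mapsTo_coordVariation hS1 (0, 1))
      (fun t ht => coordAlong_covDerivAlong_slice hS hJ hΓ hs hγ cov hV hS1
        (fun t ht => coordAlong_variationField_slice hS hJ hΓ hs hγ ht) ht) hp]
  -- As the tension is `bφT`, the curvature term `g(R(V,T)T, τ)` becomes `c g(V, τ)`.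
  obtain ⟨b, hb⟩ := hτ
  have hb' : coordAlong (γ t) γ (tension cov γ) t = b • localEnd φ (γ t)
      (coordVariation E (γ t) Γ (0, t))
      (fderiv ℝ (coordVariation E (γ t) Γ) (0, t) (0, 1)) := by
    rw [coordAlong, hb, map_smul, toChart_end hx.1, ← eT, ← eu]
    rfl
  have h0' : localForm η (γ t) (coordVariation E (γ t) Γ (0, t))
      (fderiv ℝ (coordVariation E (γ t) Γ) (0, t) (0, 1)) = 0 := by
    have h2 := form_eq_localForm (η := η) hx.1 (velocity (I := 𝓘(ℝ, E)) γ t)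
    rw [h0] at h2
    rw [← eT, ← eu]
    exact h2.symm
  have h1' : localMetric (γ t) (coordVariation E (γ t) Γ (0, t))
      (fderiv ℝ (coordVariation E (γ t) Γ) (0, t) (0, 1))
      (fderiv ℝ (coordVariation E (γ t) Γ) (0, t) (0, 1)) = 1 := by
    rw [← eT, ← eu, ← inner_eq_coordAlong hx, real_inner_self_eq_norm_sq, h1, one_pow]
  rw [← eτ, hb']
  simp only [map_smul, smul_eq_mul]
  rw [hl.inner_curvature_phi hy h0' h1']
  ring

end Density

end Variations

end SesquiHarmonic

namespace SesquiHarmonic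

/-! ### The first variation formula -/

section FirstVariation

set_option linter.unusedSectionVars false

open MeasureTheory in
/-- Differentiation under the integral sign over a compact interval. -/
lemma hasDerivAt_integral_slice {f : ℝ × ℝ → ℝ} {S J : Set ℝ} {a b : ℝ} (hS : IsOpen S)
    (hJ : IsOpen J) (hf : ContDiffOn ℝ ∞ f (S ×ˢ J)) (hs : (0 : ℝ) ∈ S) (hab : a ≤ b)
    (hJab : Icc a b ⊆ J) :
    HasDerivAt (fun s => ∫ t in a..b, f (s, t)) (∫ t in a..b, fderiv ℝ f (0, t) (1, 0)) 0 := by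
  have hO := hS.prod hJ
  have hf' := (contDiffOn_fderiv_apply hO hf (1, 0)).continuousOn
  obtain ⟨ε, hε, hεS⟩ := Metric.nhds_basis_closedBall.mem_iff.mp (hS.mem_nhds hs)
  have hK : Metric.closedBall (0 : ℝ) ε ×ˢ Icc a b ⊆ S ×ˢ J := prod_mono hεS hJab
  -- Compactness of the parameter rectangle gives a constant dominating function.
  obtain ⟨B, hB⟩ := ((isCompact_closedBall (0 : ℝ) ε).prod isCompact_Icc).exists_bound_of_continuousOn
    (hf'.mono hK)
  have hIoc : uIoc a b ⊆ Icc a b := by rw [uIoc_of_le hab]; exact Ioc_subset_Icc_self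
  have hslice : ∀ (g : ℝ × ℝ → ℝ), ContinuousOn g (S ×ˢ J) → ∀ s ∈ S,
      ContinuousOn (fun t => g (s, t)) (Icc a b) := fun g hg s hs =>
    hg.comp (by fun_prop) fun t ht => ⟨hs, hJab ht⟩
  refine (intervalIntegral.hasDerivAt_integral_of_dominated_loc_of_deriv_le
    (F := fun s t => f (s, t)) (F' := fun s t => fderiv ℝ f (s, t) (1, 0)) (bound := fun _ => B)
    (Metric.closedBall_mem_nhds 0 hε) ?_ ?_ ?_ ?_ intervalIntegrable_const ?_).2
  · filter_upwards [hS.mem_nhds hs] with s hs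
    exact ((hslice f hf.continuousOn s hs).mono hIoc).aestronglyMeasurable measurableSet_uIoc
  · exact (hslice f hf.continuousOn 0 hs).intervalIntegrable_of_Icc hab
  · exact ((hslice _ hf' 0 hs).mono hIoc).aestronglyMeasurable measurableSet_uIoc
  · exact Filter.Eventually.of_forall fun t ht s hs => hB (s, t) ⟨hs, hIoc ht⟩
  · exact Filter.Eventually.of_forall fun t ht s hs => hasDerivAt_slice_left
      (ContDiffOn.differentiableAt_of_isOpen hf hO (hK ⟨hs, hIoc ht⟩))

variable {E : Type*} [NormedAddCommGroup E] [NormedSpace ℝ E] [FiniteDimensional ℝ E]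
  {M : Type*} [TopologicalSpace M] [T2Space M] [ChartedSpace E M] [IsManifold 𝓘(ℝ, E) ∞ M]
  {γ : ℝ → M} {Γ : ℝ → ℝ → M} {S J : Set ℝ} {t : ℝ}

/-- The covariant derivative vanishes at a boundary point of an interval on which the field
vanishes. -/
lemma covDerivAlong_eq_zero
    {cov : CovariantDerivative 𝓘(ℝ, E) E (fun x : M => TangentSpace 𝓘(ℝ, E) x)}
    {V : ∀ t, TangentSpace 𝓘(ℝ, E) (γ t)} (hV : SmoothAlong J γ V) (hJ : IsOpen J)
    (hγ : ContMDiffOn 𝓘(ℝ, ℝ) 𝓘(ℝ, E) ∞ γ J) (ht : t ∈ J) {K : Set ℝ} (htK : t ∈ K)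
    (hK : UniqueDiffWithinAt ℝ K t) (h0 : ∀ t ∈ J ∩ K, V t = 0) :
    covDerivAlong cov γ V t = 0 := by
  have hx : γ t ∈ frameNhd E (γ t) := mem_frameNhd_self
  refine toChart_injective hx.1 ?_
  have h1 := hV.covDerivAlong_coord (cov := cov) hJ hγ ht hx
  have e : ∀ s ∈ J ∩ K, coordAlong (γ t) γ V s = 0 := fun s hs => by
    rw [coordAlong, h0 s hs, map_zero]
  -- The derivative exists, hence agrees with the derivative within `K`, where the components
  -- vanish.
  have h2 : deriv (coordAlong (γ t) γ V) t = 0 := by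
    have h3 := (hV.differentiableAt hJ ht hx.1).hasDerivAt.hasDerivWithinAt (s := K)
    have h4 : HasDerivWithinAt (coordAlong (γ t) γ V) 0 K t := by
      refine (hasDerivWithinAt_const t K (0 : E)).congr_of_eventuallyEq ?_ (e t ⟨ht, htK⟩)
      filter_upwards [mem_nhdsWithin_of_mem_nhds (hJ.mem_nhds ht), self_mem_nhdsWithin] with s h h'
      exact e s ⟨h, h'⟩
    exact hK.eq_deriv _ h3 h4
  rw [coordAlong] at h1
  rw [h1, h2, e t ⟨ht, htK⟩, map_zero, map_zero, add_zero]

lemma variationField_eq_zero (hS : IsOpen S) (hJ : IsOpen J)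
    (hΓ : ContMDiffOn 𝓘(ℝ, ℝ × ℝ) 𝓘(ℝ, E) ∞ (fun p : ℝ × ℝ => Γ p.1 p.2) (S ×ˢ J))
    (hs : (0 : ℝ) ∈ S) (hγ : ∀ t ∈ J, Γ 0 t = γ t) (ht : t ∈ J) (h : ∀ s ∈ S, Γ s t = γ t) :
    variationField E γ Γ t = 0 := by
  have hx : γ t ∈ frameNhd E (γ t) := mem_frameNhd_self
  refine toChart_injective hx.1 ?_
  have h1 := coordAlong_variationField hS hJ hΓ hs hγ ht hx.1
  rw [coordAlong] at h1
  have e : (fun s => coordVariation E (γ t) Γ (s, t)) =ᶠ[𝓝 0] fun _ => chartAt E (γ t) (γ t) := by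
    filter_upwards [hS.mem_nhds hs] with s hs
    rw [coordVariation, h s hs]
  rw [h1, e.deriv_eq, deriv_const, map_zero]

variable [Bundle.RiemannianBundle (fun x : M => TangentSpace 𝓘(ℝ, E) x)]
  [IsContMDiffRiemannianBundle 𝓘(ℝ, E) ∞ E (fun x : M => TangentSpace 𝓘(ℝ, E) x)]
  {cov : CovariantDerivative 𝓘(ℝ, E) E (fun x : M => TangentSpace 𝓘(ℝ, E) x)}
  {φ : ∀ x : M, TangentSpace 𝓘(ℝ, E) x →L[ℝ] TangentSpace 𝓘(ℝ, E) x}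
  {ξ : ∀ x : M, TangentSpace 𝓘(ℝ, E) x} {η : ∀ x : M, TangentSpace 𝓘(ℝ, E) x →L[ℝ] ℝ} {c : ℝ}

/-- The Euler-Lagrange field of `E_{δ₁,δ₂}`, for a Legendre curve in a Sasakian space form with
`∇_T T` parallel to `φ T`. -/
noncomputable def eulerLagrange
    (cov : CovariantDerivative 𝓘(ℝ, E) E (fun x : M => TangentSpace 𝓘(ℝ, E) x))
    (δ₁ δ₂ c : ℝ) (γ : ℝ → M) (t : ℝ) : TangentSpace 𝓘(ℝ, E) (γ t) :=
  δ₂ • (covDerivAlong cov γ (covDerivAlong cov γ (tension cov γ)) t + c • tension cov γ t)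
    - δ₁ • tension cov γ t

lemma SmoothAlong.const_smul {V : ∀ t, TangentSpace 𝓘(ℝ, E) (γ t)} (a : ℝ)
    (hV : SmoothAlong J γ V) (hJ : IsOpen J) (hγ : ContMDiffOn 𝓘(ℝ, ℝ) 𝓘(ℝ, E) ∞ γ J) :
    SmoothAlong J γ (fun t => a • V t) :=
  SmoothAlong.smul contDiffOn_const hV hJ hγ

lemma smoothAlong_tension (hcov : IsLeviCivita cov) (hJ : IsOpen J)
    (hγ : ContMDiffOn 𝓘(ℝ, ℝ) 𝓘(ℝ, E) ∞ γ J) : SmoothAlong J γ (tension cov γ) :=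
  (smoothAlong_velocity hJ hγ).covDerivAlong hJ hγ hcov.smooth

lemma smoothAlong_eulerLagrange (hcov : IsLeviCivita cov) (δ₁ δ₂ c : ℝ) (hJ : IsOpen J)
    (hγ : ContMDiffOn 𝓘(ℝ, ℝ) 𝓘(ℝ, E) ∞ γ J) :
    SmoothAlong J γ (eulerLagrange cov δ₁ δ₂ c γ) := by
  have hτ := smoothAlong_tension hcov hJ hγ
  have h2 := (hτ.covDerivAlong hJ hγ hcov.smooth).covDerivAlong hJ hγ hcov.smooth
  refine (((h2.add (hτ.const_smul c hJ hγ) hJ hγ).const_smul δ₂ hJ hγ).add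
    (hτ.const_smul (-δ₁) hJ hγ) hJ hγ).congr fun t _ => ?_
  rw [eulerLagrange, sub_eq_add_neg, neg_smul]

/-- The first variation formula. -/
theorem hasDerivAt_sesquiEnergy (hcov : IsLeviCivita cov) (hSas : IsSasakian φ ξ η)
    (hc : HasConstantPhiSectionalCurvature cov φ η c) (hS : IsOpen S) (hJ : IsOpen J)
    (hΓ : ContMDiffOn 𝓘(ℝ, ℝ × ℝ) 𝓘(ℝ, E) ∞ (fun p : ℝ × ℝ => Γ p.1 p.2) (S ×ˢ J))
    (hs : (0 : ℝ) ∈ S) (hγ : ∀ t ∈ J, Γ 0 t = γ t)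
    (h1 : ∀ t ∈ J, ‖velocity (I := 𝓘(ℝ, E)) γ t‖ = 1)
    (h0 : ∀ t ∈ J, η (γ t) (velocity (I := 𝓘(ℝ, E)) γ t) = 0)
    (hτ : ∀ t ∈ J, ∃ b : ℝ, tension cov γ t = b • φ (γ t) (velocity (I := 𝓘(ℝ, E)) γ t))
    (δ₁ δ₂ : ℝ) {a b : ℝ} (hab : a < b) (hJab : Icc a b ⊆ J)
    (hsupp : ∀ s ∈ S, ∀ t ∈ J \ Ioo a b, Γ s t = γ t) :
    HasDerivAt (fun s => sesquiEnergy cov δ₁ δ₂ a b (Γ s))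
      (∫ t in a..b, 2 * inner ℝ (variationField E γ Γ t) (eulerLagrange cov δ₁ δ₂ c γ t)) 0 := by
  set V := variationField E γ Γ with hVdef
  set T := velocity (I := 𝓘(ℝ, E)) γ with hTdef
  have hγ' := contMDiffOn_slice hΓ hs hγ
  have hT : SmoothAlong J γ T := smoothAlong_velocity hJ hγ'
  have hV : SmoothAlong J γ V := smoothAlong_variationField hS hJ hΓ hs hγ
  have hV1 := hV.covDerivAlong hJ hγ' hcov.smooth
  have hV2 := hV1.covDerivAlong hJ hγ' hcov.smooth
  have hτs := smoothAlong_tension hcov hJ hγ'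
  have hτ1 := hτs.covDerivAlong hJ hγ' hcov.smooth
  have hτ2 := hτ1.covDerivAlong hJ hγ' hcov.smooth
  have hW := smoothAlong_eulerLagrange hcov δ₁ δ₂ c hJ hγ'
  have haJ : a ∈ J := hJab (left_mem_Icc.mpr hab.le)
  have hbJ : b ∈ J := hJab (right_mem_Icc.mpr hab.le)
  have hVa : ∀ t ∈ J ∩ Iic a, V t = 0 := fun t ht =>
    variationField_eq_zero hS hJ hΓ hs hγ ht.1 fun s hs =>
      hsupp s hs t ⟨ht.1, fun h => absurd h.1 (not_lt.mpr ht.2)⟩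
  have hVb : ∀ t ∈ J ∩ Ici b, V t = 0 := fun t ht =>
    variationField_eq_zero hS hJ hΓ hs hγ ht.1 fun s hs =>
      hsupp s hs t ⟨ht.1, fun h => absurd h.2 (not_lt.mpr ht.2)⟩
  -- The bienergy is integrated by parts twice, so `∇_T V` must vanish at the ends as well. It does
  -- because `V` vanishes on the part of `J` beyond `(a, b)`.
  have hV1a : covDerivAlong cov γ V a = 0 :=
    covDerivAlong_eq_zero hV hJ hγ' haJ (mem_Iic.mpr le_rfl) (uniqueDiffWithinAt_Iic a) hVa
  have hV1b : covDerivAlong cov γ V b = 0 :=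
    covDerivAlong_eq_zero hV hJ hγ' hbJ (mem_Ici.mpr le_rfl) (uniqueDiffWithinAt_Ici b) hVb
  -- differentiation under the integral sign
  have d1 := hasDerivAt_integral_slice hS hJ (contDiffOn_norm_sq_velocity hS hJ hΓ) hs hab.le hJab
  have d2 := hasDerivAt_integral_slice hS hJ
    (contDiffOn_norm_sq_tension (cov := cov) hS hJ hΓ hcov) hs hab.le hJab
  refine ((d1.const_mul δ₁).add (d2.const_mul δ₂)).congr_deriv ?_
  have hu : uIcc a b = Icc a b := uIcc_of_le hab.le
  have i1 : ∫ t in a..b, fderiv ℝ (fun p : ℝ × ℝ => ‖velocity (I := 𝓘(ℝ, E)) (Γ p.1) p.2‖ ^ 2)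
      (0, t) (1, 0) = ∫ t in a..b, 2 * inner ℝ (covDerivAlong cov γ V t) (T t) :=
    intervalIntegral.integral_congr fun t ht =>
      fderiv_norm_sq_velocity hS hJ hΓ hs hγ hcov (hJab (hu ▸ ht))
  have i2 : ∫ t in a..b, fderiv ℝ (fun p : ℝ × ℝ => ‖tension cov (Γ p.1) p.2‖ ^ 2)
      (0, t) (1, 0) = ∫ t in a..b, 2 * (inner ℝ (covDerivAlong cov γ (covDerivAlong cov γ V) t)
        (tension cov γ t) + c * inner ℝ (V t) (tension cov γ t)) :=
    intervalIntegral.integral_congr fun t ht => by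
      have htJ := hJab (hu ▸ ht)
      exact fderiv_norm_sq_tension hS hJ hΓ hs hγ hcov hSas hc htJ (h1 t htJ) (h0 t htJ) (hτ t htJ)
  rw [i1, i2]
  -- integration by parts
  have hint : ∀ {X Y : ∀ t, TangentSpace 𝓘(ℝ, E) (γ t)}, SmoothAlong J γ X → SmoothAlong J γ Y →
      IntervalIntegrable (fun t => (inner ℝ (X t) (Y t) : ℝ)) MeasureTheory.volume a b :=
    fun hX hY => ((contDiffOn_inner_along hX hY hJ hγ').continuousOn.mono
      hJab).intervalIntegrable_of_Icc hab.le
  have parts : ∀ {X Y : ∀ t, TangentSpace 𝓘(ℝ, E) (γ t)}, SmoothAlong J γ X → SmoothAlong J γ Y →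
      ((X a = 0 ∧ X b = 0) ∨ (Y a = 0 ∧ Y b = 0)) →
      ∫ t in a..b, ((inner ℝ (covDerivAlong cov γ X t) (Y t) : ℝ) +
        inner ℝ (X t) (covDerivAlong cov γ Y t)) = 0 := by
    intro X Y hX hY h
    have hX' := hX.covDerivAlong hJ hγ' hcov.smooth
    have hY' := hY.covDerivAlong hJ hγ' hcov.smooth
    rw [intervalIntegral.integral_eq_sub_of_hasDerivAt (f := fun t => (inner ℝ (X t) (Y t) : ℝ))
      (fun t ht => hasDerivAt_inner_along hcov hX hY hJ hγ' (hJab (hu ▸ ht)))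
      ((hint hX' hY).add (hint hX hY'))]
    rcases h with h | h <;> simp [h.1, h.2]
  have p1 := parts hV hT (Or.inl ⟨hVa a ⟨haJ, mem_Iic.mpr le_rfl⟩, hVb b ⟨hbJ, mem_Ici.mpr le_rfl⟩⟩)
  have p2 := parts hV1 hτs (Or.inl ⟨hV1a, hV1b⟩)
  have p3 := parts hV hτ1
    (Or.inl ⟨hVa a ⟨haJ, mem_Iic.mpr le_rfl⟩, hVb b ⟨hbJ, mem_Ici.mpr le_rfl⟩⟩)
  have hτT : covDerivAlong cov γ T = tension cov γ := rfl
  rw [hτT] at p1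
  rw [intervalIntegral.integral_add (hint hV1 hT) (hint hV hτs)] at p1
  rw [intervalIntegral.integral_add (hint hV2 hτs) (hint hV1 hτ1)] at p2
  rw [intervalIntegral.integral_add (hint hV1 hτ1) (hint hV hτ2)] at p3
  have i3 : ∀ t, 2 * (inner ℝ (V t) (eulerLagrange cov δ₁ δ₂ c γ t) : ℝ) =
      2 * δ₂ * inner ℝ (V t) (covDerivAlong cov γ (covDerivAlong cov γ (tension cov γ)) t) +
      (2 * δ₂ * c - 2 * δ₁) * inner ℝ (V t) (tension cov γ t) := by
    intro t
    simp only [eulerLagrange, inner_sub_right, inner_smul_right, inner_add_right]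
    ring
  simp only [i3]
  rw [intervalIntegral.integral_add ((hint hV hτ2).const_mul _) ((hint hV hτs).const_mul _),
    intervalIntegral.integral_const_mul, intervalIntegral.integral_const_mul,
    intervalIntegral.integral_const_mul, intervalIntegral.integral_const_mul,
    intervalIntegral.integral_add (hint hV2 hτs) ((hint hV hτs).const_mul _),
    intervalIntegral.integral_const_mul]
  -- One integration by parts in the energy produces the sign of `-δ₁τ`; the two in the bienergy
  -- restore the sign of `δ₂∇_T²τ`.
  linear_combination 2 * δ₁ * p1 + 2 * δ₂ * p2 - 2 * δ₂ * p3

end FirstVariation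

end SesquiHarmonic

namespace SesquiHarmonic

/-! ### Critical points -/

section CriticalPoints

set_option linter.unusedSectionVars false

variable {E : Type*} [NormedAddCommGroup E] [NormedSpace ℝ E] [FiniteDimensional ℝ E]
  {M : Type*} [TopologicalSpace M] [T2Space M] [ChartedSpace E M] [IsManifold 𝓘(ℝ, E) ∞ M]
  {γ : ℝ → M} {J : Set ℝ} {t₀ : ℝ}

/-- Every smooth field along a curve is, near a given point and up to a bump function, the variation
field of a variation with compact support. -/
lemma exists_variation (hJ : IsOpen J) (hγ : ContMDiffOn 𝓘(ℝ, ℝ) 𝓘(ℝ, E) ∞ γ J)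
    {W : ∀ t, TangentSpace 𝓘(ℝ, E) (γ t)} (hW : SmoothAlong J γ W) (ht₀ : t₀ ∈ J) :
    ∃ a b : ℝ, a < b ∧ t₀ ∈ Icc a b ∧ Icc a b ⊆ J ∧ ∃ ε : ℝ, 0 < ε ∧ ∃ Γ : ℝ → ℝ → M,
      ContMDiffOn 𝓘(ℝ, ℝ × ℝ) 𝓘(ℝ, E) ∞ (fun p : ℝ × ℝ => Γ p.1 p.2) (Ioo (-ε) ε ×ˢ J) ∧
      (∀ t ∈ J, Γ 0 t = γ t) ∧ (∀ s ∈ Ioo (-ε) ε, ∀ t ∈ J \ Ioo a b, Γ s t = γ t) ∧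
      ∃ χ : ℝ → ℝ, Continuous χ ∧ (∀ t, 0 ≤ χ t) ∧ χ t₀ = 1 ∧
        ∀ t ∈ Icc a b, variationField E γ Γ t = χ t • W t := by
  set x₀ := γ t₀ with hx₀
  set ψ := chartAt E x₀ with hψ
  set A := J ∩ γ ⁻¹' ψ.source with hA
  have hAo : IsOpen A := hγ.continuousOn.isOpen_inter_preimage hJ ψ.open_source
  have ht₀A : t₀ ∈ A := ⟨ht₀, mem_chart_source E x₀⟩
  obtain ⟨r, hr, hrA⟩ := Metric.nhds_basis_closedBall.mem_iff.mp (hAo.mem_nhds ht₀A)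
  -- The bump is supported within distance `r / 2` while `[a, b]` has radius `r`; in the gap the
  -- deformed and the original curve coincide, so they glue smoothly.
  let χ : ContDiffBump t₀ := ⟨r / 4, r / 2, by positivity, by linarith⟩
  set a := t₀ - r with ha
  set b := t₀ + r with hb
  have hab : a < b := by rw [ha, hb]; linarith
  have hIA : Icc a b ⊆ A := by rw [ha, hb, ← Real.closedBall_eq_Icc]; exact hrA
  have hχ0 : ∀ t, t ∉ Metric.closedBall t₀ (r / 2) → χ t = 0 := fun t ht =>
    χ.zero_of_le_dist (not_le.mp fun h => ht (Metric.mem_closedBall.mpr h)).le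
  have hsub : Metric.closedBall t₀ (r / 2) ⊆ Ioo a b := by
    rw [Real.closedBall_eq_Icc]
    exact fun t ht => ⟨by rw [ha]; linarith [ht.1], by rw [hb]; linarith [ht.2]⟩
  set u := coordCurve E x₀ γ with hu
  set w := coordAlong x₀ γ W with hw
  have hus : ∀ t ∈ A, ContDiffAt ℝ ∞ u t := fun t ht => contDiffAt_coordCurve hJ hγ ht.1 ht.2
  have hws : ∀ t ∈ A, ContDiffAt ℝ ∞ w t := fun t ht => hW.contDiffAt hJ ht.1 ht.2
  set g : ℝ × ℝ → E := fun p => u p.2 + (p.1 * χ p.2) • w p.2 with hg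
  have hgs : ∀ p : ℝ × ℝ, p.2 ∈ A → ContDiffAt ℝ ∞ g p := by
    intro p hp
    have h2 : ContDiffAt ℝ ∞ (fun p : ℝ × ℝ => p.2) p := contDiffAt_snd
    have hχs : ContDiffAt ℝ ∞ (fun p : ℝ × ℝ => p.1 * χ p.2) p :=
      contDiffAt_fst.mul (χ.contDiff.contDiffAt.comp p h2)
    exact ((hus _ hp).comp p h2).add (hχs.smul ((hws _ hp).comp p h2))
  have hN : IsOpen ((univ ×ˢ A) ∩ g ⁻¹' ψ.target) :=
    ContinuousOn.isOpen_inter_preimage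
      (fun p hp => (hgs p hp.2).continuousAt.continuousWithinAt) (isOpen_univ.prod hAo)
      ψ.open_target
  have hut : ∀ t ∈ A, u t ∈ ψ.target := fun t ht => ψ.map_source ht.2
  -- At `s = 0` the coordinate curve lies in the open chart target over the compact `[a, b]`; the
  -- tube lemma gives one range of `s` good for all `t`.
  obtain ⟨S, B, hS, hB, h0S, hIB, hSB⟩ := generalized_tube_lemma (s := {(0 : ℝ)}) (t := Icc a b)
    isCompact_singleton isCompact_Icc hN (by
      rintro ⟨s, t⟩ ⟨hs, ht⟩
      rw [mem_singleton_iff] at hs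
      refine ⟨⟨mem_univ _, hIA ht⟩, ?_⟩
      simpa [hg, show s = 0 from hs] using hut t (hIA ht))
  obtain ⟨ε, hε, hεS⟩ := Metric.mem_nhds_iff.mp (hS.mem_nhds (h0S rfl))
  rw [Real.ball_eq_Ioo, zero_sub, zero_add] at hεS
  have hgt : ∀ s ∈ Ioo (-ε) ε, ∀ t ∈ Icc a b, g (s, t) ∈ ψ.target := fun s hs t ht =>
    (hSB (⟨hεS hs, hIB ht⟩ : (s, t) ∈ S ×ˢ B)).2
  classical
  -- A straight-line variation in the chart with velocity `χW`, extended by `γ`.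
  set Γ : ℝ → ℝ → M := fun s t => if t ∈ Ioo a b then ψ.symm (g (s, t)) else γ t with hΓ
  have hΓγ : ∀ s t, t ∈ J → χ t = 0 → Γ s t = γ t := by
    intro s t _ h
    by_cases hI : t ∈ Ioo a b
    · have : g (s, t) = ψ (γ t) := by simp [hg, h, hu, coordCurve, hψ]
      simp only [hΓ, hI, if_true, this]
      exact ψ.left_inv (hIA (Ioo_subset_Icc_self hI)).2
    · simp only [hΓ, hI, if_false]
  have h0ε : (0 : ℝ) ∈ Ioo (-ε) ε := ⟨by linarith, hε⟩
  have hsm : ContMDiffOn 𝓘(ℝ, ℝ × ℝ) 𝓘(ℝ, E) ∞ (fun p : ℝ × ℝ => Γ p.1 p.2)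
      (Ioo (-ε) ε ×ˢ J) := by
    rintro ⟨s, t⟩ ⟨hs, ht⟩
    refine ContMDiffAt.contMDiffWithinAt ?_
    by_cases hI : t ∈ Ioo a b
    · have h1 := contMDiffAt_chart_symm (x₀ := x₀) (hgt s hs t (Ioo_subset_Icc_self hI))
      have h2 := (h1.comp (s, t) (hgs (s, t) (hIA (Ioo_subset_Icc_self hI))).contMDiffAt)
      refine h2.congr_of_eventuallyEq ?_
      filter_upwards [continuousAt_snd.preimage_mem_nhds (isOpen_Ioo.mem_nhds hI)] with p hp
      have hp' : p.2 ∈ Ioo a b := hp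
      simp only [hΓ, hp', if_true]
      rfl
    · have h1 := hγ.contMDiffAt (hJ.mem_nhds ht)
      have h2 : ContMDiffAt 𝓘(ℝ, ℝ × ℝ) 𝓘(ℝ, ℝ) ∞ (fun p : ℝ × ℝ => p.2) (s, t) :=
        contDiffAt_snd.contMDiffAt
      have h3 : ContMDiffAt 𝓘(ℝ, ℝ × ℝ) 𝓘(ℝ, E) ∞ (γ ∘ fun p : ℝ × ℝ => p.2) (s, t) :=
        ContMDiffAt.comp (s, t) h1 h2
      refine h3.congr_of_eventuallyEq ?_
      filter_upwards [continuousAt_snd.preimage_mem_nhds (hJ.mem_nhds ht),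
        continuousAt_snd.preimage_mem_nhds (Metric.isClosed_closedBall.isOpen_compl.mem_nhds
          (fun h => hI (hsub h) : t ∉ Metric.closedBall t₀ (r / 2)))] with p hp hp'
      exact hΓγ _ _ hp (hχ0 _ hp')
  have hΓ0 : ∀ t ∈ J, Γ 0 t = γ t := by
    intro t ht
    by_cases hI : t ∈ Ioo a b
    · have : g (0, t) = ψ (γ t) := by simp [hg, hu, coordCurve, hψ]
      simp only [hΓ, hI, if_true, this]
      exact ψ.left_inv (hIA (Ioo_subset_Icc_self hI)).2
    · simp only [hΓ, hI, if_false]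
  refine ⟨a, b, hab, ⟨by rw [ha]; linarith, by rw [hb]; linarith⟩,
    hIA.trans inter_subset_left, ε, hε, Γ, hsm, hΓ0, fun s _ t ht => ?_, χ, χ.continuous,
    fun t => χ.nonneg, χ.one_of_mem_closedBall (Metric.mem_closedBall_self χ.rIn_pos.le), ?_⟩
  · exact hΓγ s t ht.1 (hχ0 t fun h => ht.2 (hsub h))
  · intro t ht
    have htA := hIA ht
    refine toChart_injective (x₀ := x₀) htA.2 ?_
    have h1 := coordAlong_variationField (x₀ := x₀) isOpen_Ioo hJ hsm h0ε hΓ0 htA.1 htA.2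
    rw [coordAlong] at h1
    rw [h1, map_smul]
    have e : (fun s => coordVariation E x₀ Γ (s, t)) =ᶠ[𝓝 0] fun s => u t + s • (χ t • w t) := by
      filter_upwards [isOpen_Ioo.mem_nhds h0ε] with s hs
      have h2 : g (s, t) = u t + s • (χ t • w t) := by simp only [hg, smul_smul]
      rw [← h2, coordVariation]
      by_cases hI : t ∈ Ioo a b
      · simp only [hΓ, hI, if_true]
        exact ψ.right_inv (hgt s hs t ht)
      · have h3 := hχ0 t fun h => hI (hsub h)
        simp only [hΓ, hI, if_false]
        simp [hg, h3, hu, coordCurve]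
    rw [e.deriv_eq]
    have h4 : HasDerivAt (fun s : ℝ => u t + s • (χ t • w t)) ((1 : ℝ) • (χ t • w t)) 0 :=
      ((hasDerivAt_id (0 : ℝ)).smul_const _).const_add _
    rw [h4.deriv, one_smul]
    rfl

variable [Bundle.RiemannianBundle (fun x : M => TangentSpace 𝓘(ℝ, E) x)]
  [IsContMDiffRiemannianBundle 𝓘(ℝ, E) ∞ E (fun x : M => TangentSpace 𝓘(ℝ, E) x)]
  {cov : CovariantDerivative 𝓘(ℝ, E) E (fun x : M => TangentSpace 𝓘(ℝ, E) x)}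
  {φ : ∀ x : M, TangentSpace 𝓘(ℝ, E) x →L[ℝ] TangentSpace 𝓘(ℝ, E) x}
  {ξ : ∀ x : M, TangentSpace 𝓘(ℝ, E) x} {η : ∀ x : M, TangentSpace 𝓘(ℝ, E) x →L[ℝ] ℝ} {c : ℝ}

/-- The Euler-Lagrange equation of `E_{δ₁,δ₂}`, for a Legendre curve in a Sasakian space form with
`∇_T T` parallel to `φ T`. -/
theorem isInterpolatingSesquiHarmonic_iff (hcov : IsLeviCivita cov) (hSas : IsSasakian φ ξ η)
    (hc : HasConstantPhiSectionalCurvature cov φ η c) (hJ : IsOpen J)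
    (hγ : ContMDiffOn 𝓘(ℝ, ℝ) 𝓘(ℝ, E) ∞ γ J)
    (h1 : ∀ t ∈ J, ‖velocity (I := 𝓘(ℝ, E)) γ t‖ = 1)
    (h0 : ∀ t ∈ J, η (γ t) (velocity (I := 𝓘(ℝ, E)) γ t) = 0)
    (hτ : ∀ t ∈ J, ∃ b : ℝ, tension cov γ t = b • φ (γ t) (velocity (I := 𝓘(ℝ, E)) γ t))
    (δ₁ δ₂ : ℝ) :
    IsInterpolatingSesquiHarmonic cov δ₁ δ₂ J γ ↔
      ∀ t ∈ J, eulerLagrange cov δ₁ δ₂ c γ t = 0 := by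
  have hW := smoothAlong_eulerLagrange hcov δ₁ δ₂ c hJ hγ
  constructor
  · intro h t₀ ht₀
    -- Take the Euler-Lagrange field itself as direction. The first variation is then `∫ 2χ‖W‖²`, a
    -- continuous nonnegative integrand, positive at `t₀` unless `W` vanishes there.
    obtain ⟨a, b, hab, htab, hJab, ε, hε, Γ, hΓ, hΓ0, hsupp, χ, hχc, hχ0, hχ1, hV⟩ :=
      exists_variation hJ hγ hW ht₀
    have h0ε : (0 : ℝ) ∈ Ioo (-ε) ε := ⟨by linarith, hε⟩
    have e := (h a b hab hJab ε hε Γ hΓ hΓ0 hsupp).unique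
      (hasDerivAt_sesquiEnergy hcov hSas hc isOpen_Ioo hJ hΓ h0ε hΓ0 h1 h0 hτ δ₁ δ₂ hab hJab hsupp)
    have e2 : ∫ t in a..b, 2 * (inner ℝ (variationField E γ Γ t)
        (eulerLagrange cov δ₁ δ₂ c γ t) : ℝ) =
        ∫ t in a..b, 2 * (χ t * inner ℝ (eulerLagrange cov δ₁ δ₂ c γ t)
          (eulerLagrange cov δ₁ δ₂ c γ t)) := by
      refine intervalIntegral.integral_congr fun t ht => ?_
      rw [uIcc_of_le hab.le] at ht
      simp only [hV t ht, real_inner_smul_left]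
    rw [e2] at e
    by_contra hne
    refine (intervalIntegral.integral_pos hab ?_ ?_ ⟨t₀, htab, ?_⟩).ne e
    · exact continuousOn_const.mul (hχc.continuousOn.mul
        ((contDiffOn_inner_along hW hW hJ hγ).continuousOn.mono hJab))
    · exact fun t _ => mul_nonneg zero_le_two (mul_nonneg (hχ0 t) real_inner_self_nonneg)
    · rw [hχ1, one_mul]
      exact mul_pos zero_lt_two (real_inner_self_pos.mpr hne)
  · intro h a b hab hJab ε hε Γ hΓ hΓ0 hsupp
    have h0ε : (0 : ℝ) ∈ Ioo (-ε) ε := ⟨by linarith, hε⟩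
    refine (hasDerivAt_sesquiEnergy hcov hSas hc isOpen_Ioo hJ hΓ h0ε hΓ0 h1 h0 hτ δ₁ δ₂ hab hJab
      hsupp).congr_deriv ?_
    rw [intervalIntegral.integral_congr (g := fun _ => 0), intervalIntegral.integral_zero]
    intro t ht
    rw [uIcc_of_le hab.le] at ht
    simp only [h t (hJab ht), inner_zero_right, mul_zero]

end CriticalPoints

end SesquiHarmonic

namespace SesquiHarmonic

/-! ### Legendre Frenet curves with `φ T` parallel to `E₂` -/

section Frenet

set_option linter.unusedSectionVars false

variable {E : Type*} [NormedAddCommGroup E] [NormedSpace ℝ E] [FiniteDimensional ℝ E]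
  {M : Type*} [TopologicalSpace M] [T2Space M] [ChartedSpace E M] [IsManifold 𝓘(ℝ, E) ∞ M]
  [Bundle.RiemannianBundle (fun x : M => TangentSpace 𝓘(ℝ, E) x)]
  [IsContMDiffRiemannianBundle 𝓘(ℝ, E) ∞ E (fun x : M => TangentSpace 𝓘(ℝ, E) x)]
  {cov : CovariantDerivative 𝓘(ℝ, E) E (fun x : M => TangentSpace 𝓘(ℝ, E) x)}
  {φ : ∀ x : M, TangentSpace 𝓘(ℝ, E) x →L[ℝ] TangentSpace 𝓘(ℝ, E) x}
  {ξ : ∀ x : M, TangentSpace 𝓘(ℝ, E) x} {η : ∀ x : M, TangentSpace 𝓘(ℝ, E) x →L[ℝ] ℝ} {c : ℝ}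
  {γ : ℝ → M} {J : Set ℝ} {t : ℝ}

lemma IsSasakian.inner_xi (hcov : IsLeviCivita cov) (hS : IsSasakian φ ξ η)
    (hc : HasConstantPhiSectionalCurvature cov φ η c) (x : M) (v : TangentSpace 𝓘(ℝ, E) x) :
    inner ℝ (ξ x) v = η x v := by
  have hx : x ∈ frameNhd E x := mem_frameNhd_self
  have hl := (hS.isLocalSasakiSpaceForm hcov hc x).contactSpace _ (chartAt_mem_chartNhd hx)
  rw [inner_eq_localMetric hx, ← coordField_chartAt hx.1 ξ, hl.xi_inner, form_eq_localForm hx.1]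

/-- From `2ff' = 0`. Used for the sign functions `a`, `k₂` and `a k₂`, which enter the Leibniz rule.
-/
lemma deriv_eq_zero_of_sq_eq_one {f : ℝ → ℝ} (hJ : IsOpen J) (hf : ContDiffOn ℝ ∞ f J)
    (h : ∀ t ∈ J, f t ^ 2 = 1) (ht : t ∈ J) : deriv f t = 0 := by
  have hd := (ContDiffOn.differentiableAt_of_isOpen hf hJ ht).hasDerivAt
  have h1 := hd.pow 2
  have h2 : HasDerivAt (f ^ 2) 0 t := by
    refine (hasDerivAt_const t (1 : ℝ)).congr_of_eventuallyEq ?_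
    filter_upwards [hJ.mem_nhds ht] with s hs using h s hs
  have h3 := h1.unique h2
  have h4 : f t ≠ 0 := fun h0 => by simpa [h0] using h t ht
  simpa [h4] using h3

lemma contDiffOn_deriv_infty {f : ℝ → ℝ} (hJ : IsOpen J) (hf : ContDiffOn ℝ ∞ f J) :
    ContDiffOn ℝ ∞ (deriv f) J := fun _ ht =>
  (contDiffAt_deriv_infty (hf.contDiffAt (hJ.mem_nhds ht))).contDiffWithinAt

section Frame

variable {T N Z : ∀ t, TangentSpace 𝓘(ℝ, E) (γ t)} {f a : ℝ → ℝ}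

/-- Covariant derivative of a linear combination of fields `T`, `N`, `Z` with
`∇T = fN`, `∇N = -fT + aZ`, `∇Z = -aN`. -/
lemma covDerivAlong_frame (hJ : IsOpen J) (hγ : ContMDiffOn 𝓘(ℝ, ℝ) 𝓘(ℝ, E) ∞ γ J)
    (hT : SmoothAlong J γ T) (hN : SmoothAlong J γ N) (hZ : SmoothAlong J γ Z)
    (dT : ∀ t ∈ J, covDerivAlong cov γ T t = f t • N t)
    (dN : ∀ t ∈ J, covDerivAlong cov γ N t = -(f t • T t) + a t • Z t)
    (dZ : ∀ t ∈ J, covDerivAlong cov γ Z t = -(a t • N t))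
    {p q h : ℝ → ℝ} (hp : ContDiffOn ℝ ∞ p J) (hq : ContDiffOn ℝ ∞ q J) (hh : ContDiffOn ℝ ∞ h J)
    {V : ∀ t, TangentSpace 𝓘(ℝ, E) (γ t)}
    (hV : ∀ t ∈ J, V t = p t • N t + q t • T t + h t • Z t) (ht : t ∈ J) :
    covDerivAlong cov γ V t = (deriv p t + q t * f t - h t * a t) • N t
      + (deriv q t - p t * f t) • T t + (deriv h t + p t * a t) • Z t := by
  rw [covDerivAlong_congr hJ ht hV,
    covDerivAlong_add ((hN.smul hp hJ hγ).add (hT.smul hq hJ hγ) hJ hγ) (hZ.smul hh hJ hγ) hJ hγ ht,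
    covDerivAlong_add (hN.smul hp hJ hγ) (hT.smul hq hJ hγ) hJ hγ ht,
    covDerivAlong_smul hp hN hJ hγ ht, covDerivAlong_smul hq hT hJ hγ ht,
    covDerivAlong_smul hh hZ hJ hγ ht, dT t ht, dN t ht, dZ t ht]
  module

/-- `covDerivAlong_frame` applied twice, starting from `τ = fN`. Since `a² = 1` and `a' = 0`, the
sign `a` disappears from the `N`-component, and the `T`- and `Z`-components are proportional to
`f'`. -/
lemma eulerLagrange_frame (hJ : IsOpen J) (hγ : ContMDiffOn 𝓘(ℝ, ℝ) 𝓘(ℝ, E) ∞ γ J)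
    (hT : SmoothAlong J γ T) (hN : SmoothAlong J γ N) (hZ : SmoothAlong J γ Z)
    (dT : ∀ t ∈ J, covDerivAlong cov γ T t = f t • N t)
    (dN : ∀ t ∈ J, covDerivAlong cov γ N t = -(f t • T t) + a t • Z t)
    (dZ : ∀ t ∈ J, covDerivAlong cov γ Z t = -(a t • N t))
    (hf : ContDiffOn ℝ ∞ f J) (ha : ContDiffOn ℝ ∞ a J) (ha1 : ∀ t ∈ J, a t ^ 2 = 1)
    (hτ : ∀ t ∈ J, tension cov γ t = f t • N t) (δ₁ δ₂ : ℝ) (ht : t ∈ J) :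
    eulerLagrange cov δ₁ δ₂ c γ t =
      (δ₂ * (deriv (deriv f) t - f t ^ 3 - f t + c * f t) - δ₁ * f t) • N t
      + (-(3 * δ₂ * (f t * deriv f t))) • T t + (2 * δ₂ * (deriv f t * a t)) • Z t := by
  have e1 : ∀ t ∈ J, covDerivAlong cov γ (tension cov γ) t =
      deriv f t • N t + (-(f t ^ 2)) • T t + (f t * a t) • Z t := by
    intro t ht
    rw [covDerivAlong_frame hJ hγ hT hN hZ dT dN dZ hf (contDiffOn_const (c := 0))
      (contDiffOn_const (c := 0)) (V := tension cov γ)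
      (fun t ht => by rw [hτ t ht, zero_smul, zero_smul, add_zero, add_zero]) ht]
    simp only [deriv_const]
    module
  have e2 := covDerivAlong_frame hJ hγ hT hN hZ dT dN dZ (contDiffOn_deriv_infty hJ hf)
    ((hf.pow 2).neg) (hf.mul ha) e1 ht
  have hfd := (ContDiffOn.differentiableAt_of_isOpen hf hJ ht).hasDerivAt
  have had := (ContDiffOn.differentiableAt_of_isOpen ha hJ ht).hasDerivAt
  have d1 : deriv (fun t => -(f t ^ 2)) t = -(2 * f t * deriv f t) := by
    simpa using (hfd.fun_pow 2).fun_neg.deriv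
  have d2 : deriv (fun t => f t * a t) t = deriv f t * a t := by
    rw [(hfd.fun_mul had).deriv, deriv_eq_zero_of_sq_eq_one hJ ha ha1 ht, mul_zero, add_zero]
  rw [d1, d2] at e2
  rw [eulerLagrange, e2, hτ t ht]
  have h2 : deriv (deriv f) t + -f t ^ 2 * f t - f t * a t * a t =
      deriv (deriv f) t - f t ^ 3 - f t := by
    linear_combination (-f t) * ha1 t ht
  rw [h2]
  module

end Frame

variable {r : ℕ} {F : ℕ → ∀ t : ℝ, TangentSpace 𝓘(ℝ, E) (γ t)} {k : ℕ → ℝ → ℝ}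

lemma IsFrenetCurve.inner_self (h : IsFrenetCurve cov J γ r F k) (ht : t ∈ J) {i : ℕ}
    (hi : i ∈ Finset.Icc 1 r) : (inner ℝ (F i t) (F i t) : ℝ) = 1 := by
  rw [h.orthonormal t ht i hi i hi, if_pos rfl]

lemma IsFrenetCurve.inner_of_ne (h : IsFrenetCurve cov J γ r F k) (ht : t ∈ J) {i j : ℕ}
    (hi : i ∈ Finset.Icc 1 r) (hj : j ∈ Finset.Icc 1 r) (hij : i ≠ j) :
    (inner ℝ (F i t) (F j t) : ℝ) = 0 := by
  rw [h.orthonormal t ht i hi j hj, if_neg hij]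

/-- The structure of a Legendre Frenet curve with `φ T` parallel to `E₂`: the third field of its
Frenet frame is `±ξ`, its second curvature is `±1` and its third curvature vanishes. -/
lemma IsFrenetCurve.phi_parallel (hcov : IsLeviCivita cov) (hS : IsSasakian φ ξ η)
    (hc : HasConstantPhiSectionalCurvature cov φ η c) (hJ : IsOpen J)
    (h : IsFrenetCurve cov J γ r F k) (hL : IsLegendre η J γ) (hgeod : ∃ t ∈ J, k 1 t ≠ 0)
    (hpar : ∀ t ∈ J, ∃ a : ℝ, φ (γ t) (F 1 t) = a • F 2 t) :
    3 ≤ r ∧ ContDiffOn ℝ ∞ (k 1) J ∧ ContDiffOn ℝ ∞ (k 2) J ∧ (∀ t ∈ J, k 2 t ^ 2 = 1) ∧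
    (∀ t ∈ J, k 3 t = 0) ∧ ∃ a : ℝ → ℝ, ContDiffOn ℝ ∞ a J ∧ (∀ t ∈ J, a t ^ 2 = 1) ∧
      (∀ t ∈ J, φ (γ t) (F 1 t) = a t • F 2 t) ∧ (∀ t ∈ J, ξ (γ t) = (a t * k 2 t) • F 3 t) := by
  have hγ := h.smooth
  obtain ⟨t₁, ht₁, hk₁⟩ := hgeod
  -- For `r = 1` the convention `k i = 0` for `i ≥ r` would make `k₁` vanish identically.
  have hr2 : 2 ≤ r := by
    by_contra hlt
    exact hk₁ (h.curvature_of_ge 1 (by omega) t₁ ht₁)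
  have m1 : 1 ∈ Finset.Icc 1 r := by simp; omega
  have m2 : 2 ∈ Finset.Icc 1 r := by simp; omega
  have s1 : SmoothAlong J γ (F 1) := h.smooth_frame 1 m1
  have s2 : SmoothAlong J γ (F 2) := h.smooth_frame 2 m2
  have hξ : SmoothAlong J γ (fun t => ξ (γ t)) := hS.smooth_xi.smoothAlong hγ
  have hφ1 := s1.phi hS.toIsAlmostContactMetric hJ hγ
  have hη : ∀ t ∈ J, η (γ t) (F 1 t) = 0 := fun t ht => by rw [h.frame_one t ht]; exact hL t ht
  have d1 : ∀ t ∈ J, covDerivAlong cov γ (F 1) t = k 1 t • F 2 t := fun t ht => by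
    rw [h.frenet 1 m1 t ht, Nat.sub_self, h.curvature_zero t ht, zero_smul, neg_zero, zero_add]
  have d2 : ∀ t ∈ J, covDerivAlong cov γ (F 2) t = -(k 1 t • F 1 t) + k 2 t • F 3 t :=
    fun t ht => h.frenet 2 m2 t ht
  set a : ℝ → ℝ := fun t => inner ℝ (φ (γ t) (F 1 t)) (F 2 t) with ha
  have has : ContDiffOn ℝ ∞ a J := contDiffOn_inner_along hφ1 s2 hJ hγ
  have hpa : ∀ t ∈ J, φ (γ t) (F 1 t) = a t • F 2 t := by
    intro t ht
    obtain ⟨b, hb⟩ := hpar t ht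
    simp only [ha]
    rw [hb, real_inner_smul_left, h.inner_self ht m2, mul_one]
  have ha1 : ∀ t ∈ J, a t ^ 2 = 1 := by
    intro t ht
    have h1 := hS.inner_phi_phi (γ t) (F 1 t) (F 1 t)
    rw [hη t ht, h.inner_self ht m1, hpa t ht, real_inner_smul_left, real_inner_smul_right,
      h.inner_self ht m2] at h1
    linear_combination h1
  have hξ1 : ∀ x : M, (inner ℝ (ξ x) (ξ x) : ℝ) = 1 := fun x => by
    rw [hS.inner_xi hcov hc, hS.eta_xi]
  -- `ξ` is a multiple of `E₃`
  have hξk : ∀ t ∈ J, ξ (γ t) = (a t * k 2 t) • F 3 t := by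
    intro t ht
    -- `∇_T(φT)` in two ways: as `a(-k₁T + k₂E₃)`, since `a' = 0`, and as `k₁φE₂ + ξ`. Below, `φE₂ =
    -- -aT` from `φ²T = -T`, so the `T`-terms cancel.
    have e1 := covDerivAlong_phi hcov hS hc s1 hJ hγ ht
    rw [covDerivAlong_congr hJ ht hpa, covDerivAlong_smul has s2 hJ hγ ht,
      deriv_eq_zero_of_sq_eq_one hJ has ha1 ht, d2 t ht, d1 t ht, ← h.frame_one t ht,
      h.inner_self ht m1, hη t ht, map_smul] at e1
    have e2 : φ (γ t) (F 2 t) = -(a t • F 1 t) := by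
      have e3 := hS.phi_phi (γ t) (F 1 t)
      rw [hpa t ht, map_smul, hη t ht, zero_smul, add_zero] at e3
      have e4 := congrArg (fun v => a t • v) e3
      simp only [smul_smul, smul_neg] at e4
      rwa [← sq, ha1 t ht, one_smul] at e4
    rw [e2] at e1
    have e5 : ξ (γ t) = a t • (-(k 1 t • F 1 t) + k 2 t • F 3 t) + k 1 t • a t • F 1 t := by
      rw [zero_smul, zero_add] at e1
      rw [e1]
      module
    rw [e5]
    module
  -- For `r = 2` the convention gives `k₂ = 0`, hence `ξ = 0`, which contradicts `g(ξ,ξ) = 1`.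
  have hr3 : 3 ≤ r := by
    by_contra hlt
    have e1 := hξk t₁ ht₁
    rw [h.curvature_of_ge 2 (by omega) t₁ ht₁, mul_zero, zero_smul] at e1
    have e2 := hξ1 (γ t₁)
    rw [e1, inner_zero_left] at e2
    exact zero_ne_one e2
  have m3 : 3 ∈ Finset.Icc 1 r := by simp; omega
  have s3 : SmoothAlong J γ (F 3) := h.smooth_frame 3 m3
  have hk2 : ∀ t ∈ J, k 2 t ^ 2 = 1 := by
    intro t ht
    have e1 := hξ1 (γ t)
    rw [hξk t ht, real_inner_smul_left, real_inner_smul_right, h.inner_self ht m3] at e1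
    linear_combination e1 - k 2 t ^ 2 * ha1 t ht
  have k1s : ContDiffOn ℝ ∞ (k 1) J := by
    refine (contDiffOn_inner_along (s1.covDerivAlong hJ hγ hcov.smooth) s2 hJ hγ).congr
      fun t ht => ?_
    rw [d1 t ht, real_inner_smul_left, h.inner_self ht m2, mul_one]
  have k2s : ContDiffOn ℝ ∞ (k 2) J := by
    refine (contDiffOn_inner_along (s2.covDerivAlong hJ hγ hcov.smooth) s3 hJ hγ).congr
      fun t ht => ?_
    rw [d2 t ht, inner_add_left, inner_neg_left, real_inner_smul_left, real_inner_smul_left,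
      h.inner_self ht m3, h.inner_of_ne ht m1 m3 (by norm_num)]
    ring
  refine ⟨hr3, k1s, k2s, hk2, fun t ht => ?_, a, has, ha1, hpa, hξk⟩
  by_cases hr4 : 4 ≤ r
  · have m4 : 4 ∈ Finset.Icc 1 r := by simp; omega
    -- The factor `a k₂` is its own inverse and has zero derivative, so `∇_T E₃` is a multiple of
    -- `φT`, thus of `E₂`; its `E₄`-component is `k₃`.
    have e1 : ∀ t ∈ J, F 3 t = (a t * k 2 t) • ξ (γ t) := by
      intro t ht
      rw [hξk t ht, smul_smul]
      have : a t * k 2 t * (a t * k 2 t) = 1 := by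
        linear_combination a t ^ 2 * hk2 t ht + ha1 t ht
      rw [this, one_smul]
    have e2 := h.frenet 3 m3 t ht
    have e3 : deriv (fun t => a t * k 2 t) t = 0 := by
      refine deriv_eq_zero_of_sq_eq_one hJ (has.mul k2s) (fun t ht => ?_) ht
      linear_combination a t ^ 2 * hk2 t ht + ha1 t ht
    rw [covDerivAlong_congr hJ ht e1, covDerivAlong_smul (has.mul k2s) hξ hJ hγ ht, e3, zero_smul,
      zero_add, covDerivAlong_xi hcov hS hc hJ hγ ht, ← h.frame_one t ht, hpa t ht] at e2
    have e4 := congrArg (fun v => (inner ℝ v (F 4 t) : ℝ)) e2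
    simp only [inner_add_left, inner_neg_left, real_inner_smul_left] at e4
    rw [h.inner_of_ne ht m2 m4 (by norm_num), h.inner_self ht m4] at e4
    simpa using e4.symm
  · exact h.curvature_of_ge 3 (by omega) t ht

/-- Characterization of interpolating sesqui-harmonic Legendre curves with `φ T` parallel to `E₂`. -/
theorem IsFrenetCurve.isInterpolatingSesquiHarmonic_iff (hcov : IsLeviCivita cov)
    (hS : IsSasakian φ ξ η)
    (hc : HasConstantPhiSectionalCurvature cov φ η c) (hJ : IsOpen J) (hJ' : J.OrdConnected)
    (h : IsFrenetCurve cov J γ r F k) (hL : IsLegendre η J γ) (hgeod : ∃ t ∈ J, k 1 t ≠ 0)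
    (hpar : ∀ t ∈ J, ∃ a : ℝ, φ (γ t) (F 1 t) = a • F 2 t) {δ₁ δ₂ : ℝ} (hδ₂ : δ₂ ≠ 0) :
    IsInterpolatingSesquiHarmonic cov δ₁ δ₂ J γ ↔
      (∃ κ₁ : ℝ, 0 < κ₁ ∧ ∀ t ∈ J, k 1 t = κ₁) ∧
      (∃ κ₂ : ℝ, ∀ t ∈ J, k 2 t = κ₂) ∧
      (∀ t ∈ J, k 1 t ^ 2 + k 2 t ^ 2 = c - δ₁ / δ₂) ∧
      (∀ t ∈ J, k 2 t * k 3 t = 0) := by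
  have hγ := h.smooth
  obtain ⟨hr, k1s, k2s, hk2, hk3, a, has, ha1, hpa, hξk⟩ :=
    h.phi_parallel hcov hS hc hJ hL hgeod hpar
  have m1 : 1 ∈ Finset.Icc 1 r := by simp; omega
  have m2 : 2 ∈ Finset.Icc 1 r := by simp; omega
  have m3 : 3 ∈ Finset.Icc 1 r := by simp; omega
  have d1 : ∀ t ∈ J, covDerivAlong cov γ (F 1) t = k 1 t • F 2 t := fun t ht => by
    rw [h.frenet 1 m1 t ht, Nat.sub_self, h.curvature_zero t ht, zero_smul, neg_zero, zero_add]
  -- `ξ` is used in place of `E₃`: by `k₂E₃ = aξ` the fields `T, E₂, ξ` satisfy closed Frenet-type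
  -- equations with `a` as second curvature.
  have d2 : ∀ t ∈ J, covDerivAlong cov γ (F 2) t = -(k 1 t • F 1 t) + a t • ξ (γ t) := by
    intro t ht
    rw [h.frenet 2 m2 t ht, hξk t ht, smul_smul, ← mul_assoc, ← sq, ha1 t ht, one_mul]
  have d3 : ∀ t ∈ J, covDerivAlong cov γ (fun t => ξ (γ t)) t = -(a t • F 2 t) := by
    intro t ht
    rw [covDerivAlong_xi hcov hS hc hJ hγ ht, ← h.frame_one t ht, hpa t ht]
  have hτ : ∀ t ∈ J, tension cov γ t = k 1 t • F 2 t := by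
    intro t ht
    rw [tension, ← d1 t ht]
    exact covDerivAlong_congr hJ ht fun t ht => (h.frame_one t ht).symm
  have hEL := fun (t : ℝ) (ht : t ∈ J) => eulerLagrange_frame (c := c) hJ hγ (h.smooth_frame 1 m1)
    (h.smooth_frame 2 m2) (hS.smooth_xi.smoothAlong hγ) d1 d2 d3 k1s has ha1 hτ δ₁ δ₂ ht
  rw [SesquiHarmonic.isInterpolatingSesquiHarmonic_iff hcov hS hc hJ hγ (fun t ht => ?_) hL
    (fun t ht => ⟨k 1 t * a t, ?_⟩) δ₁ δ₂]
  rotate_left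
  · have h1 := h.inner_self ht m1
    rw [h.frame_one t ht, real_inner_self_eq_norm_sq] at h1
    nlinarith [norm_nonneg (velocity (I := 𝓘(ℝ, E)) γ t)]
  · rw [hτ t ht, ← h.frame_one t ht, hpa t ht, smul_smul, mul_assoc, ← sq, ha1 t ht, mul_one]
  constructor
  · intro h0
    -- The `E₃`-component is `2δ₂k₁'` times `a²k₂ = ±1`, so `k₁' = 0` even at points where `k₁`
    -- might vanish. The `E₂`-component is the scalar equation for `k₁`.
    have comp : ∀ t ∈ J, deriv (k 1) t = 0 ∧
        δ₂ * (deriv (deriv (k 1)) t - k 1 t ^ 3 - k 1 t + c * k 1 t) - δ₁ * k 1 t = 0 := by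
      intro t ht
      have e := h0 t ht
      rw [hEL t ht, hξk t ht] at e
      have e3 := congrArg (fun v => (inner ℝ v (F 3 t) : ℝ)) e
      have e2 := congrArg (fun v => (inner ℝ v (F 2 t) : ℝ)) e
      simp only [inner_add_left, real_inner_smul_left, inner_zero_left, h.inner_self ht m3,
        h.inner_self ht m2,
        h.inner_of_ne ht m2 m3 (by norm_num), h.inner_of_ne ht m1 m3 (by norm_num),
        h.inner_of_ne ht m1 m2 (by norm_num), h.inner_of_ne ht m3 m2 (by norm_num)] at e2 e3
      refine ⟨?_, by linarith⟩
      have e4 : 2 * δ₂ * (deriv (k 1) t) * (a t ^ 2 * k 2 t) = 0 := by linear_combination e3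
      rw [ha1 t ht, one_mul] at e4
      have hk : k 2 t ≠ 0 := fun h0 => by simpa [h0] using hk2 t ht
      simpa [hδ₂, hk] using e4
    obtain ⟨κ₁, hκ₁⟩ := hJ.exists_is_const_of_deriv_eq_zero hJ'.isPreconnected
      (k1s.differentiableOn (by simp)) fun t ht => (comp t ht).1
    obtain ⟨κ₂, hκ₂⟩ := hJ.exists_is_const_of_deriv_eq_zero hJ'.isPreconnected
      (k2s.differentiableOn (by simp)) fun t ht => deriv_eq_zero_of_sq_eq_one hJ k2s hk2 ht
    obtain ⟨t₁, ht₁, hne⟩ := hgeod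
    have hpos : 0 < κ₁ := by
      rw [← hκ₁ t₁ ht₁]
      exact (h.curvature_one_nonneg t₁ ht₁).lt_of_ne' hne
    refine ⟨⟨κ₁, hpos, hκ₁⟩, ⟨κ₂, hκ₂⟩, fun t ht => ?_, fun t ht => by rw [hk3 t ht, mul_zero]⟩
    have e1 : deriv (deriv (k 1)) t = 0 := by
      have : deriv (k 1) =ᶠ[𝓝 t] fun _ => 0 := by
        filter_upwards [hJ.mem_nhds ht] with s hs using (comp s hs).1
      rw [this.deriv_eq, deriv_const]
    have e2 := (comp t ht).2
    rw [e1, hκ₁ t ht] at e2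
    rw [hk2 t ht, hκ₁ t ht, eq_sub_iff_add_eq]
    field_simp
    -- With `k₁'' = 0` the scalar equation has the factor `κ₁`, which is positive.
    have e3 : κ₁ * (δ₂ * (κ₁ ^ 2 + 1 - c) + δ₁) = 0 := by linear_combination -e2
    have e4 := (mul_eq_zero.mp e3).resolve_left hpos.ne'
    linear_combination e4
  -- Constancy of `k₁` annihilates the `T`- and `ξ`-components, and the relation between the
  -- curvatures, multiplied by `k₁`, the `E₂`-component.
  · rintro ⟨⟨κ₁, -, hκ₁⟩, -, hsum, -⟩ t ht
    have e0 : ∀ t ∈ J, deriv (k 1) t = 0 := by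
      intro t ht
      have : k 1 =ᶠ[𝓝 t] fun _ => κ₁ := by
        filter_upwards [hJ.mem_nhds ht] with s hs using hκ₁ s hs
      rw [this.deriv_eq, deriv_const]
    have e1 : deriv (deriv (k 1)) t = 0 := by
      have : deriv (k 1) =ᶠ[𝓝 t] fun _ => 0 := by
        filter_upwards [hJ.mem_nhds ht] with s hs using e0 s hs
      rw [this.deriv_eq, deriv_const]
    have e2 := hsum t ht
    rw [hk2 t ht, eq_sub_iff_add_eq] at e2
    field_simp at e2
    rw [hEL t ht, e0 t ht, e1]
    have e3 : δ₂ * (0 - k 1 t ^ 3 - k 1 t + c * k 1 t) - δ₁ * k 1 t = 0 := by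
      linear_combination -k 1 t * e2
    rw [e3]
    simp

end Frenet

end SesquiHarmonic

/-- The characterization over an arbitrary finite-dimensional model space, specialized to
`ℝ^(2n+1)`; order-connectedness of the open set `J` encodes that it is an interval. -/
theorem mainTheorem6 (n : ℕ)
    {M : Type*} [TopologicalSpace M] [T2Space M]
    [ChartedSpace (EuclideanSpace ℝ (Fin (2 * n + 1))) M] [IsManifold (𝓡 (2 * n + 1)) ∞ M]
    -- the Riemannian metric `g`
    [Bundle.RiemannianBundle (fun x : M => TangentSpace (𝓡 (2 * n + 1)) x)]
    [IsContMDiffRiemannianBundle (𝓡 (2 * n + 1)) ∞ (EuclideanSpace ℝ (Fin (2 * n + 1)))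
      (fun x : M => TangentSpace (𝓡 (2 * n + 1)) x)]
    -- its Levi-Civita connection
    (cov : CovariantDerivative (𝓡 (2 * n + 1)) (EuclideanSpace ℝ (Fin (2 * n + 1)))
      (fun x : M => TangentSpace (𝓡 (2 * n + 1)) x))
    (hcov : SesquiHarmonic.IsLeviCivita cov)
    -- the Sasakian space form `M(c)`
    (φ : ∀ x : M, TangentSpace (𝓡 (2 * n + 1)) x →L[ℝ] TangentSpace (𝓡 (2 * n + 1)) x)
    (ξ : ∀ x : M, TangentSpace (𝓡 (2 * n + 1)) x)
    (η : ∀ x : M, TangentSpace (𝓡 (2 * n + 1)) x →L[ℝ] ℝ)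
    (hSasaki : SesquiHarmonic.IsSasakian φ ξ η)
    (c : ℝ) (hcurv : SesquiHarmonic.HasConstantPhiSectionalCurvature cov φ η c) (hc : c ≠ 1)
    -- the Legendre curve `γ : J → M` of osculating order `r`, not a geodesic, with `φT ∥ E₂`
    (J : Set ℝ) (hJ : IsOpen J) (hJ' : J.OrdConnected) (γ : ℝ → M) (r : ℕ)
    (F : ℕ → ∀ t : ℝ, TangentSpace (𝓡 (2 * n + 1)) (γ t)) (k : ℕ → ℝ → ℝ)
    (hFrenet : SesquiHarmonic.IsFrenetCurve cov J γ r F k)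
    (hLegendre : SesquiHarmonic.IsLegendre η J γ)
    (hgeod : ∃ t ∈ J, k 1 t ≠ 0)
    (hpar : ∀ t ∈ J, ∃ a : ℝ, φ (γ t) (F 1 t) = a • F 2 t)
    (δ₁ δ₂ : ℝ) (hδ₂ : δ₂ ≠ 0) (hδ : δ₁ / δ₂ ≠ 0) :
    SesquiHarmonic.IsInterpolatingSesquiHarmonic cov δ₁ δ₂ J γ ↔
      (∃ κ₁ : ℝ, 0 < κ₁ ∧ ∀ t ∈ J, k 1 t = κ₁) ∧
      (∃ κ₂ : ℝ, ∀ t ∈ J, k 2 t = κ₂) ∧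
      (∀ t ∈ J, k 1 t ^ 2 + k 2 t ^ 2 = c - δ₁ / δ₂) ∧
      (∀ t ∈ J, k 2 t * k 3 t = 0) := by
  exact hFrenet.isInterpolatingSesquiHarmonic_iff hcov hSasaki hcurv hJ hJ' hLegendre hgeod hpar hδ₂
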